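/- **Setting.** Let $\Lambda=[-L/2,L/2]^d$ with periodic boundary conditions, $k_{\mathbf j}=\frac{2\pi}{L}\mathbf j$ for $\mathbf j\in\mathbb Z^d$, and let $\phi$ be a bounded, real-valued, periodic, even pair potential with nonnegative Fourier components $\phi_{\mathbf j}$, where $\phi(x)=|\Lambda|^{-1}\sum_{\mathbf j}\phi_{\mathbf j}e^{ik_{\mathbf j}\cdot x}$, of which those with $\mathbf j\ne\mathbf 0$ are nonzero exactly for $\mathbf j\in\{\pm\mathbf j_1,\dots,\pm\mathbf j_M\}$ ($M$ distinct couples). On the $N$-particle sector $\mathcal F^N$ of the bosonic Fock space over $L^2(\Lambda)$ put, with $k^2_{\mathbf j}=|k_{\mathbf j}|^2$, $$W_{\mathbf j}=\tfrac{\phi_{\mathbf j}}{N}a^*_{\mathbf 0}a^*_{\mathbf 0}a_{\mathbf j}a_{-\mathbf j},\qquad W^*_{\mathbf j}=\tfrac{\phi_{\mathbf j}}{N}a_{\mathbf 0}a_{\mathbf 0}a^*_{\mathbf j}a^*_{-\mathbf j},\qquad \hat H^{Bog}_{\mathbf j}=\Big(k_{\mathbf j}^2+\tfrac{\phi_{\mathbf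 j}}{N}a^*_{\mathbf 0}a_{\mathbf 0}\Big)(a^*_{\mathbf j}a_{\mathbf j}+a^*_{-\mathbf j}a_{-\mathbf j})+W_{\mathbf j}+W^*_{\mathbf j},$$ $$H^{Bog}_{\mathbf j_1,\dots,\mathbf j_m}=\sum_{\mathbf j\notin\{\pm\mathbf j_1,\dots,\pm\mathbf j_m\}}k_{\mathbf j}^2a^*_{\mathbf j}a_{\mathbf j}+\sum_{l=1}^m\hat H^{Bog}_{\mathbf j_l}.$$ Let $z^{Bog}_{m-1}$ be the ground state energy (infimum of the spectrum) of $H^{Bog}_{\mathbf j_1,\dots,\mathbf j_{m-1}}$ ($z^{Bog}_0=0$), $\epsilon=\epsilon_{\mathbf j_m}=k^2_{\mathbf j_m}/\phi_{\mathbf j_m}$ and $E^{Bog}_{\mathbf j_m}=-\big[k^2_{\mathbf j_m}+\phi_{\mathbf j_m}-\sqrt{(k^2_{\mathbf j_m})^2+2\phi_{\mathbf j_m}k^2_{\mathbf j_m}}\big]$. For even $0\le i\le N-2$ let $Q_i$ be the projection onto the states with $N-i$ or $N-i-1$ particles in the modes $\pm\mathbf j_m$, and put, for real $w$, $$W_{i,i-2}=Q_iW_{\mathbf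 j_m}Q_{i-2},\quad W^*_{i-2,i}=Q_{i-2}W^*_{\mathbf j_m}Q_i,\quad R_i=R_i(w)=Q_i\big[Q_i(H^{Bog}_{\mathbf j_1,\dots,\mathbf j_m}-w)Q_i\big]^{-1}Q_i,$$ $\Gamma_2=W_{2,0}R_0W^*_{0,2}$ and $\Gamma_i=W_{i,i-2}R_{i-2}\sum_{n\ge0}[\Gamma_{i-2}R_{i-2}]^nW^*_{i-2,i}$ for even $4\le i\le N-2$. **Terms of the expansion.** Write $D_j[X]=W_{j,j-2}R_{j-2}^{1/2}XR_{j-2}^{1/2}W^*_{j-2,j}$ and $\langle X\rangle_i=R_i^{1/2}XR_i^{1/2}$. Put $\Gamma_j^{(0)}=W_{j,j-2}R_{j-2}W^*_{j-2,j}$ for $j\ge 2$ and $\Gamma_j^{(>0)}=D_j\big[\sum_{n=1}^{h-1}\langle\Gamma^{(0)}_{j-2}\rangle_{j-2}^n\big]$ for $j\ge4$. For $h\ge2$ and even $4\le j\le N-2$, $2\le l\le j-2$ the operators $\Gamma_j^{l,-}=[\Gamma_{j,j}(w)]_{(l,h_-;l+2,h_-;\dots;j-2,h_-)}$ and $\Gamma_j^{l,+}=[\Gamma_{j,j}(w)]_{(l,h_+;l+2,h_-;\dots;j-2,h_-)}$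 are defined recursively ($s,s'$ are even below). * $\Gamma_j^{j-2,-}=\Gamma_j^{(0)}+\Gamma_j^{(>0)}$ and $\Gamma_j^{j-2,+}=D_j\big[\sum_{n\ge h}\langle\Gamma_{j-2}\rangle_{j-2}^n\big]$. * $\Gamma_j^{j-4,-}=D_j[S]$, where $S$ is the sum over $1\le n\le h-1$ of all products of $n$ factors, each equal to $\langle\Gamma_{j-2}^{(0)}\rangle_{j-2}$ or $\langle\Gamma_{j-2}^{(>0)}\rangle_{j-2}$, the latter occurring at least once. * For $l\le j-6$, $\Gamma_j^{l,-}=D_j[S]$, where $S$ is the sum over $1\le n\le h-1$ of all products of $n$ factors $\langle\Gamma_{j-2}^{s,-}\rangle_{j-2}$, $l\le s\le j-4$, the value $s=l$ occurring at least once. * For $l\le j-4$, $\Gamma_j^{l,+}=D_j[S]$, where $S$ is the sum over $1\le n\le h-1$ of all products of $n$ factors, each of the form $\langle\Gamma_{j-2}^{s,+}\rangle_{j-2}$ with $l\le s\le j-4$ or $\langle\Gamma_{j-2}^{s',-}\rangle_{j-2}$ with $2\le s'\le j-4$, the factor $\langle\Gamma_{j-2}^{l,+}\rangle_{j-2}$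 occurring at least once. **Constants.** Let $\nu>\frac{11}8$, $\Theta=\min\{2(\nu-\frac{11}8),\frac14\}$, $\eta=1-\sqrt\epsilon$. With $\chi_{[0,2)}$ the characteristic function of $[0,2)$, let $b_\epsilon=(1+\epsilon)\delta\chi_{[0,2)}(\delta)\sqrt{\epsilon^2+2\epsilon}$ and $c_\epsilon=-(1-\delta^2\chi_{[0,2)}(\delta))(\epsilon^2+2\epsilon)$, both at $\delta=1+\sqrt\epsilon$. Given a value $a_\epsilon$, let $$K_{i,\epsilon}=\frac1{4\big(1+a_\epsilon-\frac{2b_\epsilon}{N-i+1}-\frac{1-c_\epsilon}{(N-i+1)^2}\big)},\qquad Z_{i,\epsilon}=K_{i,\epsilon}\,\frac{2}{1+\sqrt{\eta a_\epsilon}-\frac{b_\epsilon/\sqrt{\eta a_\epsilon}}{N-i+2-\epsilon^\Theta}}.$$ **Statement.** For every $\nu>\frac{11}8$ there are a function $\epsilon\mapsto a_\epsilon$ with $a_\epsilon=2\epsilon+\mathcal O(\epsilon^\nu)$ as $\epsilon\downarrow0$ and an $\epsilon_0>0$ such that for all $d$, $L>0$, $\phi$ as above and $1\le m\le M$ with $\epsilon=\epsilon_{\mathbf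 j_m}\le\epsilon_0$ there is an $N_0$ such that for every even $N\ge N_0$ for which $$\inf\operatorname{spec}\Big[\sum_{l=1}^{m-1}\hat H^{Bog}_{\mathbf j_l}\Big]-z^{Bog}_{m-1}\ \ge\ -\frac{m-1}{(\ln N)^{1/8}},$$ and all real $\delta\le1+\sqrt\epsilon$ and $w\le z^{Bog}_{m-1}+E^{Bog}_{\mathbf j_m}+(\delta-1)\phi_{\mathbf j_m}\sqrt{\epsilon^2+2\epsilon}$, the following holds. The resolvents $R_i(w)$, $0\le i\le N-2$ even, exist as bounded nonnegative operators; for even $2\le i\le N-4$ the series $\sum_n[\Gamma_iR_i]^n$ and $\sum_n\langle\Gamma_i\rangle_i^n$ converge in operator norm; $K_{f,\epsilon}>0$ and $0<Z_{f-2,\epsilon}<1$ for even $4\le f\le N-2$; and for every integer $h\ge2$ and every even $4\le i\le N-2$ $$\Gamma_{i}=\sum_{\substack{l=2\\ l\text{ even}}}^{i-2}\Gamma_i^{l,-}+\sum_{\substack{l=2\\ l\text{ even}}}^{i-2}\Gamma_i^{l,+},$$ and for every even $2\le l\le i-2$ $$\big\|R_i^{1/2}\,\Gamma_i^{l,-}R_i^{1/2}\big\|\le\prod_{\substack{f=l+2\\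 f\text{ even}}}^{i}\frac{K_{f,\epsilon}}{(1-Z_{f-2,\epsilon})^2},\qquad \big\|R_i^{1/2}\,\Gamma_i^{l,+}R_i^{1/2}\big\|\le (Z_{l,\epsilon})^h\prod_{\substack{f=l+2\\ f\text{ even}}}^{i}\frac{K_{f,\epsilon}}{(1-Z_{f-2,\epsilon})^2}.$$ -/

import Mathlib

open Filter Topology MeasureTheory Asymptotics

noncomputable section

namespace BoseGas

/-! ## Occupation-number representation of the bosonic Fock space -/

/-- Momentum labels `𝐣 ∈ ℤ^d`. -/
abbrev Mode (d : ℕ) : Type := Fin d → ℤ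

/-- Occupation-number configurations: finitely many particles distributed over the modes. -/
abbrev Conf (d : ℕ) : Type := Mode d →₀ ℕ

/-- Configurations with exactly `N` particles. -/
abbrev NConf (d N : ℕ) : Type := {n : Conf d // n.degree = N}

/-- The Hilbert space `ℓ²(X)`. -/
abbrev EllTwo (X : Type) : Type := lp (fun _ : X => ℂ) 2

/-- The `N`-particle sector of the bosonic Fock space over `L²(Λ)`, in the orthonormal basis of
occupation-number states of the plane-wave modes. -/
abbrev FockN (d N : ℕ) : Type := EllTwo (NConf d N)

/-- Linear maps on arbitrary (not necessarily square-summable) coefficient families. -/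
abbrev FormalOp (X : Type) : Type := (X → ℂ) →ₗ[ℂ] (X → ℂ)

/-- The annihilation operator `a_𝐣`, i.e. `a_𝐣 |n⟩ = √(n_𝐣) |n - 1_𝐣⟩`, on coefficients. -/
def ann {d : ℕ} (j : Mode d) : FormalOp (Conf d) where
  toFun ψ n := (Real.sqrt (n j + 1) : ℂ) * ψ (n + Finsupp.single j 1)
  map_add' ψ χ := by funext n; simp [mul_add]
  map_smul' c ψ := by funext n; simp [mul_left_comm]

/-- The creation operator `a*_𝐣`, i.e. `a*_𝐣 |n⟩ = √(n_𝐣 + 1) |n + 1_𝐣⟩`, on coefficients. -/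
def cre {d : ℕ} (j : Mode d) : FormalOp (Conf d) where
  toFun ψ n := (Real.sqrt (n j) : ℂ) * ψ (n - Finsupp.single j 1)
  map_add' ψ χ := by funext n; simp [mul_add]
  map_smul' c ψ := by funext n; simp [mul_left_comm]

/-- `a*_𝐣 a_𝐣` is the number operator of the mode `𝐣`. -/
lemma cre_ann_apply {d : ℕ} (j : Mode d) (ψ : Conf d → ℂ) (n : Conf d) :
    cre j (ann j ψ) n = (n j : ℂ) * ψ n := by
  rcases Nat.eq_zero_or_pos (n j) with h | h
  · simp [cre, h]
  · have h1 : n - Finsupp.single j 1 + Finsupp.single j 1 = n := by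
      apply tsub_add_cancel_of_le
      rw [Finsupp.single_le_iff]
      exact h
    have h0 := DFunLike.congr_fun h1 j
    rw [Finsupp.add_apply, Finsupp.single_eq_same] at h0
    have h2 : ((((n - Finsupp.single j 1 : Conf d) j : ℕ) : ℝ)) + 1 = (n j : ℝ) := by
      exact_mod_cast h0
    simp only [cre, ann, LinearMap.coe_mk, AddHom.coe_mk, h1, h2]
    rw [← mul_assoc, ← Complex.ofReal_mul, Real.mul_self_sqrt (Nat.cast_nonneg _)]
    simp

/-- The restriction of a formal operator to the `N`-particle sector. -/
def sector {d : ℕ} (N : ℕ) (A : FormalOp (Conf d)) : FormalOp (NConf d N) :=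
  (LinearMap.funLeft ℂ ℂ (Subtype.val : NConf d N → Conf d)) ∘ₗ A ∘ₗ
    (Function.ExtendByZero.linearMap ℂ (Subtype.val : NConf d N → Conf d))

/-- The operator in `ℓ²(X)` given by `A` on its maximal domain `{ψ ∈ ℓ² | Aψ ∈ ℓ²}`. -/
def maximalOp {X : Type} (A : FormalOp X) : EllTwo X →ₗ.[ℂ] EllTwo X where
  domain :=
    { carrier := {ψ | Memℓp (E := fun _ : X => ℂ) (A ψ) 2}
      zero_mem' := by
        simp only [Set.mem_ofPred_eq, lp.coeFn_zero, map_zero]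
        exact zero_memℓp
      add_mem' := fun {ψ χ} hψ hχ => by
        simp only [Set.mem_ofPred_eq, lp.coeFn_add, map_add] at *
        exact hψ.add hχ
      smul_mem' := fun c ψ hψ => by
        simp only [Set.mem_ofPred_eq, lp.coeFn_smul, map_smul] at *
        exact hψ.const_smul c }
  toFun :=
    { toFun := fun ψ => ⟨A ψ.1, ψ.2⟩
      map_add' := fun ψ χ => by
        ext x
        exact congrFun (map_add A _ _) x
      map_smul' := fun c ψ => by
        ext x
        exact congrFun (map_smul A _ _) x }

/-- The bounded operator on `ℓ²(X)` given by `A` (it is only used for operators that are bounded: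
see `boundedOp_apply` and the lemmas at the end of the next section). -/
def boundedOp {X : Type} (A : FormalOp X) : EllTwo X →L[ℂ] EllTwo X :=
  open Classical in
  if h : ∃ T : EllTwo X →L[ℂ] EllTwo X, ∀ ψ, (T ψ : X → ℂ) = A ψ then h.choose else 0

lemma boundedOp_apply {X : Type} {A : FormalOp X}
    (h : ∃ T : EllTwo X →L[ℂ] EllTwo X, ∀ ψ, (T ψ : X → ℂ) = A ψ) (ψ : EllTwo X) :
    (boundedOp A ψ : X → ℂ) = A ψ := by
  unfold boundedOp
  rw [dif_pos h]
  exact h.choose_spec ψ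

/-! ### Boundedness of particle-number preserving monomials -/

/-- Weighted shifts of configurations that change the total particle number by `-k` and whose
weights are bounded at fixed particle number. -/
def IsShift {d : ℕ} (A : FormalOp (Conf d)) (k : ℤ) : Prop :=
  ∃ (c : Conf d → ℂ) (τ : Conf d → Conf d),
    (∀ ψ n, A ψ n = c n * ψ (τ n)) ∧ Set.InjOn τ {n | c n ≠ 0} ∧
    (∀ n, c n ≠ 0 → ((τ n).degree : ℤ) = n.degree + k) ∧
    ∀ N : ℕ, ∃ C : ℝ, ∀ n : Conf d, n.degree = N → ‖c n‖ ≤ C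

lemma isShift_ann {d : ℕ} (j : Mode d) : IsShift (ann j) 1 := by
  refine ⟨fun n => (Real.sqrt (n j + 1) : ℂ), fun n => n + Finsupp.single j 1,
    fun _ _ => rfl, ?_, ?_, ?_⟩
  · intro n _ n' _ h
    exact add_right_cancel h
  · intro n _
    simp
  · intro N
    refine ⟨Real.sqrt (N + 1), fun n hn => ?_⟩
    have : (n j : ℝ) ≤ N := by exact_mod_cast hn ▸ Finsupp.le_degree j n
    rw [Complex.norm_real, Real.norm_of_nonneg (Real.sqrt_nonneg _)]
    exact Real.sqrt_le_sqrt (by linarith)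

lemma isShift_cre {d : ℕ} (j : Mode d) : IsShift (cre j) (-1) := by
  have key : ∀ n : Conf d, (Real.sqrt (n j) : ℂ) ≠ 0 →
      n - Finsupp.single j 1 + Finsupp.single j 1 = n := by
    intro n hn
    apply tsub_add_cancel_of_le
    rw [Finsupp.single_le_iff]
    by_contra h0
    apply hn
    have : n j = 0 := by omega
    simp [this]
  refine ⟨fun n => (Real.sqrt (n j) : ℂ), fun n => n - Finsupp.single j 1,
    fun _ _ => rfl, ?_, ?_, ?_⟩
  · intro n hn n' hn' h
    rw [← key n hn, ← key n' hn']
    exact congrArg (· + Finsupp.single j 1) h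
  · intro n hn
    have h := congrArg Finsupp.degree (key n hn)
    simp only [map_add, Finsupp.degree_single] at h
    dsimp only
    omega
  · intro N
    refine ⟨Real.sqrt N, fun n hn => ?_⟩
    have : (n j : ℝ) ≤ N := by exact_mod_cast hn ▸ Finsupp.le_degree j n
    rw [Complex.norm_real, Real.norm_of_nonneg (Real.sqrt_nonneg _)]
    exact Real.sqrt_le_sqrt this

lemma IsShift.comp {d : ℕ} {A B : FormalOp (Conf d)} {k l : ℤ} (hA : IsShift A k)
    (hB : IsShift B l) : IsShift (A ∘ₗ B) (k + l) := by
  obtain ⟨c, τ, h1, h2, h3, h4⟩ := hA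
  obtain ⟨c', τ', h1', h2', h3', h4'⟩ := hB
  refine ⟨fun n => c n * c' (τ n), fun n => τ' (τ n), ?_, ?_, ?_, ?_⟩
  · intro ψ n
    simp [h1, h1', mul_assoc]
  · intro n hn n' hn' h
    have a := mul_ne_zero_iff.mp hn
    have a' := mul_ne_zero_iff.mp hn'
    exact h2 a.1 a'.1 (h2' a.2 a'.2 h)
  · intro n hn
    have a := mul_ne_zero_iff.mp hn
    have := h3 n a.1
    have := h3' _ a.2
    dsimp only
    omega
  · intro N
    obtain ⟨C, hC⟩ := h4 N
    obtain ⟨C', hC'⟩ := h4' (N + k).toNat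
    refine ⟨|C| * |C'|, fun n hn => ?_⟩
    by_cases h0 : c n = 0
    · simp only [h0, zero_mul, norm_zero]
      positivity
    · have hd := h3 n h0
      rw [norm_mul]
      have e1 := (hC n hn).trans (le_abs_self C)
      have e2 := (hC' (τ n) (by omega)).trans (le_abs_self C')
      exact mul_le_mul e1 e2 (norm_nonneg _) (abs_nonneg _)

lemma IsShift.smul {d : ℕ} {A : FormalOp (Conf d)} {k : ℤ} (hA : IsShift A k) (r : ℂ) :
    IsShift (r • A) k := by
  obtain ⟨c, τ, h1, h2, h3, h4⟩ := hA
  refine ⟨fun n => r * c n, τ, ?_, ?_, ?_, ?_⟩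
  · intro ψ n
    simp [h1, mul_assoc]
  · exact h2.mono fun n hn => (mul_ne_zero_iff.mp hn).2
  · exact fun n hn => h3 n (mul_ne_zero_iff.mp hn).2
  · intro N
    obtain ⟨C, hC⟩ := h4 N
    refine ⟨‖r‖ * C, fun n hn => ?_⟩
    rw [norm_mul]
    exact mul_le_mul_of_nonneg_left (hC n hn) (norm_nonneg _)

/-- A number-preserving weighted shift is a bounded operator on the `N`-particle sector. -/
lemma IsShift.bounded {d : ℕ} {A : FormalOp (Conf d)} (hA : IsShift A 0) (N : ℕ) :
    ∃ T : FockN d N →L[ℂ] FockN d N, ∀ ψ, (T ψ : NConf d N → ℂ) = sector N A ψ := by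
  classical
  obtain ⟨c, τ, h1, h2, h3, h4⟩ := hA
  obtain ⟨C, hC⟩ := h4 N
  have hC0 : ∀ n : NConf d N, ‖c n.1‖ ≤ |C| := fun n => (hC n.1 n.2).trans (le_abs_self C)
  have hτ : ∀ n : NConf d N, c n.1 ≠ 0 → (τ n.1).degree = N := by
    intro n hn
    have := h3 _ hn
    have := n.2
    omega
  have happ : ∀ (ψ : NConf d N → ℂ) (n : NConf d N), sector N A ψ n =
      if h : c n.1 ≠ 0 then c n.1 * ψ ⟨τ n.1, hτ n h⟩ else 0 := by
    intro ψ n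
    have : sector N A ψ n = A (Function.extend Subtype.val ψ 0) n.1 := rfl
    rw [this, h1]
    split_ifs with h
    · congr 1
      exact Subtype.val_injective.extend_apply ψ 0 ⟨τ n.1, hτ n h⟩
    · rw [not_not.mp h, zero_mul]
  have hsum : ∀ (ψ : FockN d N) (s : Finset (NConf d N)),
      ∑ n ∈ s, ‖sector N A ψ n‖ ^ (2 : ENNReal).toReal ≤ (|C| * ‖ψ‖) ^ (2 : ENNReal).toReal := by
    intro ψ s
    have hp : 0 < (2 : ENNReal).toReal := by norm_num
    have e1 : ∑ n ∈ s, ‖sector N A ψ n‖ ^ (2 : ENNReal).toReal ≤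
        |C| ^ (2 : ENNReal).toReal * ∑ n ∈ (s.filter fun n => c n.1 ≠ 0).attach,
          ‖ψ ⟨τ n.1.1, hτ n.1 (Finset.mem_filter.mp n.2).2⟩‖ ^ (2 : ENNReal).toReal := by
      rw [Finset.mul_sum]
      have : ∑ n ∈ s, ‖sector N A ψ n‖ ^ (2 : ENNReal).toReal =
          ∑ n ∈ s.filter (fun n => c n.1 ≠ 0), ‖sector N A ψ n‖ ^ (2 : ENNReal).toReal := by
        symm
        apply Finset.sum_filter_of_ne
        intro n _ hn h0
        apply hn
        rw [happ, dif_neg (not_not.mpr h0), norm_zero, Real.zero_rpow hp.ne']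
      rw [this, ← Finset.sum_attach]
      apply Finset.sum_le_sum
      intro n _
      have hn := (Finset.mem_filter.mp n.2).2
      rw [happ, dif_pos hn, norm_mul, Real.mul_rpow (norm_nonneg _) (norm_nonneg _)]
      exact mul_le_mul_of_nonneg_right
        (Real.rpow_le_rpow (norm_nonneg _) (hC0 n.1) hp.le) (by positivity)
    have e2 : ∑ n ∈ (s.filter fun n => c n.1 ≠ 0).attach,
          ‖ψ ⟨τ n.1.1, hτ n.1 (Finset.mem_filter.mp n.2).2⟩‖ ^ (2 : ENNReal).toReal ≤
        ‖ψ‖ ^ (2 : ENNReal).toReal := by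
      have inj : Set.InjOn (fun n : {x // x ∈ s.filter fun n => c n.1 ≠ 0} =>
          (⟨τ n.1.1, hτ n.1 (Finset.mem_filter.mp n.2).2⟩ : NConf d N))
          ((s.filter fun n => c n.1 ≠ 0).attach : Finset _) := by
        intro n _ n' _ h
        have h' : τ n.1.1 = τ n'.1.1 := congrArg Subtype.val h
        exact Subtype.ext (Subtype.ext (h2 (Finset.mem_filter.mp n.2).2
          (Finset.mem_filter.mp n'.2).2 h'))
      rw [← Finset.sum_image (f := fun x : NConf d N => ‖ψ x‖ ^ (2 : ENNReal).toReal) inj]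
      exact lp.sum_rpow_le_norm_rpow hp ψ _
    rw [Real.mul_rpow (abs_nonneg _) (norm_nonneg _)]
    exact e1.trans (mul_le_mul_of_nonneg_left e2 (by positivity))
  have hmem : ∀ ψ : FockN d N, Memℓp (E := fun _ : NConf d N => ℂ) (sector N A ψ) 2 := fun ψ =>
    memℓp_gen' (hsum ψ)
  let T₀ : FockN d N →ₗ[ℂ] FockN d N :=
    { toFun := fun ψ => ⟨sector N A ψ, hmem ψ⟩
      map_add' := fun ψ χ => by
        ext x
        exact congrFun (map_add (sector N A) _ _) x
      map_smul' := fun r ψ => by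
        ext x
        exact congrFun (map_smul (sector N A) _ _) x }
  refine ⟨T₀.mkContinuous |C| fun ψ => ?_, fun ψ => rfl⟩
  exact lp.norm_le_of_forall_sum_le (by norm_num) (by positivity) (hsum ψ)

/-! ## The pair potential and the interacting modes -/

/-- `|k_𝐣|²` with `k_𝐣 = (2π/L) 𝐣`. -/
def kSq {d : ℕ} (L : ℝ) (j : Mode d) : ℝ := ∑ a, (2 * Real.pi / L * (j a : ℝ)) ^ 2

/-- The box `Λ = [-L/2, L/2]^d`. -/
def box (d : ℕ) (L : ℝ) : Set (Fin d → ℝ) := {x | ∀ a, |x a| ≤ L / 2}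

/-- The Fourier component `φ_𝐣` of `φ`, normalized by `φ(x) = |Λ|⁻¹ ∑_𝐣 φ_𝐣 exp(i k_𝐣·x)`. -/
def fourierComponent {d : ℕ} (L : ℝ) (φ : (Fin d → ℝ) → ℝ) (j : Mode d) : ℂ :=
  ∫ x in box d L, (φ x : ℂ) *
    Complex.exp (-Complex.I * ((∑ a, 2 * Real.pi / L * (j a : ℝ) * x a : ℝ) : ℂ))

/-- Bounded, periodic, even pair potentials of positive type with finitely many nonzero Fourier
components. -/
structure PairPotential (d : ℕ) (L : ℝ) where
  φ : (Fin d → ℝ) → ℝ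
  measurable : Measurable φ
  bounded : ∃ C, ∀ x, |φ x| ≤ C
  periodic : ∀ (x : Fin d → ℝ) (j : Mode d), φ (fun a => x a + (j a : ℝ) * L) = φ x
  even : ∀ x, φ (-x) = φ x
  positiveType : ∀ j, ∃ r : ℝ, 0 ≤ r ∧ fourierComponent L φ j = r
  ultravioletCutoff : {j | fourierComponent L φ j ≠ 0}.Finite

/-- The (real) Fourier component `φ_𝐣`. -/
def PairPotential.coeff {d : ℕ} {L : ℝ} (v : PairPotential d L) (j : Mode d) : ℝ :=
  (fourierComponent L v.φ j).re

/-- An enumeration `±𝐣_1, …, ±𝐣_M` of the modes `𝐣 ≠ 𝟎` with `φ_𝐣 ≠ 0`, one index for each couple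
`{𝐣, -𝐣}`. The index set `Fin M` starts from `0`. -/
structure InteractingModes {d : ℕ} {L : ℝ} (v : PairPotential d L) (M : ℕ) where
  mode : Fin M → Mode d
  mode_injective : ∀ l l', mode l = mode l' ∨ mode l = -mode l' → l = l'
  mem_iff : ∀ j, (j ≠ 0 ∧ v.coeff j ≠ 0) ↔ ∃ l, j = mode l ∨ j = -mode l

section Model

variable {d : ℕ} {L : ℝ} {v : PairPotential d L} {M : ℕ}

/-- `φ_{𝐣_l}`. -/
def InteractingModes.phi (J : InteractingModes v M) (l : Fin M) : ℝ := v.coeff (J.mode l)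

/-- The ratio `ε_{𝐣_l} = k²_{𝐣_l} / φ_{𝐣_l}`. -/
def InteractingModes.eps (J : InteractingModes v M) (l : Fin M) : ℝ :=
  kSq L (J.mode l) / J.phi l

/-- The Bogoliubov energy `E^{Bog}_{𝐣_l} = -[k² + φ - √((k²)² + 2 φ k²)]`. -/
def InteractingModes.energy (J : InteractingModes v M) (l : Fin M) : ℝ :=
  -(kSq L (J.mode l) + J.phi l -
    Real.sqrt (kSq L (J.mode l) ^ 2 + 2 * J.phi l * kSq L (J.mode l)))

/-! ## The Bogoliubov Hamiltonians -/

/-- `W_𝐣 = φ_𝐣 a*_𝟎 a*_𝟎 a_𝐣 a_{-𝐣} / N`. -/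
def formalW (v : PairPotential d L) (N : ℕ) (j : Mode d) : FormalOp (Conf d) :=
  ((v.coeff j / N : ℝ) : ℂ) • (cre 0 ∘ₗ cre 0 ∘ₗ ann j ∘ₗ ann (-j))

/-- `W*_𝐣 = φ_𝐣 a_𝟎 a_𝟎 a*_𝐣 a*_{-𝐣} / N`. -/
def formalWstar (v : PairPotential d L) (N : ℕ) (j : Mode d) : FormalOp (Conf d) :=
  ((v.coeff j / N : ℝ) : ℂ) • (ann 0 ∘ₗ ann 0 ∘ₗ cre j ∘ₗ cre (-j))

/-- `Ĥ⁰_𝐣 = ∑_{±} (k²_𝐣 + φ_𝐣 a*_𝟎 a_𝟎 / N) a*_{±𝐣} a_{±𝐣}`. -/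
def formalH0 (v : PairPotential d L) (N : ℕ) (j : Mode d) : FormalOp (Conf d) :=
  ((kSq L j : ℂ) • LinearMap.id + ((v.coeff j / N : ℝ) : ℂ) • (cre 0 ∘ₗ ann 0)) ∘ₗ
    (cre j ∘ₗ ann j + cre (-j) ∘ₗ ann (-j))

/-- `Ĥ^{Bog}_𝐣 = Ĥ⁰_𝐣 + W_𝐣 + W*_𝐣`. -/
def formalHhat (v : PairPotential d L) (N : ℕ) (j : Mode d) : FormalOp (Conf d) :=
  formalH0 v N j + formalW v N j + formalWstar v N j

/-- The kinetic energy `∑_{𝐣 ∉ S} k²_𝐣 a*_𝐣 a_𝐣`; on a configuration `n` only the finitely many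
modes in the support of `n` contribute. -/
def formalKinetic {d : ℕ} (L : ℝ) (S : Set (Mode d)) : FormalOp (Conf d) where
  toFun ψ n := ∑ j ∈ n.support, Set.indicator Sᶜ
    (fun j => (kSq L j : ℂ) * cre j (ann j ψ) n) j
  map_add' ψ χ := by
    funext n
    simp only [Pi.add_apply, map_add, mul_add, ← Finset.sum_add_distrib]
    exact Finset.sum_congr rfl fun j _ => by
      by_cases h : j ∈ S <;> simp [h]
  map_smul' c ψ := by
    funext n
    simp only [Pi.smul_apply, map_smul, smul_eq_mul, RingHom.id_apply, Finset.mul_sum]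
    exact Finset.sum_congr rfl fun j _ => by
      by_cases h : j ∈ S <;> simp [h, mul_left_comm]

/-- `∑_{l ∈ S} Ĥ^{Bog}_{𝐣_l}` on the `N`-particle space. -/
def interactionHam (J : InteractingModes v M) (N : ℕ) (S : Finset (Fin M)) :
    FockN d N →ₗ.[ℂ] FockN d N :=
  maximalOp (sector N (∑ l ∈ S, formalHhat v N (J.mode l)))

/-- The intermediate Bogoliubov Hamiltonian with the interacting couples of modes `±𝐣_l`, `l ∈ S`:
`∑_{𝐣 ∉ {±𝐣_l | l ∈ S}} k²_𝐣 a*_𝐣 a_𝐣 + ∑_{l ∈ S} Ĥ^{Bog}_{𝐣_l}` on the `N`-particle space. -/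
def bogHam (J : InteractingModes v M) (N : ℕ) (S : Finset (Fin M)) :
    FockN d N →ₗ.[ℂ] FockN d N :=
  maximalOp (sector N (formalKinetic L {j | ∃ l ∈ S, j = J.mode l ∨ j = -J.mode l} +
    ∑ l ∈ S, formalHhat v N (J.mode l)))

/-- The projection `Q^{(i,i+1)}_𝐣` onto the states with `N - i` or `N - i - 1` particles in the
modes `±𝐣`, as an operator on coefficients. -/
def formalQ {d : ℕ} (N : ℕ) (j : Mode d) (i : ℕ) : FormalOp (Conf d) where
  toFun ψ n := if n j + n (-j) + i = N ∨ n j + n (-j) + i + 1 = N then ψ n else 0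
  map_add' ψ χ := by
    funext n
    simp only [Pi.add_apply]
    split_ifs <;> simp
  map_smul' c ψ := by
    funext n
    simp only [Pi.smul_apply, RingHom.id_apply]
    split_ifs <;> simp

/-- `W_{𝐣_l}` as a bounded operator on the `N`-particle space. -/
def opW (J : InteractingModes v M) (N : ℕ) (l : Fin M) : FockN d N →L[ℂ] FockN d N :=
  boundedOp (sector N (formalW v N (J.mode l)))

/-- `W*_{𝐣_l}` as a bounded operator on the `N`-particle space. -/
def opWstar (J : InteractingModes v M) (N : ℕ) (l : Fin M) : FockN d N →L[ℂ] FockN d N :=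
  boundedOp (sector N (formalWstar v N (J.mode l)))

/-- `Q^{(i,i+1)}_{𝐣_l}` as a bounded operator on the `N`-particle space. -/
def opQ (J : InteractingModes v M) (N : ℕ) (l : Fin M) (i : ℕ) : FockN d N →L[ℂ] FockN d N :=
  boundedOp (sector N (formalQ N (J.mode l) i))

lemma opW_apply (J : InteractingModes v M) (N : ℕ) (l : Fin M) (ψ : FockN d N) :
    (opW J N l ψ : NConf d N → ℂ) = sector N (formalW v N (J.mode l)) ψ := by
  refine boundedOp_apply (IsShift.bounded ?_ N) ψ
  have h := (isShift_cre (0 : Mode d)).comp ((isShift_cre (0 : Mode d)).comp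
    ((isShift_ann (J.mode l)).comp (isShift_ann (-J.mode l))))
  norm_num at h
  exact h.smul _

lemma opWstar_apply (J : InteractingModes v M) (N : ℕ) (l : Fin M) (ψ : FockN d N) :
    (opWstar J N l ψ : NConf d N → ℂ) = sector N (formalWstar v N (J.mode l)) ψ := by
  refine boundedOp_apply (IsShift.bounded ?_ N) ψ
  have h := (isShift_ann (0 : Mode d)).comp ((isShift_ann (0 : Mode d)).comp
    ((isShift_cre (J.mode l)).comp (isShift_cre (-J.mode l))))
  norm_num at h
  exact h.smul _

lemma opQ_apply (J : InteractingModes v M) (N : ℕ) (l : Fin M) (i : ℕ) (ψ : FockN d N) :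
    (opQ J N l i ψ : NConf d N → ℂ) = sector N (formalQ N (J.mode l) i) ψ := by
  classical
  refine boundedOp_apply (IsShift.bounded ⟨fun n => if n (J.mode l) + n (-J.mode l) + i = N ∨
    n (J.mode l) + n (-J.mode l) + i + 1 = N then 1 else 0, id, ?_, ?_, ?_, ?_⟩ N) ψ
  · intro ψ n
    simp [formalQ]
  · exact fun _ _ _ _ h => h
  · simp
  · refine fun _ => ⟨1, fun n _ => ?_⟩
    dsimp only
    split_ifs <;> simp

end Model

/-! ## Resolvents and the bottom of the spectrum -/

section Resolvent

variable {H : Type} [NormedAddCommGroup H] [InnerProductSpace ℂ H]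

/-- `R = Q [Q (T - z) Q]⁻¹ Q`, where `Q (T - z) Q` acts on `Q H` with domain `Q H ∩ D(T)` and has
a bounded everywhere defined inverse on `Q H`. There is at most one such `R`. -/
structure IsCompressedResolvent (T : H →ₗ.[ℂ] H) (Q : H →L[ℂ] H) (z : ℂ) (R : H →L[ℂ] H) :
    Prop where
  left_proj : Q ∘L R = R
  right_proj : R ∘L Q = R
  right_inv : ∀ ψ, ∃ χ, (R ψ, χ) ∈ T.graph ∧ Q (χ - z • R ψ) = Q ψ
  left_inv : ∀ φ χ, (φ, χ) ∈ T.graph → Q φ = φ → R (Q (χ - z • φ)) = φ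

/-- The compressed resolvent `Q [Q (T - z) Q]⁻¹ Q` (and `0` if it does not exist). -/
def compressedResolvent (T : H →ₗ.[ℂ] H) (Q : H →L[ℂ] H) (z : ℂ) : H →L[ℂ] H :=
  open Classical in
  if h : ∃ R, IsCompressedResolvent T Q z R then h.choose else 0

/-- The infimum of the (real) spectrum of `T`; `λ` belongs to the spectrum if `T - λ` has no
bounded everywhere defined inverse. -/
def infSpec (T : H →ₗ.[ℂ] H) : ℝ :=
  sInf {x : ℝ | ¬ ∃ R, IsCompressedResolvent T (ContinuousLinearMap.id ℂ H) (x : ℂ) R}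

end Resolvent

/-! ## The operators `Γ_{i,i}` and their re-expansion

`Wd i`, `Wu i` and `R i` stand for `W_{i,i-2}`, `W*_{i-2,i}` and `R_{i,i}(w)`, with `i` even. -/

section Expansion

variable {H : Type} [NormedAddCommGroup H] [InnerProductSpace ℂ H] [CompleteSpace H]

/-- `Γ_{2,2} = W_{2,0} R_{0,0} W*_{0,2}` and
`Γ_{i,i} = W_{i,i-2} R_{i-2,i-2} ∑_{n ≥ 0} [Γ_{i-2,i-2} R_{i-2,i-2}]^n W*_{i-2,i}` for even
`i ≥ 4` (the other values are not used). -/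
def Gam (Wd Wu R : ℕ → H →L[ℂ] H) : ℕ → H →L[ℂ] H
  | 0 => 0
  | 1 => 0
  | 2 => Wd 2 * R 0 * Wu 2
  | 3 => 0
  | i + 4 => Wd (i + 4) * R (i + 2) * (∑' n : ℕ, (Gam Wd Wu R (i + 2) * R (i + 2)) ^ n) *
      Wu (i + 4)

/-- `[Γ_{j,j}]^{(0)}_{(j-2,h_-)} = W_{j,j-2} R_{j-2,j-2} W*_{j-2,j}`. -/
def minusZero (Wd Wu R : ℕ → H →L[ℂ] H) (j : ℕ) : H →L[ℂ] H :=
  Wd j * R (j - 2) * Wu j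

/-- `W_{j,j-2} (R_{j-2,j-2})^{1/2} X (R_{j-2,j-2})^{1/2} W*_{j-2,j}`. -/
def dress (Wd Wu R : ℕ → H →L[ℂ] H) (j : ℕ) (X : H →L[ℂ] H) : H →L[ℂ] H :=
  Wd j * CFC.sqrt (R (j - 2)) * X * CFC.sqrt (R (j - 2)) * Wu j

/-- `(R_{i,i})^{1/2} X (R_{i,i})^{1/2}`. -/
def sandwich (R : ℕ → H →L[ℂ] H) (i : ℕ) (X : H →L[ℂ] H) : H →L[ℂ] H :=
  CFC.sqrt (R i) * X * CFC.sqrt (R i)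

/-- `[Γ_{j,j}]^{(>0)}_{(j-2,h_-)}`, where powers `1, …, h-1` of the sandwiched
`[Γ_{j-2,j-2}]^{(0)}_{(j-4,h_-)}` are summed. -/
def minusPos (Wd Wu R : ℕ → H →L[ℂ] H) (h j : ℕ) : H →L[ℂ] H :=
  dress Wd Wu R j
    (∑ n ∈ Finset.Icc 1 (h - 1), sandwich R (j - 2) (minusZero Wd Wu R (j - 2)) ^ n)

/-- The sum of all products `∏_t X(g_t)` of `n` factors with letters `g_t ∈ S` in which the letter
`s₀` occurs at least once. -/
def wordSum {ι : Type} [DecidableEq ι] (S : Finset ι) (s₀ : ι) (X : ι → H →L[ℂ] H) (n : ℕ) :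
    H →L[ℂ] H :=
  ∑ g ∈ (Fintype.piFinset fun _ : Fin n => S) with ∃ t, g t = s₀,
    (List.ofFn fun t => X (g t)).prod

/-- The even numbers `s` with `p ≤ s ≤ q`. -/
def evens (p q : ℕ) : Finset ℕ := (Finset.Icc p q).filter Even

/-- `minusTerm h j l = [Γ_{j,j}]_{(l,h_-; l+2,h_-; …; j-2,h_-)}` for even `4 ≤ j`, `2 ≤ l ≤ j - 2`.

* For `l = j - 2` it is `[Γ_{j,j}]^{(0)}_{(j-2,h_-)} + [Γ_{j,j}]^{(>0)}_{(j-2,h_-)}`.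
* For `l = j - 4` one sums the products of `1, …, h-1` sandwiched factors
  `[Γ_{j-2,j-2}]^{(0)}_{(j-4,h_-)}` (letter `false`) and `[Γ_{j-2,j-2}]^{(>0)}_{(j-4,h_-)}`
  (letter `true`), the latter occurring at least once.
* For `l ≤ j - 6` one sums the products of `1, …, h-1` sandwiched factors
  `[Γ_{j-2,j-2}]_{(s,h_-; …; j-4,h_-)}` with even `l ≤ s ≤ j - 4`, the value `s = l` occurring at
  least once. -/
def minusTerm (Wd Wu R : ℕ → H →L[ℂ] H) (h : ℕ) : ℕ → ℕ → H →L[ℂ] H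
  | 0, _ => 0
  | 1, _ => 0
  | i + 2, l =>
    if l = i then minusZero Wd Wu R (i + 2) + minusPos Wd Wu R h (i + 2)
    else if l + 2 = i then
      dress Wd Wu R (i + 2) (∑ n ∈ Finset.Icc 1 (h - 1),
        wordSum Finset.univ true (fun b : Bool => sandwich R i
          (if b then minusPos Wd Wu R h i else minusZero Wd Wu R i)) n)
    else
      dress Wd Wu R (i + 2) (∑ n ∈ Finset.Icc 1 (h - 1),
        wordSum (evens l (i - 2)) l
          (fun s => sandwich R i (minusTerm Wd Wu R h i s)) n)

/-- `plusTerm h j l = [Γ_{j,j}]_{(l,h_+; l+2,h_-; …; j-2,h_-)}` for even `4 ≤ j`, `2 ≤ l ≤ j - 2`.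

* For `l = j - 2` the powers `≥ h` of the sandwiched `Γ_{j-2,j-2}` are summed.
* For `l ≤ j - 4` one sums the products of `1, …, h-1` sandwiched factors
  `[Γ_{j-2,j-2}]_{(s,h_+; …; j-4,h_-)}` with even `l ≤ s ≤ j - 4` (letters `inl s`) and
  `[Γ_{j-2,j-2}]_{(s',h_-; …; j-4,h_-)}` with even `2 ≤ s' ≤ j - 4` (letters `inr s'`), the letter
  `inl l` occurring at least once. -/
def plusTerm (Wd Wu R : ℕ → H →L[ℂ] H) (h : ℕ) : ℕ → ℕ → H →L[ℂ] H
  | 0, _ => 0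
  | 1, _ => 0
  | i + 2, l =>
    if l = i then
      dress Wd Wu R (i + 2) (∑' n : ℕ, sandwich R i (Gam Wd Wu R i) ^ (h + n))
    else
      dress Wd Wu R (i + 2) (∑ n ∈ Finset.Icc 1 (h - 1),
        wordSum ((evens l (i - 2)).disjSum (evens 2 (i - 2))) (Sum.inl l)
          (fun s => sandwich R i
            (Sum.elim (fun s => plusTerm Wd Wu R h i s) (fun s => minusTerm Wd Wu R h i s) s)) n)

end Expansion

/-! ## The operators of the model -/

section ModelOperators

variable {d : ℕ} {L : ℝ} {v : PairPotential d L} {M : ℕ}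

/-- The ground state energy of the Hamiltonian with the interacting couples of index `< m`
(for the first index this is the kinetic energy, and the value is `0`). -/
def prevEnergy (J : InteractingModes v M) (N : ℕ) (m : Fin M) : ℝ :=
  infSpec (bogHam J N (Finset.Iio m))

/-- `W_{i,i-2} = Q^{(i,i+1)} W Q^{(i-2,i-1)}`. -/
def Wdown (J : InteractingModes v M) (N : ℕ) (m : Fin M) (i : ℕ) : FockN d N →L[ℂ] FockN d N :=
  opQ J N m i * opW J N m * opQ J N m (i - 2)

/-- `W*_{i-2,i} = Q^{(i-2,i-1)} W* Q^{(i,i+1)}`. -/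
def Wup (J : InteractingModes v M) (N : ℕ) (m : Fin M) (i : ℕ) : FockN d N →L[ℂ] FockN d N :=
  opQ J N m (i - 2) * opWstar J N m * opQ J N m i

/-- `R_{i,i}(w) = Q^{(i,i+1)} [Q^{(i,i+1)} (H - w) Q^{(i,i+1)}]⁻¹ Q^{(i,i+1)}`, where `H` is the
Hamiltonian with the interacting couples of index `≤ m` and the projections refer to `±𝐣_m`. -/
def resolventR (J : InteractingModes v M) (N : ℕ) (m : Fin M) (w : ℝ) (i : ℕ) :
    FockN d N →L[ℂ] FockN d N :=
  compressedResolvent (bogHam J N (Finset.Iic m)) (opQ J N m i) (w : ℂ)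

/-- `Γ_{i,i}(w)`. -/
def gammaOp (J : InteractingModes v M) (N : ℕ) (m : Fin M) (w : ℝ) (i : ℕ) :
    FockN d N →L[ℂ] FockN d N :=
  Gam (Wdown J N m) (Wup J N m) (resolventR J N m w) i

/-- `[Γ_{i,i}(w)]_{(l,h_-; l+2,h_-; …; i-2,h_-)}`. -/
def gammaMinus (J : InteractingModes v M) (N : ℕ) (m : Fin M) (w : ℝ) (h i l : ℕ) :
    FockN d N →L[ℂ] FockN d N :=
  minusTerm (Wdown J N m) (Wup J N m) (resolventR J N m w) h i l

/-- `[Γ_{i,i}(w)]_{(l,h_+; l+2,h_-; …; i-2,h_-)}`. -/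
def gammaPlus (J : InteractingModes v M) (N : ℕ) (m : Fin M) (w : ℝ) (h i l : ℕ) :
    FockN d N →L[ℂ] FockN d N :=
  plusTerm (Wdown J N m) (Wup J N m) (resolventR J N m w) h i l

end ModelOperators

/-! ## The constants -/

/-- The characteristic function `χ_{[0,2)}`. -/
def chi (δ : ℝ) : ℝ := Set.indicator (Set.Ico 0 2) 1 δ

/-- `b_ε = (1+ε) δ χ_{[0,2)}(δ) √(ε² + 2ε)` at `δ = 1 + √ε`. -/
def bConst (ε : ℝ) : ℝ :=
  (1 + ε) * (1 + Real.sqrt ε) * chi (1 + Real.sqrt ε) * Real.sqrt (ε ^ 2 + 2 * ε)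

/-- `c_ε = -(1 - δ² χ_{[0,2)}(δ)) (ε² + 2ε)` at `δ = 1 + √ε`. -/
def cConst (ε : ℝ) : ℝ :=
  -(1 - (1 + Real.sqrt ε) ^ 2 * chi (1 + Real.sqrt ε)) * (ε ^ 2 + 2 * ε)

/-- `Θ = min {2(ν - 11/8), 1/4}`. -/
def thetaConst (ν : ℝ) : ℝ := min (2 * (ν - 11 / 8)) (1 / 4)

/-- `K_{i,ε}`, with `a` the value of `a_ε`. -/
def KConst (a ε : ℝ) (N i : ℕ) : ℝ :=
  1 / (4 * (1 + a - 2 * bConst ε / ((N : ℝ) - i + 1) -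
    (1 - cConst ε) / ((N : ℝ) - i + 1) ^ 2))

/-- `Z_{i,ε}`, with `a` the value of `a_ε` and `η = 1 - √ε`. -/
def ZConst (ν a ε : ℝ) (N i : ℕ) : ℝ :=
  1 / (4 * (1 + a - 2 * bConst ε / ((N : ℝ) - i + 1) -
    (1 - cConst ε) / ((N : ℝ) - i + 1) ^ 2)) *
  (2 / (1 + Real.sqrt ((1 - Real.sqrt ε) * a) -
    bConst ε / Real.sqrt ((1 - Real.sqrt ε) * a) / ((N : ℝ) - i + 2 - ε ^ thetaConst ν)))

end BoseGas

end

open BoseGas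

open BoseGas
namespace BoseGas

/-! ## Sums over words -/

section Words

variable {A : Type*} [Ring A] {ι : Type*}

/-! The proof separates an operator estimate, an algebraic identity and a scalar recursion;
`ExpansionBounds` is the interface between them.

Operators. After compression by `Q_i` the hopping `W + W*` of the last couple drops out. What
remains is the kinetic energy of the free modes, the Hamiltonians of the earlier couples, which
commute with `Q_i`, the diagonal pair energy of the last couple, and `-w`. The hypotheses on the
spectrum and on `w` bound this from below by `P²`, the pair energy plus a positive constant `γ`. So
`R_i` exists, is nonnegative and satisfies `R P² R ≤ R`, whence `‖P R^{1/2}‖ ≤ 1`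
(`resolventR_dominated`, `norm_mul_sqrt_le_one`). A comparison of matrix elements writes `W*_{i-2,i}
= P T P` with `‖T‖² ≤ K_i` (`exists_hopping_factor`). Together these give `‖⟨D_i[X]⟩_i‖ ≤ K_i ‖X‖`
for every bounded `X`. The constants `b_ε`, `c_ε` come from an exact factorization (`invK_mul_sq`);
with `a_ε = 2ε` it leaves a slack `ε²`, which absorbs the errors in `N`.

Recursion. The numbers `x_i = ‖⟨Γ_i⟩_i‖` satisfy `x_{i+2} ≤ K_{i+2} / (1 - x_i)`, and `Z` is a
supersolution: with `Z_i = K_i / X_i` it suffices that `Z_i ≤ 1 - X_{i+2}`, an explicit inequality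
(`supersolution`). Hence `x_i ≤ Z_i < 1` and all series converge.

Expansion. A sum over words in which a given letter occurs is a difference of two `n`-th powers
(`sum_words_eq`). Ordering the letters by their smallest index makes these differences telescope
(`pow_splitting`), which is the splitting of `Γ_i`.

Estimates. The recursive definitions are run a second time on real numbers (`HasMajorants`). The
same telescoping identity in `ℝ` keeps the sum of all majorants at level `i` below `K_i / (1 -
Z_{i-2})`, hence below `Z_i` wherever the next level uses it. A difference of truncated geometric
sums then costs at most a factor `(1 - Z)⁻²` per level (`sum_Icc_pow_sub_pow_le`), and the product
over the levels is the asserted bound. -/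

lemma sum_piFinset_ofFn_prod (S : Finset ι) (X : ι → A) (n : ℕ) :
    ∑ g ∈ Fintype.piFinset fun _ : Fin n => S, (List.ofFn fun t => X (g t)).prod =
      (∑ s ∈ S, X s) ^ n := by
  induction n with
  | zero => simp
  | succ n ih =>
    rw [pow_succ', ← ih, Finset.sum_mul_sum, ← Finset.sum_product']
    refine Finset.sum_bij' (fun g _ => (g 0, fun t => g t.succ))
      (fun p _ => Fin.cons (α := fun _ => ι) p.1 p.2) ?_ ?_ ?_ ?_ ?_
    · intro g hg
      simp only [Fintype.mem_piFinset] at hg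
      simp [hg]
    · intro p hp
      simp only [Finset.mem_product, Fintype.mem_piFinset] at hp
      simp only [Fintype.mem_piFinset]
      intro t
      refine Fin.cases ?_ (fun t => ?_) t
      · simpa using hp.1
      · simpa using hp.2 t
    · intro g _
      exact Fin.cons_self_tail g
    · intro p _
      simp
    · intro g _
      simp [List.ofFn_succ]

/-- The words that avoid `s₀` are exactly the words over the erased alphabet, so inclusion-exclusion
has only two terms. The order of the factors plays no role, and the identity is used both for
operators and for real numbers. -/
lemma sum_words_eq [DecidableEq ι] (S : Finset ι) (s₀ : ι) (X : ι → A) (n : ℕ) :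
    ∑ g ∈ (Fintype.piFinset fun _ : Fin n => S) with ∃ t, g t = s₀,
      (List.ofFn fun t => X (g t)).prod =
      (∑ s ∈ S, X s) ^ n - (∑ s ∈ S.erase s₀, X s) ^ n := by
  rw [← sum_piFinset_ofFn_prod S, ← sum_piFinset_ofFn_prod (S.erase s₀), eq_sub_iff_add_eq,
    ← Finset.sum_filter_add_sum_filter_not (Fintype.piFinset fun _ : Fin n => S)
      (fun g => ∃ t, g t = s₀)]
  congr 1
  refine Finset.sum_congr ?_ fun _ _ => rfl
  ext g
  simp only [Fintype.mem_piFinset, Finset.mem_erase, Finset.mem_filter, not_exists]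
  exact ⟨fun h => ⟨fun t => (h t).2, fun t => (h t).1⟩, fun h t => ⟨h.2 t, h.1 t⟩⟩

end Words

section WordNorm

variable {H : Type} [NormedAddCommGroup H] [InnerProductSpace ℂ H]

lemma wordSum_eq {ι : Type} [DecidableEq ι] (S : Finset ι) (s₀ : ι) (X : ι → H →L[ℂ] H) (n : ℕ) :
    wordSum S s₀ X n = (∑ s ∈ S, X s) ^ n - (∑ s ∈ S.erase s₀, X s) ^ n :=
  sum_words_eq S s₀ X n

lemma norm_list_ofFn_prod_le {n : ℕ} (X : Fin n → H →L[ℂ] H) (x : Fin n → ℝ)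
    (h : ∀ t, ‖X t‖ ≤ x t) : ‖(List.ofFn X).prod‖ ≤ (List.ofFn x).prod := by
  induction n with
  -- Only `‖1‖ ≤ 1` is available, because `H` may be trivial.
  | zero => simpa using! ContinuousLinearMap.norm_id_le (𝕜 := ℂ) (E := H)
  | succ n ih =>
    simp only [List.ofFn_succ, List.prod_cons]
    exact (norm_mul_le _ _).trans (mul_le_mul (h 0) (ih _ _ fun t => h t.succ) (norm_nonneg _)
      ((norm_nonneg _).trans (h 0)))

/-- The triangle inequality is applied word by word, before resummation. The majorants are then
resummed by the same identity in `ℝ`, so the subtraction survives in the bound. -/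
lemma norm_wordSum_le {ι : Type} [DecidableEq ι] (S : Finset ι) (s₀ : ι) (X : ι → H →L[ℂ] H)
    (x : ι → ℝ) (hx : ∀ s ∈ S, ‖X s‖ ≤ x s) (n : ℕ) :
    ‖wordSum S s₀ X n‖ ≤ (∑ s ∈ S, x s) ^ n - (∑ s ∈ S.erase s₀, x s) ^ n := by
  rw [← sum_words_eq S s₀ x n]
  refine norm_sum_le_of_le _ fun g hg => ?_
  refine norm_list_ofFn_prod_le _ _ fun t => hx _ ?_
  exact Fintype.mem_piFinset.mp (Finset.mem_filter.mp hg).1 t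

end WordNorm

/-! ## Even numbers in an interval -/

lemma mem_evens {p q s : ℕ} : s ∈ evens p q ↔ (p ≤ s ∧ s ≤ q) ∧ Even s := by
  simp [evens]

lemma evens_eq_insert {p q : ℕ} (hp : Even p) (h : p ≤ q) :
    evens p q = insert p (evens (p + 2) q) := by
  ext s
  simp only [mem_evens, Finset.mem_insert]
  grind

lemma evens_eq_insert_right {p q : ℕ} (hq : Even q) (h : p ≤ q + 2) :
    evens p (q + 2) = insert (q + 2) (evens p q) := by
  ext s
  simp only [mem_evens, Finset.mem_insert]
  grind

lemma evens_erase {p q : ℕ} (hp : Even p) : (evens p q).erase p = evens (p + 2) q := by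
  ext s
  simp only [mem_evens, Finset.mem_erase]
  grind

lemma evens_eq_empty {p q : ℕ} (h : q < p) : evens p q = ∅ := by
  ext s
  simp only [mem_evens, Finset.notMem_empty]
  grind

lemma evens_self {p : ℕ} (hp : Even p) : evens p p = {p} := by
  ext s
  simp only [mem_evens, Finset.mem_singleton]
  grind

lemma sum_evens_eq {A : Type*} [AddCommMonoid A] {p q : ℕ} (hp : Even p) (h : p ≤ q)
    (f : ℕ → A) : ∑ s ∈ evens p q, f s = f p + ∑ s ∈ evens (p + 2) q, f s := by
  rw [evens_eq_insert hp h, Finset.sum_insert (by simp [mem_evens])]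

lemma sum_evens_eq_right {A : Type*} [AddCommMonoid A] {p q : ℕ} (hq : Even q) (h : p ≤ q + 2)
    (f : ℕ → A) : ∑ s ∈ evens p (q + 2), f s = f (q + 2) + ∑ s ∈ evens p q, f s := by
  rw [evens_eq_insert_right hq h, Finset.sum_insert (by simp [mem_evens])]

lemma prod_evens_eq_right {p q : ℕ} (hq : Even q) (h : p ≤ q + 2)
    (f : ℕ → ℝ) : ∏ s ∈ evens p (q + 2), f s = f (q + 2) * ∏ s ∈ evens p q, f s := by
  rw [evens_eq_insert_right hq h, Finset.prod_insert (by simp [mem_evens])]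

/-- Telescoping over the even numbers `2, 4, …, q`. -/
lemma sum_evens_telescope {A : Type*} [AddCommGroup A] {q : ℕ} (hq : Even q)
    (F : ℕ → A) : ∑ l ∈ evens 2 q, (F l - F (l + 2)) = F 2 - F (q + 2) := by
  obtain ⟨k, rfl⟩ := hq
  induction k with
  | zero => simp [evens_eq_empty]
  | succ k ih =>
    rw [show k + 1 + (k + 1) = k + k + 2 by ring, sum_evens_eq_right ⟨k, rfl⟩ (by omega), ih]
    abel

/-- The algebraic identity behind the splitting of `(∑ X + ∑ Y)^n` according to the smallest index
of the letters, where `X q = z + p`. -/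
lemma pow_splitting {A : Type*} [Ring A] {q : ℕ} (hq : Even q) (h2 : 2 ≤ q) (X Y : ℕ → A) (z p : A)
    (hX : X q = z + p) (n : ℕ) :
    z ^ n + ((z + p) ^ n - z ^ n) +
      ∑ l ∈ evens 2 (q - 2), ((∑ s ∈ evens l q, X s) ^ n - (∑ s ∈ evens (l + 2) q, X s) ^ n) +
      ∑ l ∈ evens 2 q, ((∑ s ∈ evens l q, Y s + ∑ s ∈ evens 2 q, X s) ^ n -
        (∑ s ∈ evens (l + 2) q, Y s + ∑ s ∈ evens 2 q, X s) ^ n) =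
      (∑ s ∈ evens 2 q, X s + ∑ s ∈ evens 2 q, Y s) ^ n := by
  -- The first telescope ends at the one-letter sum `X q = z + p`, which cancels against the leading
  -- terms. The second runs from all of `X` and `Y` down to `X` alone.
  have e1 := sum_evens_telescope (q := q - 2) (by grind)
    (fun l => (∑ s ∈ evens l q, X s) ^ n)
  have e2 := sum_evens_telescope hq
    (fun l => (∑ s ∈ evens l q, Y s + ∑ s ∈ evens 2 q, X s) ^ n)
  rw [show q - 2 + 2 = q by omega] at e1
  rw [e1, e2, evens_self hq, Finset.sum_singleton, hX, evens_eq_empty (show q < q + 2 by omega)]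
  simp only [Finset.sum_empty, zero_add]
  rw [add_comm (∑ s ∈ evens 2 q, Y s)]
  abel

/-! ## Geometric sums -/

/-- Keeping the tail as an explicit term lets truncated sums be estimated by discarding it, and lets
the minus and plus contributions recombine exactly. -/
lemma one_add_sum_Icc_pow_add {z : ℝ} (h1 : z < 1) {h : ℕ} (hh : 1 ≤ h) :
    1 + ∑ n ∈ Finset.Icc 1 (h - 1), z ^ n + z ^ h / (1 - z) = (1 - z)⁻¹ := by
  have e : 1 + ∑ n ∈ Finset.Icc 1 (h - 1), z ^ n = ∑ n ∈ Finset.range h, z ^ n := by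
    obtain ⟨k, rfl⟩ : ∃ k, h = k + 1 := ⟨h - 1, by omega⟩
    rw [Finset.sum_range_succ', pow_zero, add_comm]
    congr 1
    rw [Finset.range_eq_Ico, Finset.sum_Ico_add' (fun n => z ^ n) 0 k 1]
    rfl
  rw [e, geom_sum_eq h1.ne]
  have : 1 - z ≠ 0 := by linarith
  have : z - 1 ≠ 0 := by linarith
  field_simp
  ring

lemma one_add_sum_Icc_pow_le {z Z : ℝ} (h0 : 0 ≤ z) (hz : z ≤ Z) (h1 : Z < 1) {h : ℕ}
    (hh : 1 ≤ h) : 1 + ∑ n ∈ Finset.Icc 1 (h - 1), z ^ n ≤ 1 / (1 - Z) ^ 2 := by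
  have e := one_add_sum_Icc_pow_add (hz.trans_lt h1) hh
  have : 0 ≤ z ^ h / (1 - z) := div_nonneg (pow_nonneg h0 _) (by linarith)
  have h2 : (1 - z)⁻¹ ≤ (1 - Z)⁻¹ := inv_anti₀ (by linarith) (by linarith)
  have h3 : (1 - Z)⁻¹ ≤ 1 / (1 - Z) ^ 2 := by
    rw [inv_eq_one_div]
    have : 0 < 1 - Z := by linarith
    exact one_div_le_one_div_of_le (by positivity) (by nlinarith)
  linarith

/-- The discarded tails are ordered, since `z ↦ z^h / (1 - z)` increases, so the truncated
difference is at most the full one, `x / ((1 - x - q)(1 - q))`. This is the source of the squares in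
the product of the theorem. -/
lemma sum_Icc_pow_sub_pow_le {x q Z : ℝ} (hx : 0 ≤ x) (hq : 0 ≤ q) (hxq : x + q ≤ Z) (h1 : Z < 1)
    {h : ℕ} (hh : 1 ≤ h) :
    ∑ n ∈ Finset.Icc 1 (h - 1), ((x + q) ^ n - q ^ n) ≤ x / (1 - Z) ^ 2 := by
  have e1 := one_add_sum_Icc_pow_add (hxq.trans_lt h1) hh
  have e2 := one_add_sum_Icc_pow_add (show q < 1 by linarith) hh
  have h3 : q ^ h / (1 - q) ≤ (x + q) ^ h / (1 - (x + q)) :=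
    div_le_div₀ (by positivity) (pow_le_pow_left₀ hq (by linarith) _) (by linarith) (by linarith)
  have h4 : (1 - (x + q))⁻¹ - (1 - q)⁻¹ ≤ x / (1 - Z) ^ 2 := by
    have a : 0 < 1 - (x + q) := by linarith
    have b : 0 < 1 - q := by linarith
    have e : (1 - (x + q))⁻¹ - (1 - q)⁻¹ = x / ((1 - (x + q)) * (1 - q)) := by
      field_simp
      ring
    rw [e]
    refine div_le_div_of_nonneg_left hx (by nlinarith) ?_
    rw [pow_two]
    exact mul_le_mul (by linarith) (by linarith) (by linarith) a.le
  rw [Finset.sum_sub_distrib]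
  linarith

lemma tsum_pow_eq_add {A : Type*} [NormedRing A] [CompleteSpace A] {G : A} (hG : ‖G‖ < 1) {h : ℕ}
    (hh : 1 ≤ h) : ∑' n : ℕ, G ^ n =
      1 + ∑ n ∈ Finset.Icc 1 (h - 1), G ^ n + ∑' n : ℕ, G ^ (h + n) := by
  have hs : Summable fun n : ℕ => G ^ n := summable_geometric_of_norm_lt_one hG
  rw [← hs.sum_add_tsum_nat_add h]
  congr 1
  · obtain ⟨k, rfl⟩ : ∃ k, h = k + 1 := ⟨h - 1, by omega⟩
    rw [Finset.sum_range_succ', pow_zero, add_comm]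
    congr 1
    rw [Finset.range_eq_Ico, Finset.sum_Ico_add' (fun n => G ^ n) 0 k 1]
    rfl
  · simp_rw [add_comm h]

lemma norm_tsum_pow_add_le {H : Type} [NormedAddCommGroup H] [InnerProductSpace ℂ H]
    {G : H →L[ℂ] H} {z : ℝ} (hG : ‖G‖ ≤ z) (h1 : z < 1) (h : ℕ) :
    ‖∑' n : ℕ, G ^ (h + n)‖ ≤ z ^ h / (1 - z) := by
  have h0 : 0 ≤ z := (norm_nonneg _).trans hG
  refine tsum_of_norm_bounded (g := fun n => z ^ h * z ^ n) ?_ fun n => ?_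
  · exact (hasSum_geometric_of_lt_one h0 h1).mul_left _
  · rw [← pow_add]
    refine le_trans ?_ (pow_le_pow_left₀ (norm_nonneg _) hG _)
    rcases Nat.eq_zero_or_pos (h + n) with e | e
    · rw [e, pow_zero, pow_zero]
      exact ContinuousLinearMap.norm_id_le (𝕜 := ℂ) (E := H)
    · exact norm_pow_le' _ e

/-! ## The expansion of `Γ` and its estimates -/

lemma Gam_add_two {H : Type} [NormedAddCommGroup H] [InnerProductSpace ℂ H]
    {Wd Wu R : ℕ → H →L[ℂ] H} {i : ℕ} (hi : 2 ≤ i) :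
    Gam Wd Wu R (i + 2) = Wd (i + 2) * R i * (∑' n : ℕ, (Gam Wd Wu R i * R i) ^ n) * Wu (i + 2) := by
  obtain ⟨k, rfl⟩ : ∃ k, i = k + 2 := ⟨i - 2, by omega⟩
  rw [Gam]

section AbstractExpansion

variable {H : Type} [NormedAddCommGroup H] [InnerProductSpace ℂ H] [CompleteSpace H]
  {Wd Wu R : ℕ → H →L[ℂ] H}

lemma dress_add (j : ℕ) (X Y : H →L[ℂ] H) :
    dress Wd Wu R j (X + Y) = dress Wd Wu R j X + dress Wd Wu R j Y := by
  simp [dress, mul_add, add_mul]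

lemma dress_sum {ι : Type*} (j : ℕ) (s : Finset ι) (X : ι → H →L[ℂ] H) :
    dress Wd Wu R j (∑ i ∈ s, X i) = ∑ i ∈ s, dress Wd Wu R j (X i) := by
  simp [dress, Finset.mul_sum, Finset.sum_mul]

lemma sandwich_add (j : ℕ) (X Y : H →L[ℂ] H) :
    sandwich R j (X + Y) = sandwich R j X + sandwich R j Y := by
  simp [sandwich, mul_add, add_mul]

lemma sandwich_sum {ι : Type*} (j : ℕ) (s : Finset ι) (X : ι → H →L[ℂ] H) :
    sandwich R j (∑ i ∈ s, X i) = ∑ i ∈ s, sandwich R j (X i) := by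
  simp [sandwich, Finset.mul_sum, Finset.sum_mul]

lemma dress_one {j : ℕ} (hR : 0 ≤ R (j - 2)) : dress Wd Wu R j 1 = minusZero Wd Wu R j := by
  simp only [dress, minusZero, mul_one]
  rw [mul_assoc (Wd j), CFC.sqrt_mul_sqrt_self _ hR]


/-- `Γ R` itself need not be a contraction. Its powers equal powers of the sandwiched operator
between fixed bounded factors, and those decay geometrically. -/
lemma summable_mul_pow_of_sandwich {i : ℕ} (hR : 0 ≤ R i) (Γ : H →L[ℂ] H)
    (hG : ‖sandwich R i Γ‖ < 1) : Summable fun n : ℕ => (Γ * R i) ^ n := by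
  rw [← summable_nat_add_iff 1]
  have e : ∀ n : ℕ, (Γ * R i) ^ (n + 1) =
      Γ * CFC.sqrt (R i) * sandwich R i Γ ^ n * CFC.sqrt (R i) := by
    intro n
    have hs : SemiconjBy (Γ * CFC.sqrt (R i)) (sandwich R i Γ) (Γ * R i) := by
      have hr := CFC.sqrt_mul_sqrt_self (R i) hR
      rw [SemiconjBy, sandwich]
      generalize CFC.sqrt (R i) = r at hr ⊢
      rw [← hr]
      simp only [mul_assoc]
    rw [(hs.pow_right n).eq, pow_succ]
    conv_lhs => rw [← CFC.sqrt_mul_sqrt_self (R i) hR]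
    simp only [mul_assoc]
    rw [CFC.sqrt_mul_sqrt_self (R i) hR]
  simp_rw [e]
  exact ((summable_geometric_of_norm_lt_one hG).mul_left _).mul_right _

/-- `R^{1/2}` intertwines `Γ R` with `R^{1/2} Γ R^{1/2}`, and the relation passes to the convergent
geometric series. This symmetric form is the one to which the norm bound on `dress` applies. -/
lemma Gam_add_two_eq_dress {i : ℕ} (hi : 2 ≤ i) (hR : 0 ≤ R i)
    (hG : ‖sandwich R i (Gam Wd Wu R i)‖ < 1) : Gam Wd Wu R (i + 2) =
    dress Wd Wu R (i + 2) (∑' n : ℕ, sandwich R i (Gam Wd Wu R i) ^ n) := by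
  have hs : ∀ n : ℕ, CFC.sqrt (R i) * (Gam Wd Wu R i * R i) ^ n =
      sandwich R i (Gam Wd Wu R i) ^ n * CFC.sqrt (R i) := by
    intro n
    have : SemiconjBy (CFC.sqrt (R i)) (Gam Wd Wu R i * R i) (sandwich R i (Gam Wd Wu R i)) := by
      have hr := CFC.sqrt_mul_sqrt_self (R i) hR
      rw [SemiconjBy, sandwich]
      generalize CFC.sqrt (R i) = r at hr ⊢
      generalize Gam Wd Wu R i = Γ
      rw [← hr]
      simp only [mul_assoc]
    exact (this.pow_right n).eq
  have e : CFC.sqrt (R i) * ∑' n : ℕ, (Gam Wd Wu R i * R i) ^ n =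
      (∑' n : ℕ, sandwich R i (Gam Wd Wu R i) ^ n) * CFC.sqrt (R i) := by
    rw [← (summable_mul_pow_of_sandwich hR _ hG).tsum_mul_left,
      ← (summable_geometric_of_norm_lt_one hG).tsum_mul_right]
    exact tsum_congr hs
  rw [Gam_add_two hi, dress, Nat.add_sub_cancel, mul_assoc (Wd (i + 2) * CFC.sqrt (R i)), ← e]
  conv_lhs => rw [← CFC.sqrt_mul_sqrt_self (R i) hR]
  simp only [mul_assoc]
  rw [CFC.sqrt_mul_sqrt_self (R i) hR]

end AbstractExpansion

/-! ### The recursive terms as differences of powers -/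

section Terms

variable {H : Type} [NormedAddCommGroup H] [InnerProductSpace ℂ H] [CompleteSpace H]
  {Wd Wu R : ℕ → H →L[ℂ] H} {h : ℕ}

lemma minusTerm_last {j : ℕ} (hj : 2 ≤ j) : minusTerm Wd Wu R h j (j - 2) =
    minusZero Wd Wu R j + minusPos Wd Wu R h j := by
  obtain ⟨k, rfl⟩ : ∃ k, j = k + 2 := ⟨j - 2, by omega⟩
  rw [Nat.add_sub_cancel, minusTerm, if_pos rfl]

lemma minusTerm_mid {i : ℕ} (hi : 2 ≤ i) : minusTerm Wd Wu R h (i + 2) (i - 2) =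
    dress Wd Wu R (i + 2) (∑ n ∈ Finset.Icc 1 (h - 1),
      wordSum Finset.univ true (fun b : Bool => sandwich R i
        (if b then minusPos Wd Wu R h i else minusZero Wd Wu R i)) n) := by
  rw [minusTerm, if_neg (by omega), if_pos (by omega)]

lemma minusTerm_low {i l : ℕ} (hl : l + 4 ≤ i) : minusTerm Wd Wu R h (i + 2) l =
    dress Wd Wu R (i + 2) (∑ n ∈ Finset.Icc 1 (h - 1), wordSum (evens l (i - 2)) l
      (fun s => sandwich R i (minusTerm Wd Wu R h i s)) n) := by
  rw [minusTerm, if_neg (by omega), if_neg (by omega)]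

lemma plusTerm_last {i : ℕ} : plusTerm Wd Wu R h (i + 2) i =
    dress Wd Wu R (i + 2) (∑' n : ℕ, sandwich R i (Gam Wd Wu R i) ^ (h + n)) := by
  rw [plusTerm, if_pos rfl]

lemma plusTerm_low {i l : ℕ} (hl : l + 2 ≤ i) : plusTerm Wd Wu R h (i + 2) l =
    dress Wd Wu R (i + 2) (∑ n ∈ Finset.Icc 1 (h - 1),
      wordSum ((evens l (i - 2)).disjSum (evens 2 (i - 2))) (Sum.inl l)
        (fun s => sandwich R i
          (Sum.elim (fun s => plusTerm Wd Wu R h i s) (fun s => minusTerm Wd Wu R h i s) s)) n) := by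
  rw [plusTerm, if_neg (by omega)]

lemma erase_disjSum_evens {l q : ℕ} (hl : Even l) (s : Finset ℕ) :
    ((evens l q).disjSum s).erase (Sum.inl l) = (evens (l + 2) q).disjSum s := by
  rw [← evens_erase hl]
  ext (x | x) <;> simp

lemma minusTerm_mid_eq {i : ℕ} (hi : 2 ≤ i) : minusTerm Wd Wu R h (i + 2) (i - 2) =
    dress Wd Wu R (i + 2) (∑ n ∈ Finset.Icc 1 (h - 1),
      ((sandwich R i (minusZero Wd Wu R i) + sandwich R i (minusPos Wd Wu R h i)) ^ n -
        sandwich R i (minusZero Wd Wu R i) ^ n)) := by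
  rw [minusTerm_mid hi]
  congr 1
  refine Finset.sum_congr rfl fun n _ => ?_
  rw [wordSum_eq, show (Finset.univ : Finset Bool).erase true = {false} by decide]
  simp [add_comm]

lemma minusTerm_low_eq {i l : ℕ} (hl : l + 4 ≤ i) (hle : Even l) :
    minusTerm Wd Wu R h (i + 2) l =
    dress Wd Wu R (i + 2) (∑ n ∈ Finset.Icc 1 (h - 1),
      ((∑ s ∈ evens l (i - 2), sandwich R i (minusTerm Wd Wu R h i s)) ^ n -
        (∑ s ∈ evens (l + 2) (i - 2), sandwich R i (minusTerm Wd Wu R h i s)) ^ n)) := by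
  rw [minusTerm_low hl]
  congr 1
  refine Finset.sum_congr rfl fun n _ => ?_
  rw [wordSum_eq, evens_erase hle]

lemma plusTerm_low_eq {i l : ℕ} (hl : l + 2 ≤ i) (hle : Even l) :
    plusTerm Wd Wu R h (i + 2) l =
    dress Wd Wu R (i + 2) (∑ n ∈ Finset.Icc 1 (h - 1),
      ((∑ s ∈ evens l (i - 2), sandwich R i (plusTerm Wd Wu R h i s) +
          ∑ s ∈ evens 2 (i - 2), sandwich R i (minusTerm Wd Wu R h i s)) ^ n -
        (∑ s ∈ evens (l + 2) (i - 2), sandwich R i (plusTerm Wd Wu R h i s) +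
          ∑ s ∈ evens 2 (i - 2), sandwich R i (minusTerm Wd Wu R h i s)) ^ n)) := by
  rw [plusTerm_low hl]
  congr 1
  refine Finset.sum_congr rfl fun n _ => ?_
  rw [wordSum_eq, erase_disjSum_evens hle, Finset.sum_disjSum, Finset.sum_disjSum]
  rfl

end Terms

/-- The hypotheses of the abstract expansion: nonnegative `R_i`, relative bounds `K_j` of the
hopping terms, and a supersolution `Z` of the recursion `x ↦ K / (1 - x)`. -/
structure ExpansionBounds {H : Type} [NormedAddCommGroup H] [InnerProductSpace ℂ H]
    [CompleteSpace H] (Wd Wu R : ℕ → H →L[ℂ] H) (K Z : ℕ → ℝ) (T : ℕ) : Prop where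
  nonneg : ∀ i, Even i → i ≤ T → 0 ≤ R i
  norm_le : ∀ j, Even j → 2 ≤ j → j ≤ T → ∀ X,
    ‖sandwich R j (dress Wd Wu R j X)‖ ≤ K j * ‖X‖
  K_pos : ∀ j, Even j → 2 ≤ j → j ≤ T → 0 < K j
  K_le : ∀ j, Even j → 2 ≤ j → j + 2 ≤ T → K j ≤ Z j
  Z_lt_one : ∀ j, Even j → 2 ≤ j → j + 2 ≤ T → Z j < 1
  K_div_le : ∀ j, Even j → 2 ≤ j → j + 4 ≤ T → K (j + 2) * (1 - Z j)⁻¹ ≤ Z (j + 2)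

namespace ExpansionBounds

variable {H : Type} [NormedAddCommGroup H] [InnerProductSpace ℂ H] [CompleteSpace H]
  {Wd Wu R : ℕ → H →L[ℂ] H} {K Z : ℕ → ℝ} {T h : ℕ}

lemma norm_minusZero_le (B : ExpansionBounds Wd Wu R K Z T) {j : ℕ} (hj : Even j) (h2 : 2 ≤ j)
    (hT : j ≤ T) : ‖sandwich R j (minusZero Wd Wu R j)‖ ≤ K j := by
  rw [← dress_one (B.nonneg (j - 2) (by grind) (by omega))]
  refine (B.norm_le j hj h2 hT 1).trans ?_
  exact mul_le_of_le_one_right (B.K_pos j hj h2 hT).le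
    (ContinuousLinearMap.norm_id_le (𝕜 := ℂ) (E := H))

lemma Z_pos (B : ExpansionBounds Wd Wu R K Z T) {j : ℕ} (hj : Even j) (h2 : 2 ≤ j)
    (hT : j + 2 ≤ T) : 0 < Z j :=
  (B.K_pos j hj h2 (by omega)).trans_le (B.K_le j hj h2 hT)

/-- Induction against the supersolution: a bound `Z_i` at one level gives `K_{i+2} / (1 - Z_i)` at
the next by the geometric series, and `K_div_le` closes the step. -/
lemma norm_sandwich_Gam_le (B : ExpansionBounds Wd Wu R K Z T) {i : ℕ} (hi : Even i) (h2 : 2 ≤ i)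
    (hT : i + 2 ≤ T) : ‖sandwich R i (Gam Wd Wu R i)‖ ≤ Z i := by
  obtain ⟨k, rfl⟩ : ∃ k, i = 2 * k + 2 := by
    obtain ⟨k, rfl⟩ := hi
    exact ⟨k - 1, by omega⟩
  clear hi h2
  induction k with
  | zero =>
    exact (B.norm_minusZero_le even_two le_rfl (by omega)).trans (B.K_le 2 even_two le_rfl (by omega))
  | succ k ih =>
    have he : Even (2 * k + 2) := ⟨k + 1, by ring⟩
    have ih := ih (by omega)
    have h1 := B.Z_lt_one _ he (by omega) (by omega)
    rw [show 2 * (k + 1) + 2 = 2 * k + 2 + 2 by ring,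
      Gam_add_two_eq_dress (by omega) (B.nonneg _ he (by omega)) (ih.trans_lt h1)]
    refine (B.norm_le _ (by grind) (by omega) (by omega) _).trans ?_
    refine le_trans ?_ (B.K_div_le (2 * k + 2) he (by omega) (by omega))
    refine mul_le_mul_of_nonneg_left ?_ (B.K_pos _ (by grind) (by omega) (by omega)).le
    simpa using norm_tsum_pow_add_le ih h1 0

lemma summable_sandwich (B : ExpansionBounds Wd Wu R K Z T) {i : ℕ} (hi : Even i) (h2 : 2 ≤ i)
    (hT : i + 2 ≤ T) : Summable fun n : ℕ => sandwich R i (Gam Wd Wu R i) ^ n :=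
  summable_geometric_of_norm_lt_one
    ((B.norm_sandwich_Gam_le hi h2 hT).trans_lt (B.Z_lt_one i hi h2 hT))

lemma summable_mul (B : ExpansionBounds Wd Wu R K Z T) {i : ℕ} (hi : Even i) (h2 : 2 ≤ i)
    (hT : i + 2 ≤ T) : Summable fun n : ℕ => (Gam Wd Wu R i * R i) ^ n :=
  summable_mul_pow_of_sandwich (B.nonneg i hi (by omega)) _
    ((B.norm_sandwich_Gam_le hi h2 hT).trans_lt (B.Z_lt_one i hi h2 hT))

/-- The geometric series is cut into the power `0`, the powers `1, …, h - 1` and the powers from `h`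
on; the last part is by definition the newest plus term. -/
lemma Gam_eq_add (B : ExpansionBounds Wd Wu R K Z T) (hh : 1 ≤ h) {i : ℕ} (hi : Even i)
    (h2 : 2 ≤ i) (hT : i + 2 ≤ T) : Gam Wd Wu R (i + 2) = minusZero Wd Wu R (i + 2) +
      dress Wd Wu R (i + 2) (∑ n ∈ Finset.Icc 1 (h - 1), sandwich R i (Gam Wd Wu R i) ^ n) +
      plusTerm Wd Wu R h (i + 2) i := by
  have hG := (B.norm_sandwich_Gam_le hi h2 hT).trans_lt (B.Z_lt_one i hi h2 hT)
  have hR := B.nonneg i hi (by omega)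
  rw [Gam_add_two_eq_dress h2 hR hG, tsum_pow_eq_add hG hh, dress_add, dress_add, plusTerm_last,
    dress_one (by simpa using hR)]

/-- The splitting `Γ_i = ∑_l Γ_i^{l,-} + ∑_l Γ_i^{l,+}`. -/
theorem Gam_eq_sum (B : ExpansionBounds Wd Wu R K Z T) (hh : 1 ≤ h) {i : ℕ} (hi : Even i)
    (h4 : 4 ≤ i) (hT : i ≤ T) : Gam Wd Wu R i =
      ∑ l ∈ evens 2 (i - 2), minusTerm Wd Wu R h i l +
      ∑ l ∈ evens 2 (i - 2), plusTerm Wd Wu R h i l := by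
  obtain ⟨k, rfl⟩ : ∃ k, i = 2 * k + 4 := by
    obtain ⟨k, rfl⟩ := hi
    exact ⟨k - 2, by omega⟩
  clear hi h4
  induction k with
  | zero =>
    have e := B.Gam_eq_add hh even_two le_rfl (by omega)
    -- True by definition, because `Γ_2` contains no series and coincides with `Γ_2^{(0)}`.
    have e1 : minusPos Wd Wu R h (2 + 2) = dress Wd Wu R (2 + 2) (∑ n ∈ Finset.Icc 1 (h - 1),
        sandwich R 2 (Gam Wd Wu R 2) ^ n) := rfl
    have e2 := minusTerm_last (Wd := Wd) (Wu := Wu) (R := R) (h := h) (j := 2 + 2) (by omega)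
    simp only [Nat.add_sub_cancel] at e2
    simp only [mul_zero, zero_add, show 4 - 2 = 2 from rfl, evens_self even_two,
      Finset.sum_singleton]
    rw [show 4 = 2 + 2 from rfl, e, e2, e1]
  | succ k ih =>
    obtain ⟨i, hi⟩ : ∃ i, i = 2 * k + 4 := ⟨_, rfl⟩
    have he : Even i := ⟨k + 2, by omega⟩
    have hq : Even (i - 2) := ⟨k + 1, by omega⟩
    have hs := ih (by omega)
    rw [show 2 * (k + 1) + 4 = i + 2 by omega]
    rw [← hi] at hs
    have e := B.Gam_eq_add hh he (by omega) (by omega)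
    have e2 := minusTerm_last (Wd := Wd) (Wu := Wu) (R := R) (h := h) (j := i + 2) (by omega)
    have eX := minusTerm_last (Wd := Wd) (Wu := Wu) (R := R) (h := h) (j := i) (by omega)
    rw [Nat.add_sub_cancel] at e2 ⊢
    have e3 : ∀ f : ℕ → H →L[ℂ] H, ∑ l ∈ evens 2 i, f l = f i + ∑ l ∈ evens 2 (i - 2), f l := by
      intro f
      have := sum_evens_eq_right (p := 2) hq (by omega) f
      rwa [show i - 2 + 2 = i by omega] at this
    have e4 : ∀ f : ℕ → H →L[ℂ] H, ∑ l ∈ evens 2 (i - 2), f l =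
        f (i - 2) + ∑ l ∈ evens 2 (i - 2 - 2), f l := by
      intro f
      have := sum_evens_eq_right (p := 2) (q := i - 2 - 2) ⟨k, by omega⟩ (by omega) f
      rwa [show i - 2 - 2 + 2 = i - 2 by omega] at this
    have e5 : ∑ l ∈ evens 2 (i - 2 - 2), minusTerm Wd Wu R h (i + 2) l = _ :=
      Finset.sum_congr rfl fun l hl => by
        have := mem_evens.mp hl
        exact minusTerm_low_eq (by omega) this.2
    have e6 : ∑ l ∈ evens 2 (i - 2), plusTerm Wd Wu R h (i + 2) l = _ :=
      Finset.sum_congr rfl fun l hl => by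
        have := mem_evens.mp hl
        exact plusTerm_low_eq (by omega) this.2
    rw [e3, e3, e4 (fun l => minusTerm Wd Wu R h (i + 2) l), e5, e6, ← dress_sum, ← dress_sum, e, e2,
      minusTerm_mid_eq (by omega)]
    have hpos : minusPos Wd Wu R h (i + 2) = dress Wd Wu R (i + 2)
        (∑ n ∈ Finset.Icc 1 (h - 1), sandwich R i (minusZero Wd Wu R i) ^ n) := rfl
    rw [hpos, hs, sandwich_add, sandwich_sum, sandwich_sum]
    -- With `n` as the outer index, `pow_splitting` applies to each power of `⟨Γ_i⟩` after `Γ_i` has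
    -- been replaced by its own splitting.
    rw [Finset.sum_comm, Finset.sum_comm (s := evens 2 (i - 2))]
    have key := fun n => pow_splitting hq (by omega)
      (fun l => sandwich R i (minusTerm Wd Wu R h i l))
      (fun l => sandwich R i (plusTerm Wd Wu R h i l)) (sandwich R i (minusZero Wd Wu R i))
      (sandwich R i (minusPos Wd Wu R h i)) (by rw [eX, sandwich_add]) n
    simp_rw [← key, Finset.sum_add_distrib, dress_add]
    abel

end ExpansionBounds

/-! ### Scalar majorants of the terms -/

lemma evens_subset {p p' q : ℕ} (h : p ≤ p') : evens p' q ⊆ evens p q := by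
  intro s
  simp only [mem_evens]
  exact fun hs => ⟨⟨h.trans hs.1.1, hs.1.2⟩, hs.2⟩

/-- Numbers dominating the sandwiched terms of the expansion of `Γ_i`. -/
structure HasMajorants {H : Type} [NormedAddCommGroup H] [InnerProductSpace ℂ H]
    [CompleteSpace H] (Wd Wu R : ℕ → H →L[ℂ] H) (K Z : ℕ → ℝ) (h i : ℕ) (μ π : ℕ → ℝ) (ρ : ℝ) :
    Prop where
  minus_nonneg : ∀ l, 0 ≤ μ l
  plus_nonneg : ∀ l, 0 ≤ π l
  pos_nonneg : 0 ≤ ρ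
  minus_le : ∀ l ∈ evens 2 (i - 2), ‖sandwich R i (minusTerm Wd Wu R h i l)‖ ≤ μ l
  plus_le : ∀ l ∈ evens 2 (i - 2), ‖sandwich R i (plusTerm Wd Wu R h i l)‖ ≤ π l
  pos_le : ‖sandwich R i (minusPos Wd Wu R h i)‖ ≤ ρ
  last : μ (i - 2) = K i + ρ
  sum_le : ∑ l ∈ evens 2 (i - 2), μ l + ∑ l ∈ evens 2 (i - 2), π l ≤ K i * (1 - Z (i - 2))⁻¹
  minus_le_prod : ∀ l ∈ evens 2 (i - 2), μ l ≤ ∏ f ∈ evens (l + 2) i, K f / (1 - Z (f - 2)) ^ 2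
  plus_le_prod : ∀ l ∈ evens 2 (i - 2),
    π l ≤ Z l ^ h * ∏ f ∈ evens (l + 2) i, K f / (1 - Z (f - 2)) ^ 2

namespace ExpansionBounds

variable {H : Type} [NormedAddCommGroup H] [InnerProductSpace ℂ H] [CompleteSpace H]
  {Wd Wu R : ℕ → H →L[ℂ] H} {K Z : ℕ → ℝ} {T h : ℕ}

lemma norm_minusPos_le (B : ExpansionBounds Wd Wu R K Z T) {i : ℕ} (hi : Even i)
    (h2 : 2 ≤ i) (hT : i + 2 ≤ T) : ‖sandwich R (i + 2) (minusPos Wd Wu R h (i + 2))‖ ≤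
      K (i + 2) * ∑ n ∈ Finset.Icc 1 (h - 1), K i ^ n := by
  refine (B.norm_le (i + 2) (by grind) (by omega) hT _).trans ?_
  refine mul_le_mul_of_nonneg_left ?_ (B.K_pos _ (by grind) (by omega) hT).le
  refine norm_sum_le_of_le _ fun n hn => ?_
  rw [Nat.add_sub_cancel]
  exact (norm_pow_le' _ (Finset.mem_Icc.mp hn).1).trans
    (pow_le_pow_left₀ (norm_nonneg _) (B.norm_minusZero_le hi h2 (by omega)) _)

lemma norm_minusTerm_last_le (B : ExpansionBounds Wd Wu R K Z T) {i : ℕ} (hi : Even i)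
    (h2 : 2 ≤ i) (hT : i + 2 ≤ T) : ‖sandwich R (i + 2) (minusTerm Wd Wu R h (i + 2) i)‖ ≤
      K (i + 2) + K (i + 2) * ∑ n ∈ Finset.Icc 1 (h - 1), K i ^ n := by
  have e2 := minusTerm_last (Wd := Wd) (Wu := Wu) (R := R) (h := h) (j := i + 2) (by omega)
  rw [Nat.add_sub_cancel] at e2
  rw [e2, sandwich_add]
  exact norm_add_le_of_le (B.norm_minusZero_le (by grind) (by omega) hT)
    (B.norm_minusPos_le hi h2 hT)

lemma norm_plusTerm_last_le (B : ExpansionBounds Wd Wu R K Z T) {i : ℕ} (hi : Even i)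
    (h2 : 2 ≤ i) (hT : i + 2 ≤ T) : ‖sandwich R (i + 2) (plusTerm Wd Wu R h (i + 2) i)‖ ≤
      K (i + 2) * (Z i ^ h / (1 - Z i)) := by
  rw [plusTerm_last]
  refine (B.norm_le (i + 2) (by grind) (by omega) hT _).trans ?_
  refine mul_le_mul_of_nonneg_left ?_ (B.K_pos _ (by grind) (by omega) hT).le
  exact norm_tsum_pow_add_le (B.norm_sandwich_Gam_le hi h2 hT) (B.Z_lt_one i hi h2 hT) h

lemma norm_sum_wordSum_le (B : ExpansionBounds Wd Wu R K Z T) {j : ℕ} (hj : Even j) (h2 : 2 ≤ j)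
    (hT : j ≤ T) {ι : Type} [DecidableEq ι] (S : Finset ι) (s₀ : ι) (X : ι → H →L[ℂ] H)
    (x : ι → ℝ) (hx : ∀ s ∈ S, ‖X s‖ ≤ x s) :
    ‖sandwich R j (dress Wd Wu R j (∑ n ∈ Finset.Icc 1 (h - 1), wordSum S s₀ X n))‖ ≤
      K j * ∑ n ∈ Finset.Icc 1 (h - 1), ((∑ s ∈ S, x s) ^ n - (∑ s ∈ S.erase s₀, x s) ^ n) := by
  refine (B.norm_le j hj h2 hT _).trans ?_
  refine mul_le_mul_of_nonneg_left ?_ (B.K_pos _ hj h2 hT).le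
  exact norm_sum_le_of_le _ fun n _ => norm_wordSum_le S s₀ X x hx n

/-- Only `l = 2` occurs. Since `K_2 ≤ Z_2`, the truncated sum in `K_2` and the tail in `Z_2`
together stay below `(1 - Z_2)⁻¹`. -/
lemma hasMajorants_four (B : ExpansionBounds Wd Wu R K Z T) (hh : 1 ≤ h) (hT : 4 ≤ T) :
    ∃ μ π ρ, HasMajorants Wd Wu R K Z h 4 μ π ρ := by
  have h1 := B.Z_lt_one 2 even_two le_rfl hT
  have hK2 := B.K_pos 2 even_two le_rfl (by omega)
  have hK4 := B.K_pos 4 (by decide) (by omega) hT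
  have hKZ := B.K_le 2 even_two le_rfl hT
  have hZ0 : 0 < Z 2 := hK2.trans_le hKZ
  have hs : 0 ≤ ∑ n ∈ Finset.Icc 1 (h - 1), K 2 ^ n := Finset.sum_nonneg fun n _ => by positivity
  have hz : 0 ≤ Z 2 ^ h / (1 - Z 2) := div_nonneg (by positivity) (by linarith)
  have hsZ : ∑ n ∈ Finset.Icc 1 (h - 1), K 2 ^ n ≤ ∑ n ∈ Finset.Icc 1 (h - 1), Z 2 ^ n :=
    Finset.sum_le_sum fun n _ => pow_le_pow_left₀ hK2.le hKZ n
  have hz2 : Z 2 ^ h / (1 - Z 2) ≤ Z 2 ^ h / (1 - Z 2) ^ 2 :=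
    div_le_div_of_nonneg_left (by positivity) (by nlinarith) (by nlinarith)
  have hset : evens 2 (4 - 2) = {2} := evens_self even_two
  have hset' : evens (2 + 2) 4 = {4} := evens_self (by decide)
  refine ⟨fun _ => K 4 + K 4 * ∑ n ∈ Finset.Icc 1 (h - 1), K 2 ^ n,
    fun _ => K 4 * (Z 2 ^ h / (1 - Z 2)), K 4 * ∑ n ∈ Finset.Icc 1 (h - 1), K 2 ^ n,
    ⟨fun _ => by positivity, fun _ => by positivity, by positivity, ?_, ?_,
      B.norm_minusPos_le even_two le_rfl hT, rfl, ?_, ?_, ?_⟩⟩ <;>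
    simp only [hset, Finset.mem_singleton, forall_eq, Finset.sum_singleton, hset',
      Finset.prod_singleton]
  · exact B.norm_minusTerm_last_le even_two le_rfl hT
  · exact B.norm_plusTerm_last_le even_two le_rfl hT
  · rw [show 4 - 2 = 2 from rfl, ← one_add_sum_Icc_pow_add h1 hh]
    nlinarith
  · have := one_add_sum_Icc_pow_le hK2.le hKZ h1 hh
    rw [show 4 - 2 = 2 from rfl, div_eq_mul_one_div]
    nlinarith
  · rw [show 4 - 2 = 2 from rfl, mul_div_left_comm (Z 2 ^ h)]
    exact mul_le_mul_of_nonneg_left hz2 hK4.le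

/-- The new majorants are the word sums evaluated at the old ones. Their total is controlled because
the old total is at most `Z_i`; each individual term carries the old majorant of its distinguished
letter times at most `K_{i+2} / (1 - Z_i)²`. -/
lemma hasMajorants_step (B : ExpansionBounds Wd Wu R K Z T) (hh : 1 ≤ h) {i : ℕ} (hi : Even i)
    (h4 : 4 ≤ i) (hT : i + 2 ≤ T) {μ π : ℕ → ℝ} {ρ : ℝ}
    (M : HasMajorants Wd Wu R K Z h i μ π ρ) :
    ∃ μ' π' ρ', HasMajorants Wd Wu R K Z h (i + 2) μ' π' ρ' := by
  have h1 := B.Z_lt_one i hi (by omega) hT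
  have hK := B.K_pos i hi (by omega) (by omega)
  have hK' := B.K_pos (i + 2) (by grind) (by omega) hT
  have hKZ := B.K_le i hi (by omega) hT
  have hZ0 : 0 < Z i := hK.trans_le hKZ
  have hq : Even (i - 2) := by grind
  have hq' : Even (i - 2 - 2) := by grind
  have hs : 0 ≤ ∑ n ∈ Finset.Icc 1 (h - 1), K i ^ n := Finset.sum_nonneg fun n _ => by positivity
  have hz : 0 ≤ Z i ^ h / (1 - Z i) := div_nonneg (by positivity) (by linarith)
  have hz2 : Z i ^ h / (1 - Z i) ≤ Z i ^ h / (1 - Z i) ^ 2 :=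
    div_le_div_of_nonneg_left (by positivity) (by nlinarith) (by nlinarith)
  have hY : ∑ l ∈ evens 2 (i - 2), μ l + ∑ l ∈ evens 2 (i - 2), π l ≤ Z i := by
    have := B.K_div_le (i - 2) hq (by omega) (by omega)
    rw [show i - 2 + 2 = i by omega] at this
    exact M.sum_le.trans this
  have hμ0 : ∀ l, 0 ≤ ∑ s ∈ evens l (i - 2), μ s := fun l =>
    Finset.sum_nonneg fun s _ => M.minus_nonneg s
  have hπ0 : ∀ l, 0 ≤ ∑ s ∈ evens l (i - 2), π s := fun l =>
    Finset.sum_nonneg fun s _ => M.plus_nonneg s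
  have hμm : ∀ l l', l ≤ l' → ∑ s ∈ evens l' (i - 2), μ s ≤ ∑ s ∈ evens l (i - 2), μ s :=
    fun l l' hl => Finset.sum_le_sum_of_subset_of_nonneg (evens_subset hl)
      fun s _ _ => M.minus_nonneg s
  have hπm : ∀ l l', l ≤ l' → ∑ s ∈ evens l' (i - 2), π s ≤ ∑ s ∈ evens l (i - 2), π s :=
    fun l l' hl => Finset.sum_le_sum_of_subset_of_nonneg (evens_subset hl)
      fun s _ _ => M.plus_nonneg s
  -- The two letters of the case `l = i - 2` are the two halves of the majorant `μ (i - 2)`, so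
  -- together they also stay below `Z_i`.
  have hlast : ρ + K i ≤ ∑ s ∈ evens 2 (i - 2), μ s := by
    have := M.last
    have h3 : μ (i - 2) = ∑ s ∈ evens (i - 2) (i - 2), μ s := by
      rw [evens_self hq, Finset.sum_singleton]
    linarith [hμm 2 (i - 2) (by omega)]
  have hmid := B.norm_sum_wordSum_le (j := i + 2) (h := h) (by grind) (by omega) hT
    Finset.univ true (fun b : Bool => sandwich R i
      (if b then minusPos Wd Wu R h i else minusZero Wd Wu R i))
    (fun b => if b then ρ else K i) (by
      rintro (b | b) _
      · simpa using B.norm_minusZero_le hi (by omega) (by omega)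
      · simpa using M.pos_le)
  rw [show (Finset.univ : Finset Bool).erase true = {false} by decide, ← minusTerm_mid (by omega)]
    at hmid
  simp only [Fintype.univ_bool, Finset.mem_singleton, Bool.true_eq_false, not_false_eq_true,
    Finset.sum_insert, Finset.sum_singleton, if_true, Bool.false_eq_true, if_false] at hmid
  let ρ' := K (i + 2) * ∑ n ∈ Finset.Icc 1 (h - 1), K i ^ n
  -- `F` serves the minus terms with `l ≤ i - 4`, `P` the plus terms with `l ≤ i - 2`, and `E` the
  -- two-letter alphabet at `l = i - 2`.
  let F : ℕ → ℝ := fun l => ∑ n ∈ Finset.Icc 1 (h - 1),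
    ((∑ s ∈ evens l (i - 2), μ s) ^ n - (∑ s ∈ evens (l + 2) (i - 2), μ s) ^ n)
  let P : ℕ → ℝ := fun l => ∑ n ∈ Finset.Icc 1 (h - 1),
    ((∑ s ∈ evens l (i - 2), π s + ∑ s ∈ evens 2 (i - 2), μ s) ^ n -
      (∑ s ∈ evens (l + 2) (i - 2), π s + ∑ s ∈ evens 2 (i - 2), μ s) ^ n)
  let E : ℝ := ∑ n ∈ Finset.Icc 1 (h - 1), ((ρ + K i) ^ n - K i ^ n)
  have hF0 : ∀ l, 0 ≤ F l := fun l => Finset.sum_nonneg fun n _ =>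
    sub_nonneg.mpr (pow_le_pow_left₀ (hμ0 _) (hμm _ _ (by omega)) n)
  have hP0 : ∀ l, 0 ≤ P l := fun l => Finset.sum_nonneg fun n _ =>
    sub_nonneg.mpr (pow_le_pow_left₀ (add_nonneg (hπ0 _) (hμ0 _))
      (add_le_add_left (hπm _ _ (by omega)) _) n)
  have hE0 : 0 ≤ E := Finset.sum_nonneg fun n _ =>
    sub_nonneg.mpr (pow_le_pow_left₀ hK.le (by linarith [M.pos_nonneg]) n)
  let μ' : ℕ → ℝ := fun l => if l = i then K (i + 2) + ρ' else if l + 2 = i then K (i + 2) * E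
    else K (i + 2) * F l
  let π' : ℕ → ℝ := fun l => if l = i then K (i + 2) * (Z i ^ h / (1 - Z i)) else K (i + 2) * P l
  have hμi : μ' i = K (i + 2) + ρ' := if_pos rfl
  have hμi2 : μ' (i - 2) = K (i + 2) * E := by
    simp only [μ']
    rw [if_neg (by omega), if_pos (by omega)]
  have hμl : ∀ l, l + 4 ≤ i → μ' l = K (i + 2) * F l := fun l hl => by
    simp only [μ']
    rw [if_neg (by omega), if_neg (by omega)]
  have hπi : π' i = K (i + 2) * (Z i ^ h / (1 - Z i)) := if_pos rfl
  have hπl : ∀ l, l + 2 ≤ i → π' l = K (i + 2) * P l := fun l hl => if_neg (by omega)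
  have e3 : ∀ f : ℕ → ℝ, ∑ l ∈ evens 2 i, f l = f i + ∑ l ∈ evens 2 (i - 2), f l := by
    intro f
    have := sum_evens_eq_right (p := 2) hq (by omega) f
    rwa [show i - 2 + 2 = i by omega] at this
  have e4 : ∀ f : ℕ → ℝ, ∑ l ∈ evens 2 (i - 2), f l =
      f (i - 2) + ∑ l ∈ evens 2 (i - 2 - 2), f l := by
    intro f
    have := sum_evens_eq_right (p := 2) (q := i - 2 - 2) hq' (by omega) f
    rwa [show i - 2 - 2 + 2 = i - 2 by omega] at this
  have hcases : ∀ l ∈ evens 2 i, l = i ∨ l = i - 2 ∨ (2 ≤ l ∧ l + 4 ≤ i ∧ Even l) := by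
    intro l hl
    have := mem_evens.mp hl
    grind
  have hcases' : ∀ l ∈ evens 2 i, l = i ∨ (2 ≤ l ∧ l + 2 ≤ i ∧ Even l) := by
    intro l hl
    have := mem_evens.mp hl
    grind
  have eprod : ∀ l, l ≤ i → ∏ f ∈ evens (l + 2) (i + 2), K f / (1 - Z (f - 2)) ^ 2 =
      K (i + 2) / (1 - Z i) ^ 2 * ∏ f ∈ evens (l + 2) i, K f / (1 - Z (f - 2)) ^ 2 := by
    intro l hl
    rw [prod_evens_eq_right hi (by omega), Nat.add_sub_cancel]
  refine ⟨μ', π', ρ', ?_, ?_, ?_, ?_, ?_, B.norm_minusPos_le hi (by omega) hT, ?_, ?_, ?_, ?_⟩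
  · intro l
    change 0 ≤ if l = i then K (i + 2) + ρ' else if l + 2 = i then K (i + 2) * E
      else K (i + 2) * F l
    split_ifs
    exacts [add_nonneg hK'.le (mul_nonneg hK'.le hs), mul_nonneg hK'.le hE0,
      mul_nonneg hK'.le (hF0 l)]
  · intro l
    change 0 ≤ if l = i then K (i + 2) * (Z i ^ h / (1 - Z i)) else K (i + 2) * P l
    split_ifs
    exacts [mul_nonneg hK'.le hz, mul_nonneg hK'.le (hP0 l)]
  · exact mul_nonneg hK'.le hs
  · rw [Nat.add_sub_cancel]
    intro l hl
    rcases hcases l hl with rfl | rfl | ⟨hl2, hl4, hle⟩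
    · rw [hμi]
      exact B.norm_minusTerm_last_le hi (by omega) hT
    · rw [hμi2]
      exact hmid
    · rw [hμl l hl4, minusTerm_low hl4]
      have := B.norm_sum_wordSum_le (j := i + 2) (h := h) (by grind) (by omega) hT
        (evens l (i - 2)) l (fun s => sandwich R i (minusTerm Wd Wu R h i s)) μ
        fun s hs => M.minus_le s (evens_subset hl2 hs)
      rwa [evens_erase hle] at this
  · rw [Nat.add_sub_cancel]
    intro l hl
    rcases hcases' l hl with rfl | ⟨hl2, hl4, hle⟩
    · rw [hπi]
      exact B.norm_plusTerm_last_le hi (by omega) hT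
    · rw [hπl l hl4, plusTerm_low hl4]
      have := B.norm_sum_wordSum_le (j := i + 2) (h := h) (by grind) (by omega) hT
        ((evens l (i - 2)).disjSum (evens 2 (i - 2))) (Sum.inl l)
        (fun s => sandwich R i
          (Sum.elim (fun s => plusTerm Wd Wu R h i s) (fun s => minusTerm Wd Wu R h i s) s))
        (Sum.elim π μ) (by
          rintro (s | s) hs
          · exact M.plus_le s (evens_subset hl2 (Finset.inl_mem_disjSum.mp hs))
          · exact M.minus_le s (Finset.inr_mem_disjSum.mp hs))
      rw [erase_disjSum_evens hle, Finset.sum_disjSum, Finset.sum_disjSum] at this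
      exact this
  · rw [Nat.add_sub_cancel, hμi]
  · rw [Nat.add_sub_cancel, e3, e3, e4 μ', hμi, hμi2, hπi,
      Finset.sum_congr rfl fun l hl => hμl l (by have := mem_evens.mp hl; omega),
      Finset.sum_congr rfl fun l hl => hπl l (by have := mem_evens.mp hl; omega),
      ← Finset.mul_sum, ← Finset.mul_sum, ← one_add_sum_Icc_pow_add h1 hh]
    -- The operator identity behind the splitting is reused in `ℝ`: for each `n` the pieces add up
    -- to the `n`-th power of the old total, which is at most `Z_i ^ n`.
    have key : ∑ n ∈ Finset.Icc 1 (h - 1), K i ^ n + E + ∑ l ∈ evens 2 (i - 2 - 2), F l +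
        ∑ l ∈ evens 2 (i - 2), P l ≤ ∑ n ∈ Finset.Icc 1 (h - 1), Z i ^ n := by
      have e5 : ∑ l ∈ evens 2 (i - 2 - 2), F l = _ := Finset.sum_comm
      have e6 : ∑ l ∈ evens 2 (i - 2), P l = _ := Finset.sum_comm
      rw [e5, e6, ← Finset.sum_add_distrib, ← Finset.sum_add_distrib, ← Finset.sum_add_distrib]
      refine Finset.sum_le_sum fun n _ => ?_
      have := pow_splitting hq (by omega) μ π (K i) ρ M.last n
      rw [add_comm ρ, this]
      exact pow_le_pow_left₀ (add_nonneg (hμ0 2) (hπ0 2)) hY n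
    simp only [ρ']
    nlinarith
  · rw [Nat.add_sub_cancel]
    intro l hl
    rcases hcases l hl with rfl | rfl | ⟨hl2, hl4, hle⟩
    · rw [hμi, eprod _ le_rfl, evens_eq_empty (by omega), Finset.prod_empty, mul_one]
      have := one_add_sum_Icc_pow_le hK.le hKZ h1 hh
      rw [div_eq_mul_one_div]
      simp only [ρ']
      nlinarith
    · rw [hμi2, eprod _ (by omega), div_mul_eq_mul_div, mul_div_assoc]
      refine mul_le_mul_of_nonneg_left ?_ hK'.le
      -- The distinguished letter is the `(>0)` part, so `ρ` is the inherited factor; it is at most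
      -- `μ (i - 2) = K_i + ρ`, for which the product bound is already known.
      have hE : E ≤ ρ / (1 - Z i) ^ 2 := sum_Icc_pow_sub_pow_le M.pos_nonneg hK.le
        (by linarith [hπ0 2]) h1 hh
      refine hE.trans (div_le_div_of_nonneg_right ?_ (by positivity))
      refine le_trans ?_ (M.minus_le_prod (i - 2) (mem_evens.mpr ⟨⟨by omega, le_rfl⟩, hq⟩))
      rw [M.last]
      linarith
    · rw [hμl l hl4, eprod _ (by omega), div_mul_eq_mul_div, mul_div_assoc]
      refine mul_le_mul_of_nonneg_left ?_ hK'.le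
      have hsum := sum_evens_eq hle (show l ≤ i - 2 by omega) μ
      have hF : F l ≤ μ l / (1 - Z i) ^ 2 := by
        simp only [F]
        rw [hsum]
        exact sum_Icc_pow_sub_pow_le (M.minus_nonneg l) (hμ0 _)
          (by rw [← hsum]; linarith [hπ0 2, hμm 2 l hl2]) h1 hh
      refine hF.trans (div_le_div_of_nonneg_right ?_ (by positivity))
      exact M.minus_le_prod l (mem_evens.mpr ⟨⟨hl2, by omega⟩, hle⟩)
  · rw [Nat.add_sub_cancel]
    intro l hl
    rcases hcases' l hl with rfl | ⟨hl2, hl4, hle⟩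
    · rw [hπi, eprod _ le_rfl, evens_eq_empty (by omega), Finset.prod_empty, mul_one,
        mul_div_left_comm (Z l ^ h)]
      exact mul_le_mul_of_nonneg_left hz2 hK'.le
    · rw [hπl l hl4, eprod _ (by omega), mul_left_comm, div_mul_eq_mul_div, mul_div_assoc]
      refine mul_le_mul_of_nonneg_left ?_ hK'.le
      have hsum := sum_evens_eq hle (show l ≤ i - 2 by omega) π
      have hP : P l ≤ π l / (1 - Z i) ^ 2 := by
        simp only [P]
        rw [hsum]
        simp_rw [add_assoc (π l)]
        exact sum_Icc_pow_sub_pow_le (M.plus_nonneg l) (add_nonneg (hπ0 _) (hμ0 _))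
          (by rw [← add_assoc, ← hsum]; linarith [hπm 2 l hl2]) h1 hh
      refine hP.trans (div_le_div_of_nonneg_right ?_ (by positivity))
      exact M.plus_le_prod l (mem_evens.mpr ⟨⟨hl2, by omega⟩, hle⟩)

lemma exists_hasMajorants (B : ExpansionBounds Wd Wu R K Z T) (hh : 1 ≤ h) {i : ℕ} (hi : Even i)
    (h4 : 4 ≤ i) (hT : i ≤ T) : ∃ μ π ρ, HasMajorants Wd Wu R K Z h i μ π ρ := by
  obtain ⟨k, rfl⟩ : ∃ k, i = 2 * k + 4 := by
    obtain ⟨k, rfl⟩ := hi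
    exact ⟨k - 2, by omega⟩
  clear hi h4
  induction k with
  | zero => exact B.hasMajorants_four hh hT
  | succ k ih =>
    obtain ⟨μ, π, ρ, M⟩ := ih (by omega)
    exact B.hasMajorants_step hh ⟨k + 2, by ring⟩ (by omega) hT M

/-- The estimates of the terms of the expansion. -/
theorem norm_terms_le (B : ExpansionBounds Wd Wu R K Z T) (hh : 1 ≤ h) {i : ℕ} (hi : Even i)
    (h4 : 4 ≤ i) (hT : i ≤ T) {l : ℕ} (hl : Even l) (h2 : 2 ≤ l) (hli : l + 2 ≤ i) :
    ‖sandwich R i (minusTerm Wd Wu R h i l)‖ ≤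
        ∏ f ∈ evens (l + 2) i, K f / (1 - Z (f - 2)) ^ 2 ∧
      ‖sandwich R i (plusTerm Wd Wu R h i l)‖ ≤
        Z l ^ h * ∏ f ∈ evens (l + 2) i, K f / (1 - Z (f - 2)) ^ 2 := by
  obtain ⟨μ, π, ρ, M⟩ := B.exists_hasMajorants hh hi h4 hT
  have hm : l ∈ evens 2 (i - 2) := mem_evens.mpr ⟨⟨h2, by omega⟩, hl⟩
  exact ⟨(M.minus_le l hm).trans (M.minus_le_prod l hm),
    (M.plus_le l hm).trans (M.plus_le_prod l hm)⟩

end ExpansionBounds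

/-! ## Estimates of the constants -/

section Constants

/-- All constants are parametrized by `e = √ε`. For small `e` the point `δ = 1 + e` lies in `[0,2)`,
so the characteristic function disappears and only `√(e⁴ + 2e²)` remains non-polynomial. -/
lemma chi_one_add {e : ℝ} (h0 : 0 ≤ e) (h1 : e < 1) : chi (1 + e) = 1 := by
  rw [chi, Set.indicator_of_mem]
  · rfl
  · exact ⟨by linarith, by linarith⟩

lemma bConst_sq {e : ℝ} (h0 : 0 ≤ e) (h1 : e < 1) :
    bConst (e ^ 2) = (1 + e ^ 2) * (1 + e) * Real.sqrt (e ^ 4 + 2 * e ^ 2) := by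
  rw [bConst, Real.sqrt_sq h0, chi_one_add h0 h1, mul_one]
  ring_nf

lemma cConst_sq {e : ℝ} (h0 : 0 ≤ e) (h1 : e < 1) :
    cConst (e ^ 2) = -(1 - (1 + e) ^ 2) * (e ^ 4 + 2 * e ^ 2) := by
  rw [cConst, Real.sqrt_sq h0, chi_one_add h0 h1, mul_one]
  ring_nf

lemma sqrt_bounds {e : ℝ} (h0 : 0 < e) (h1 : e ≤ 1 / 100) :
    7 / 5 * e ≤ Real.sqrt (e ^ 4 + 2 * e ^ 2) ∧ Real.sqrt (e ^ 4 + 2 * e ^ 2) ≤ 3 / 2 * e := by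
  constructor
  · apply Real.le_sqrt_of_sq_le
    nlinarith [sq_nonneg e, sq_nonneg (e ^ 2)]
  · rw [Real.sqrt_le_left (by positivity)]
    have : e ^ 2 ≤ 1 / 4 := by nlinarith
    nlinarith [sq_nonneg e, sq_nonneg (e ^ 2)]

lemma bConst_bounds {e : ℝ} (h0 : 0 < e) (h1 : e ≤ 1 / 100) :
    7 / 5 * e ≤ bConst (e ^ 2) ∧ bConst (e ^ 2) ≤ 2 * e := by
  obtain ⟨hl, hu⟩ := sqrt_bounds h0 h1
  rw [bConst_sq h0.le (by linarith)]
  have hp : 1 ≤ (1 + e ^ 2) * (1 + e) := by nlinarith [sq_nonneg e]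
  have hq : (1 + e ^ 2) * (1 + e) ≤ 4 / 3 := by
    have : e ^ 2 ≤ 1 / 100 := by nlinarith
    nlinarith [sq_nonneg e]
  constructor
  · nlinarith [Real.sqrt_nonneg (e ^ 4 + 2 * e ^ 2)]
  · nlinarith [Real.sqrt_nonneg (e ^ 4 + 2 * e ^ 2)]

lemma cConst_bounds {e : ℝ} (h0 : 0 < e) (h1 : e ≤ 1 / 100) :
    0 ≤ cConst (e ^ 2) ∧ cConst (e ^ 2) ≤ 1 := by
  rw [cConst_sq h0.le (by linarith)]
  have h2 : -(1 - (1 + e) ^ 2) = 2 * e + e ^ 2 := by ring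
  rw [h2]
  have h3 : e ^ 2 ≤ 1 / 100 := by nlinarith
  have h4 : e ^ 4 ≤ 1 / 100 := by nlinarith [sq_nonneg (e ^ 2)]
  refine ⟨by positivity, ?_⟩
  have a : 2 * e + e ^ 2 ≤ 1 := by linarith
  have b : e ^ 4 + 2 * e ^ 2 ≤ 1 := by linarith
  exact mul_le_one₀ a (by positivity) b

/-- `1 / (4 K)` with `a = 2 ε`, as a function of `x = N - i + 1`. -/
noncomputable def invK (ε x : ℝ) : ℝ := 1 + 2 * ε - 2 * bConst ε / x - (1 - cConst ε) / x ^ 2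

lemma invK_mono {e : ℝ} (h0 : 0 < e) (h1 : e ≤ 1 / 100) {x x' : ℝ} (hx : 0 < x) (hxx : x ≤ x') :
    invK (e ^ 2) x ≤ invK (e ^ 2) x' := by
  have hb : 0 ≤ bConst (e ^ 2) := by linarith [bConst_bounds h0 h1]
  have hc : 0 ≤ 1 - cConst (e ^ 2) := by linarith [cConst_bounds h0 h1]
  unfold invK
  have := div_le_div_of_nonneg_left (by positivity : 0 ≤ 2 * bConst (e ^ 2)) hx hxx
  have := div_le_div_of_nonneg_left hc (by positivity : 0 < x ^ 2)
    (pow_le_pow_left₀ hx.le hxx 2)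
  linarith

lemma half_le_invK {e : ℝ} (h0 : 0 < e) (h1 : e ≤ 1 / 100) {x : ℝ} (hx : 3 ≤ x) :
    1 / 2 ≤ invK (e ^ 2) x := by
  refine le_trans ?_ (invK_mono h0 h1 (by norm_num) hx)
  have hb := bConst_bounds h0 h1
  have hc := cConst_bounds h0 h1
  unfold invK
  nlinarith [sq_nonneg e]

/-- The shift `τ = ε^Θ` pays for the error terms. The gain `2bτ·xy` is at least `28e²·xy` because `b
≥ 7e/5` and `τ ≥ 10e`; the losses `D x²` and `4b²·xy` are at most `10e²·xy` and `16e²·xy`. The other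
terms of the exact difference are nonnegative. -/
lemma supersolution_poly {e b τ D x y : ℝ} (h0 : 0 < e) (hb : 7 / 5 * e ≤ b) (hb2 : b ≤ 2 * e)
    (hτ : 10 * e ≤ τ) (hτ1 : τ ≤ 1 / 10) (hD : 0 ≤ D) (hD9 : D ≤ 9 * e ^ 2) (hx : 5 ≤ x)
    (hy : y = x - τ) :
    x ^ 2 * (y ^ 2 - 1) ≤ (x ^ 2 - 1 - 2 * b * x) * (y ^ 2 + 2 * b * y - D) := by
  have hy4 : 4 < y := by linarith
  have hxy : x ≤ 11 / 10 * y := by linarith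
  have hxy0 : 0 < x * y := by positivity
  have i1 : D * x ^ 2 ≤ 10 * e ^ 2 * (x * y) := by
    have : D * x ^ 2 ≤ 9 * e ^ 2 * (x * x) := by
      rw [pow_two x]; exact mul_le_mul_of_nonneg_right hD9 (by positivity)
    have h2 : x * x ≤ 11 / 10 * (x * y) := by nlinarith
    nlinarith [sq_nonneg e]
  have i2 : b ^ 2 ≤ 4 * e ^ 2 := by nlinarith
  have i3 : 28 * e ^ 2 ≤ 2 * b * τ := by nlinarith
  have i4 : 0 ≤ 2 * b * τ * (x * y) - D * x ^ 2 - 4 * b ^ 2 * (x * y) := by nlinarith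
  have i5 : 0 ≤ (τ - b) * y := mul_nonneg (by linarith) (by linarith)
  have i6 : 0 ≤ b * D * x := by
    have : 0 ≤ b := by linarith
    positivity
  have hx' : x = y + τ := by linarith
  have key : (x ^ 2 - 1 - 2 * b * x) * (y ^ 2 + 2 * b * y - D) - x ^ 2 * (y ^ 2 - 1) =
      (2 * b * τ * (x * y) - D * x ^ 2 - 4 * b ^ 2 * (x * y)) + 2 * ((τ - b) * y) + τ ^ 2 + D +
        2 * (b * D * x) := by
    rw [hx']
    ring
  nlinarith [sq_nonneg τ]

/-- The bounds on `b/A` come from comparing squares, both of which are explicit in `e`. That `b/A -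
1` lies between `0` and `3e` makes the defect `(b/A - 1)²` at most `9e²`, the size that the shift
can absorb. -/
lemma supersolution_ratio {e : ℝ} (h0 : 0 < e) (h1 : e ≤ 1 / 100) :
    let A := Real.sqrt ((1 - e) * (2 * e ^ 2))
    0 < A ∧ A ≤ 1 / 2 ∧ A ^ 2 = (1 - e) * (2 * e ^ 2) ∧ 1 ≤ bConst (e ^ 2) / A ∧
      bConst (e ^ 2) / A ≤ 1 + 3 * e := by
  intro A
  have hpos : 0 < (1 - e) * (2 * e ^ 2) := mul_pos (by linarith) (by positivity)
  have hA : 0 < A := Real.sqrt_pos.mpr hpos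
  have hA2 : A ^ 2 = (1 - e) * (2 * e ^ 2) := Real.sq_sqrt hpos.le
  have hb := bConst_bounds h0 h1
  have hb2 : bConst (e ^ 2) ^ 2 = ((1 + e ^ 2) * (1 + e)) ^ 2 * (e ^ 4 + 2 * e ^ 2) := by
    rw [bConst_sq h0.le (by linarith), mul_pow, Real.sq_sqrt (by positivity)]
  refine ⟨hA, ?_, hA2, ?_, ?_⟩
  · rw [← abs_of_pos hA, ← abs_of_pos (by norm_num : (0 : ℝ) < 1 / 2), ← sq_le_sq, hA2]
    nlinarith
  · rw [one_le_div hA, ← abs_of_pos hA, ← abs_of_pos (by linarith : 0 < bConst (e ^ 2)), ← sq_le_sq,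
      hA2, hb2]
    have : 1 ≤ ((1 + e ^ 2) * (1 + e)) ^ 2 := one_le_pow₀ (by nlinarith [sq_nonneg e])
    nlinarith [sq_nonneg (e ^ 2), sq_nonneg e]
  · rw [div_le_iff₀ hA, ← abs_of_nonneg (by positivity : 0 ≤ (1 + 3 * e) * A),
      ← abs_of_pos (by linarith : 0 < bConst (e ^ 2)), ← sq_le_sq, mul_pow, hA2, hb2]
    have i1 : ((1 + e ^ 2) * (1 + e)) ^ 2 ≤ 1 + 5 / 2 * e := by
      have : (1 + e ^ 2) * (1 + e) ≤ 1 + 11 / 10 * e := by nlinarith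
      calc ((1 + e ^ 2) * (1 + e)) ^ 2 ≤ (1 + 11 / 10 * e) ^ 2 :=
            pow_le_pow_left₀ (by positivity) this 2
        _ ≤ _ := by nlinarith
    have i2 : e ^ 4 + 2 * e ^ 2 ≤ 2 * e ^ 2 * (1 + e / 10) := by nlinarith [sq_nonneg (e ^ 2), pow_pos h0 3]
    calc _ ≤ (1 + 5 / 2 * e) * (2 * e ^ 2 * (1 + e / 10)) :=
          mul_le_mul i1 i2 (by positivity) (by positivity)
      _ = 2 * e ^ 2 * ((1 + 5 / 2 * e) * (1 + e / 10)) := by ring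
      _ ≤ 2 * e ^ 2 * ((1 + 3 * e) ^ 2 * (1 - e)) := by
          refine mul_le_mul_of_nonneg_left ?_ (by positivity)
          nlinarith [pow_pos h0 3]
      _ = _ := by ring

/-- `K / Z` as a function of `r = N - i + 2 - ε^Θ`, where `A = √(η a)`. -/
noncomputable def ratioKZ (ε A r : ℝ) : ℝ := (1 + A - bConst ε / A / r) / 2

lemma ratioKZ_pos {e : ℝ} (h0 : 0 < e) (h1 : e ≤ 1 / 100) {r : ℝ} (hr : 2 ≤ r) :
    0 < ratioKZ (e ^ 2) (Real.sqrt ((1 - e) * (2 * e ^ 2))) r := by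
  obtain ⟨hA, -, -, hB1, hB⟩ := supersolution_ratio h0 h1
  rw [ratioKZ]
  have : bConst (e ^ 2) / Real.sqrt ((1 - e) * (2 * e ^ 2)) / r ≤ (1 + 3 * e) / 2 :=
    div_le_div₀ (by positivity) hB (by norm_num) hr
  linarith

lemma ratioKZ_le_one {e : ℝ} (h0 : 0 < e) (h1 : e ≤ 1 / 100) {r : ℝ} (hr : 2 ≤ r) :
    ratioKZ (e ^ 2) (Real.sqrt ((1 - e) * (2 * e ^ 2))) r ≤ 1 := by
  obtain ⟨hA, hA1, -, hB1, hB⟩ := supersolution_ratio h0 h1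
  rw [ratioKZ]
  have : 0 ≤ bConst (e ^ 2) / Real.sqrt ((1 - e) * (2 * e ^ 2)) / r :=
    div_nonneg (by linarith) (by linarith)
  linarith

/-- The factor `η = 1 - √ε` acts here: `A²` is smaller than the gain `2e²` in `U` by enough to cover
the cross term `2e²A²`, because `(1 - e)(1 + 2e²) ≤ 1`. -/
lemma supersolution_aux {e A U V u : ℝ} (h0 : 0 < e) (h1 : e ≤ 1 / 100)
    (hA2 : A ^ 2 = (1 - e) * (2 * e ^ 2)) (hU : u + 2 * e ^ 2 ≤ U) (hu : u ≤ 1) (hV : 1 ≤ V)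
    (huV : 1 ≤ u * V) : 1 ≤ U * (V - A ^ 2) := by
  have he2 : e ^ 2 ≤ 1 / 100 := by nlinarith
  have hA1 : A ^ 2 ≤ 1 := by rw [hA2]; nlinarith
  have s1 : (u + 2 * e ^ 2) * (V - A ^ 2) ≤ U * (V - A ^ 2) :=
    mul_le_mul_of_nonneg_right hU (by linarith)
  have s2 : 0 ≤ A ^ 2 * (1 - u) := mul_nonneg (by positivity) (by linarith)
  have s3 : 0 ≤ 2 * e ^ 2 * (V - 1) := mul_nonneg (by positivity) (by linarith)
  have s4 : A ^ 2 + 2 * e ^ 2 * A ^ 2 ≤ 2 * e ^ 2 := by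
    rw [hA2]
    have h3 : (1 - e) * (1 + 2 * e ^ 2) ≤ 1 := by nlinarith [pow_pos h0 3]
    have : 2 * e ^ 2 * ((1 - e) * (1 + 2 * e ^ 2)) ≤ 2 * e ^ 2 * 1 :=
      mul_le_mul_of_nonneg_left h3 (by positivity)
    linarith
  have key : (u + 2 * e ^ 2) * (V - A ^ 2) =
      u * V + 2 * e ^ 2 * (V - 1) + A ^ 2 * (1 - u) + (2 * e ^ 2 - (A ^ 2 + 2 * e ^ 2 * A ^ 2)) := by
    ring
  linarith

/-- Here `x = N - i + 1`, so the two arguments belong to the indices `i` and `i + 2`, and the left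
side is `Z_i`. Cleared of denominators it says `U (V - A²) ≥ 1`, with `V - A²` the product of the
two bracketed factors. -/
lemma supersolution {e τ x : ℝ} (h0 : 0 < e) (h1 : e ≤ 1 / 100) (hτ : 10 * e ≤ τ)
    (hτ1 : τ ≤ 1 / 10) (hx : 5 ≤ x) :
    1 / (4 * invK (e ^ 2) x) /
        ratioKZ (e ^ 2) (Real.sqrt ((1 - e) * (2 * e ^ 2))) (x + 1 - τ) ≤
      1 - ratioKZ (e ^ 2) (Real.sqrt ((1 - e) * (2 * e ^ 2))) (x - 1 - τ) := by
  have hX := ratioKZ_pos h0 h1 (show 2 ≤ x + 1 - τ by linarith)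
  have hU := half_le_invK h0 h1 (show 3 ≤ x by linarith)
  obtain ⟨hA, hA1, hA2, hB1, hB⟩ := supersolution_ratio h0 h1
  have hAB : Real.sqrt ((1 - e) * (2 * e ^ 2)) *
      (bConst (e ^ 2) / Real.sqrt ((1 - e) * (2 * e ^ 2))) = bConst (e ^ 2) := by
    rw [mul_div_assoc', mul_div_cancel_left₀ _ hA.ne']
  have hb := bConst_bounds h0 h1
  have hc := cConst_bounds h0 h1
  rw [div_div, div_le_iff₀ (by positivity)]
  unfold ratioKZ
  rw [show x + 1 - τ = (x - τ) + 1 by ring, show x - 1 - τ = (x - τ) - 1 by ring]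
  have hU' : 1 + 2 * e ^ 2 - 2 * bConst (e ^ 2) / x - 1 / x ^ 2 ≤ invK (e ^ 2) x := by
    unfold invK
    have : (1 - cConst (e ^ 2)) / x ^ 2 ≤ 1 / x ^ 2 :=
      div_le_div_of_nonneg_right (by linarith) (by positivity)
    linarith
  generalize invK (e ^ 2) x = U at *
  generalize bConst (e ^ 2) / Real.sqrt ((1 - e) * (2 * e ^ 2)) = B at *
  generalize Real.sqrt ((1 - e) * (2 * e ^ 2)) = A at *
  generalize bConst (e ^ 2) = b at *
  obtain ⟨y, hy⟩ : ∃ y, y = x - τ := ⟨_, rfl⟩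
  rw [← hy]
  have hy4 : 4 < y := by linarith
  have hD : 0 ≤ (B - 1) ^ 2 := sq_nonneg _
  have hD9 : (B - 1) ^ 2 ≤ 9 * e ^ 2 := by nlinarith
  have poly := supersolution_poly h0 hb.1 hb.2 hτ hτ1 hD hD9 hx hy
  have hyy : 0 < y ^ 2 - 1 := by nlinarith
  -- With `AB = b` the terms linear in `A` combine to `2by / (y² - 1)`, and the remaining part in
  -- `B` yields the defect `(B - 1)²`.
  have hV : (1 + A - B / (y + 1)) * (1 - A + B / (y - 1)) =
      (y ^ 2 + 2 * b * y - (B - 1) ^ 2) / (y ^ 2 - 1) - A ^ 2 := by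
    have e1 : y + 1 ≠ 0 := by linarith
    have e2 : y - 1 ≠ 0 := by linarith
    have e3 : y ^ 2 - 1 ≠ 0 := hyy.ne'
    rw [← hAB]
    have e4 : y ^ 2 - 1 = (y + 1) * (y - 1) := by ring
    rw [e4]
    field_simp
    ring
  have hge : 1 ≤ (y ^ 2 + 2 * b * y - (B - 1) ^ 2) / (y ^ 2 - 1) := by
    rw [one_le_div hyy]
    nlinarith
  have hUx : (x ^ 2 - 1 - 2 * b * x) / x ^ 2 = 1 - 2 * b / x - 1 / x ^ 2 := by
    have : x ≠ 0 := by linarith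
    field_simp
    ring
  have hprod : 1 ≤ (x ^ 2 - 1 - 2 * b * x) / x ^ 2 *
      ((y ^ 2 + 2 * b * y - (B - 1) ^ 2) / (y ^ 2 - 1)) := by
    rw [div_mul_div_comm, one_le_div (by positivity)]
    exact poly
  have hle1 : (x ^ 2 - 1 - 2 * b * x) / x ^ 2 ≤ 1 := by
    rw [div_le_one (by positivity)]
    nlinarith
  generalize (y ^ 2 + 2 * b * y - (B - 1) ^ 2) / (y ^ 2 - 1) = V at *
  have hU2 : (x ^ 2 - 1 - 2 * b * x) / x ^ 2 + 2 * e ^ 2 ≤ U := by linarith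
  generalize (x ^ 2 - 1 - 2 * b * x) / x ^ 2 = u at *
  have hfin := supersolution_aux h0 h1 hA2 hU2 hle1 hge hprod
  calc (1 : ℝ) ≤ U * (V - A ^ 2) := hfin
    _ = (1 - (1 + A - B / (y - 1)) / 2) * (4 * U * ((1 + A - B / (y + 1)) / 2)) := by
        rw [← hV]
        ring

end Constants

/-! ### Hopping amplitudes against the diagonal, and the inequalities between `K` and `Z` -/

section Constants

/-- `-(E^{Bog} + √ε φ √(ε² + 2ε)) / φ` for `ε = e²`. -/
noncomputable def gapConst (e : ℝ) : ℝ := 1 + e ^ 2 - (1 + e) * Real.sqrt (e ^ 4 + 2 * e ^ 2)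

lemma gapConst_bounds {e : ℝ} (h0 : 0 < e) (h1 : e ≤ 1 / 100) :
    1 / 2 ≤ gapConst e ∧ gapConst e ≤ 1 + e ^ 2 := by
  have hs := sqrt_bounds h0 h1
  unfold gapConst
  constructor <;> nlinarith [sq_nonneg e]

/-- This explains `b_ε` and `c_ε`: they are the lower coefficients of the product of the two
diagonal symbols at full condensation. The leading coefficient of that product is `(1 + ε)²`, so
choosing `1 + 2ε` instead leaves the slack `ε² = e⁴`. -/
lemma invK_mul_sq {e x : ℝ} (h0 : 0 < e) (h1 : e ≤ 1 / 100) (hx : 0 < x) :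
    (invK (e ^ 2) x + e ^ 4) * x ^ 2 =
      ((1 + e ^ 2) * x + gapConst e) * ((1 + e ^ 2) * (x - 2) + gapConst e) := by
  have hs : Real.sqrt (e ^ 4 + 2 * e ^ 2) ^ 2 = e ^ 4 + 2 * e ^ 2 := Real.sq_sqrt (by positivity)
  unfold invK gapConst
  rw [bConst_sq h0.le (by linarith), cConst_sq h0.le (by linarith)]
  generalize Real.sqrt (e ^ 4 + 2 * e ^ 2) = s at *
  have : x ≠ 0 := hx.ne'
  field_simp
  linear_combination -(1 + e) ^ 2 * hs

/-- Both factors are at most `3x`, and the perturbations of either are at most `(r + v) x`. The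
total loss is therefore at most `6(r + v) x²`, inside the slack `e⁴x²`. -/
lemma mul_sq_le_perturbed {e r v x α U : ℝ} (hr : 0 ≤ r) (hv : 0 ≤ v)
    (hrv : 6 * (r + v) ≤ e ^ 4) (hx : 3 ≤ x) (hα : 1 / 2 ≤ α) (hα2 : α ≤ 1 + e ^ 2)
    (he : e ^ 2 ≤ 1 / 100)
    (hU : (U + e ^ 4) * x ^ 2 = ((1 + e ^ 2) * x + α) * ((1 + e ^ 2) * (x - 2) + α)) :
    U * x ^ 2 ≤ ((1 + e ^ 2) * x + (α - r) - v * x) * ((1 + e ^ 2) * (x - 2) + (α - r)) := by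
  obtain ⟨F1, hF1⟩ : ∃ F, F = (1 + e ^ 2) * x + α := ⟨_, rfl⟩
  obtain ⟨F2, hF2⟩ : ∃ F, F = (1 + e ^ 2) * (x - 2) + α := ⟨_, rfl⟩
  have hex : e ^ 2 * x ≤ 1 / 100 * x := mul_le_mul_of_nonneg_right he (by linarith)
  have hex0 : 0 ≤ e ^ 2 * x := by positivity
  have b1 : F1 ≤ 3 * x := by rw [hF1]; linarith
  have b2 : F2 ≤ 3 * x := by rw [hF2]; linarith
  have b1' : 0 ≤ F1 := by rw [hF1]; linarith
  have b2' : 0 ≤ F2 := by rw [hF2]; linarith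
  have hxr : r ≤ x * r := le_mul_of_one_le_left hr (by linarith)
  have c1 : r + v * x ≤ x * (r + v) := by linarith
  have c2 : r ≤ x * (r + v) := by
    have : 0 ≤ x * v := by positivity
    linarith
  have d1 : (r + v * x) * F2 ≤ x * (r + v) * (3 * x) := mul_le_mul c1 b2 b2' (by positivity)
  have d2 : r * F1 ≤ x * (r + v) * (3 * x) := mul_le_mul c2 b1 b1' (by positivity)
  have d3 : 0 ≤ (r + v * x) * r := by positivity
  have d4 : 6 * (r + v) * x ^ 2 ≤ e ^ 4 * x ^ 2 := mul_le_mul_of_nonneg_right hrv (by positivity)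
  rw [← hF1, ← hF2] at hU
  have e1 : ((1 + e ^ 2) * x + (α - r) - v * x) * ((1 + e ^ 2) * (x - 2) + (α - r)) =
      F1 * F2 - (r + v * x) * F2 - r * F1 + (r + v * x) * r := by
    rw [hF1, hF2]
    ring
  rw [e1]
  linarith

/-- The bound of the hopping amplitudes relative to the diagonal part of the Hamiltonian. -/
lemma hopping_bound {e r N s p q : ℝ} (h0 : 0 < e) (h1 : e ≤ 1 / 100) (hr : 0 ≤ r) (hN : 0 < N)
    (hrN : 6 * (r + 2 / N) ≤ e ^ 4) (hs : 0 < s) (hsN : s ≤ N)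
    (hpq : 1 ≤ p + q) :
    4 * invK (e ^ 2) (p + q + 2) * ((s / N) ^ 2 * ((p + 1) * (q + 1))) ≤
      ((e ^ 2 + s / N) * (p + q) + (gapConst e - r)) *
        ((e ^ 2 + (s - 2) / N) * (p + q + 2) + (gapConst e - r)) := by
  obtain ⟨x, hx⟩ : ∃ x, x = p + q + 2 := ⟨_, rfl⟩
  have hx3 : 3 ≤ x := by linarith
  obtain ⟨u, hu⟩ : ∃ u, u = s / N := ⟨_, rfl⟩
  obtain ⟨v, hv⟩ : ∃ v, v = 2 / N := ⟨_, rfl⟩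
  have hu0 : 0 < u := by rw [hu]; positivity
  have hu1 : u ≤ 1 := by rw [hu, div_le_one hN]; exact hsN
  have hv0 : 0 < v := by rw [hv]; positivity
  have hinv := invK_mul_sq h0 h1 (show 0 < x by linarith)
  have hU := half_le_invK h0 h1 hx3
  obtain ⟨hα, hα2⟩ := gapConst_bounds h0 h1
  rw [sub_div, ← hu, ← hv, ← hx, show p + q = x - 2 by linarith]
  rw [← hv] at hrN
  generalize invK (e ^ 2) x = U at *
  generalize gapConst e = α at *
  have he2 : e ^ 2 ≤ 1 / 100 := by nlinarith
  have he4 : e ^ 4 ≤ 1 / 100 * e ^ 2 := by nlinarith [sq_nonneg e]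
  have hαr : 0 ≤ α - r := by nlinarith
  -- By the arithmetic-geometric mean inequality, only the total number `p + q` matters.
  have hw : 4 * ((p + 1) * (q + 1)) ≤ x ^ 2 := by
    rw [hx]
    nlinarith [sq_nonneg (p - q)]
  have s1 : 4 * U * (u ^ 2 * ((p + 1) * (q + 1))) ≤ U * u ^ 2 * x ^ 2 := by
    have := mul_le_mul_of_nonneg_left hw (show 0 ≤ U * u ^ 2 by positivity)
    linarith
  -- The condensate fraction `u ≤ 1` is scaled out of each diagonal factor. The part without `u` is
  -- nonnegative, where `v ≤ e²` is used, so multiplying it by `u` only decreases it; the fraction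
  -- then cancels against `u²` in the hopping term.
  have f1 : u * ((1 + e ^ 2) * x + (α - r) - v * x) ≤ (e ^ 2 + (u - v)) * x + (α - r) := by
    have : 0 ≤ (1 - u) * ((e ^ 2 - v) * x + (α - r)) :=
      mul_nonneg (by linarith) (add_nonneg (mul_nonneg (by linarith) (by linarith)) hαr)
    linarith
  have f2 : u * ((1 + e ^ 2) * (x - 2) + (α - r)) ≤ (e ^ 2 + u) * (x - 2) + (α - r) := by
    have : 0 ≤ (1 - u) * (e ^ 2 * (x - 2) + (α - r)) :=
      mul_nonneg (by linarith) (add_nonneg (mul_nonneg (by positivity) (by linarith)) hαr)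
    linarith
  have g2 : 0 ≤ (1 + e ^ 2) * (x - 2) + (α - r) :=
    add_nonneg (mul_nonneg (by positivity) (by linarith)) hαr
  have g1 : 0 ≤ (1 + e ^ 2) * x + (α - r) - v * x := by
    have : 0 ≤ (1 + e ^ 2 - v) * x := mul_nonneg (by linarith) (by linarith)
    linarith
  have f12 : (u * ((1 + e ^ 2) * x + (α - r) - v * x)) * (u * ((1 + e ^ 2) * (x - 2) + (α - r))) ≤
      ((e ^ 2 + (u - v)) * x + (α - r)) * ((e ^ 2 + u) * (x - 2) + (α - r)) :=
    mul_le_mul f1 f2 (mul_nonneg hu0.le g2) ((mul_nonneg hu0.le g1).trans f1)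
  have main := mul_sq_le_perturbed hr hv0.le hrN hx3 hα hα2 he2 hinv
  have := mul_le_mul_of_nonneg_left main (sq_nonneg u)
  linarith

lemma KConst_eq (e : ℝ) (N i : ℕ) :
    KConst (2 * e ^ 2) (e ^ 2) N i = 1 / (4 * invK (e ^ 2) ((N : ℝ) - i + 1)) := rfl

lemma ZConst_eq {e : ℝ} (h0 : 0 ≤ e) (ν : ℝ) (N i : ℕ) :
    ZConst ν (2 * e ^ 2) (e ^ 2) N i = KConst (2 * e ^ 2) (e ^ 2) N i /
      ratioKZ (e ^ 2) (Real.sqrt ((1 - e) * (2 * e ^ 2)))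
        ((N : ℝ) - i + 1 + 1 - (e ^ 2) ^ thetaConst ν) := by
  rw [ZConst, ← KConst, Real.sqrt_sq h0, ratioKZ, show (N : ℝ) - i + 1 + 1 = N - i + 2 by ring,
    div_div_eq_mul_div, mul_div_assoc]

lemma KConst_pos {e : ℝ} (h0 : 0 < e) (h1 : e ≤ 1 / 100) {N i : ℕ} (hi : i + 2 ≤ N) :
    0 < KConst (2 * e ^ 2) (e ^ 2) N i := by
  have h : (i : ℝ) + 2 ≤ N := by exact_mod_cast hi
  have := half_le_invK h0 h1 (show 3 ≤ (N : ℝ) - i + 1 by linarith)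
  rw [KConst_eq]
  positivity

variable {e ν : ℝ}

/-- This is the invariant `Z_i ≤ 1 - X_{i+2}` of the recursion, with `X = K / Z`. It yields both
`Z_i < 1` and the supersolution inequality. The restriction on `i` makes `x = N - i + 1` at least
`5`. -/
lemma ZConst_le (h0 : 0 < e) (h1 : e ≤ 1 / 100) (hτ : 10 * e ≤ (e ^ 2) ^ thetaConst ν)
    (hτ1 : (e ^ 2) ^ thetaConst ν ≤ 1 / 10) {N i : ℕ} (hi : i + 4 ≤ N) :
    ZConst ν (2 * e ^ 2) (e ^ 2) N i ≤ 1 - ratioKZ (e ^ 2) (Real.sqrt ((1 - e) * (2 * e ^ 2)))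
        ((N : ℝ) - (i + 2 : ℕ) + 1 + 1 - (e ^ 2) ^ thetaConst ν) := by
  have h : (i : ℝ) + 4 ≤ N := by exact_mod_cast hi
  rw [ZConst_eq h0.le, KConst_eq]
  refine (supersolution h0 h1 hτ hτ1 (by linarith)).trans (le_of_eq ?_)
  congr 2
  push_cast
  ring

lemma ZConst_lt_one (h0 : 0 < e) (h1 : e ≤ 1 / 100) (hτ : 10 * e ≤ (e ^ 2) ^ thetaConst ν)
    (hτ1 : (e ^ 2) ^ thetaConst ν ≤ 1 / 10) {N i : ℕ} (hi : i + 4 ≤ N) :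
    ZConst ν (2 * e ^ 2) (e ^ 2) N i < 1 := by
  have h : (i : ℝ) + 4 ≤ N := by exact_mod_cast hi
  have := ratioKZ_pos h0 h1
    (show 2 ≤ (N : ℝ) - (i + 2 : ℕ) + 1 + 1 - (e ^ 2) ^ thetaConst ν by push_cast; linarith)
  linarith [ZConst_le h0 h1 hτ hτ1 hi]

lemma KConst_le_ZConst (h0 : 0 < e) (h1 : e ≤ 1 / 100)
    (hτ1 : (e ^ 2) ^ thetaConst ν ≤ 1 / 10) {N i : ℕ} (hi : i + 2 ≤ N) :
    KConst (2 * e ^ 2) (e ^ 2) N i ≤ ZConst ν (2 * e ^ 2) (e ^ 2) N i := by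
  have h : (i : ℝ) + 2 ≤ N := by exact_mod_cast hi
  have hr : 2 ≤ (N : ℝ) - i + 1 + 1 - (e ^ 2) ^ thetaConst ν := by linarith
  rw [ZConst_eq h0.le]
  exact le_div_self (KConst_pos h0 h1 hi).le (ratioKZ_pos h0 h1 hr) (ratioKZ_le_one h0 h1 hr)

lemma KConst_mul_inv_le (h0 : 0 < e) (h1 : e ≤ 1 / 100) (hτ : 10 * e ≤ (e ^ 2) ^ thetaConst ν)
    (hτ1 : (e ^ 2) ^ thetaConst ν ≤ 1 / 10) {N i : ℕ} (hi : i + 4 ≤ N) :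
    KConst (2 * e ^ 2) (e ^ 2) N (i + 2) * (1 - ZConst ν (2 * e ^ 2) (e ^ 2) N i)⁻¹ ≤
      ZConst ν (2 * e ^ 2) (e ^ 2) N (i + 2) := by
  have h : (i : ℝ) + 4 ≤ N := by exact_mod_cast hi
  have hr := ratioKZ_pos h0 h1
    (show 2 ≤ (N : ℝ) - (i + 2 : ℕ) + 1 + 1 - (e ^ 2) ^ thetaConst ν by push_cast; linarith)
  rw [ZConst_eq h0.le ν N (i + 2), div_eq_mul_inv]
  refine mul_le_mul_of_nonneg_left ?_ (KConst_pos h0 h1 (by omega)).le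
  exact inv_anti₀ hr (by linarith [ZConst_le h0 h1 hτ hτ1 hi])

end Constants

/-! ## Weighted shifts on `ℓ²` -/

section Shifts

variable {X : Type}

/-- The operator `(A ψ)(n) = c(n) ψ(τ n)` on coefficient families. -/
def formalShift (c : X → ℂ) (τ : X → X) : FormalOp X where
  toFun ψ n := c n * ψ (τ n)
  map_add' ψ χ := by funext n; simp [mul_add]
  map_smul' r ψ := by funext n; simp [mul_left_comm]

/-- Weights bounded by `C`, and a map of labels that is injective where the weight is nonzero. -/
structure IsBoundedShift (c : X → ℂ) (τ : X → X) (C : ℝ) : Prop where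
  injOn : Set.InjOn τ {n | c n ≠ 0}
  bound : ∀ n, ‖c n‖ ≤ C
  nonneg : 0 ≤ C

/-- On the support of the weight every label is read at most once, so the weighted sum of squares is
at most `C²` times that of `ψ`. -/
lemma IsBoundedShift.exists_clm {c : X → ℂ} {τ : X → X} {C : ℝ} (h : IsBoundedShift c τ C) :
    ∃ T : EllTwo X →L[ℂ] EllTwo X, (∀ ψ, (T ψ : X → ℂ) = formalShift c τ ψ) ∧ ‖T‖ ≤ C := by
  classical
  have hp : 0 < (2 : ENNReal).toReal := by norm_num
  have hsum : ∀ (ψ : EllTwo X) (s : Finset X),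
      ∑ n ∈ s, ‖formalShift c τ ψ n‖ ^ (2 : ENNReal).toReal ≤
        (C * ‖ψ‖) ^ (2 : ENNReal).toReal := by
    intro ψ s
    have e1 : ∑ n ∈ s, ‖formalShift c τ ψ n‖ ^ (2 : ENNReal).toReal ≤
        C ^ (2 : ENNReal).toReal * ∑ n ∈ s.filter fun n => c n ≠ 0,
          ‖ψ (τ n)‖ ^ (2 : ENNReal).toReal := by
      rw [Finset.mul_sum]
      have : ∑ n ∈ s, ‖formalShift c τ ψ n‖ ^ (2 : ENNReal).toReal =
          ∑ n ∈ s.filter (fun n => c n ≠ 0), ‖formalShift c τ ψ n‖ ^ (2 : ENNReal).toReal := by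
        symm
        apply Finset.sum_filter_of_ne
        intro n _ hn h0
        apply hn
        rw [show formalShift c τ ψ n = c n * ψ (τ n) from rfl, h0, zero_mul, norm_zero,
          Real.zero_rpow hp.ne']
      rw [this]
      refine Finset.sum_le_sum fun n _ => ?_
      rw [show formalShift c τ ψ n = c n * ψ (τ n) from rfl, norm_mul,
        Real.mul_rpow (norm_nonneg _) (norm_nonneg _)]
      exact mul_le_mul_of_nonneg_right
        (Real.rpow_le_rpow (norm_nonneg _) (h.bound n) hp.le) (by positivity)
    have e2 : ∑ n ∈ s.filter (fun n => c n ≠ 0), ‖ψ (τ n)‖ ^ (2 : ENNReal).toReal ≤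
        ‖ψ‖ ^ (2 : ENNReal).toReal := by
      have inj : Set.InjOn τ (s.filter fun n => c n ≠ 0 : Finset X) := fun n hn n' hn' e =>
        h.injOn (Finset.mem_filter.mp hn).2 (Finset.mem_filter.mp hn').2 e
      rw [← Finset.sum_image (f := fun x : X => ‖ψ x‖ ^ (2 : ENNReal).toReal) inj]
      exact lp.sum_rpow_le_norm_rpow hp ψ _
    rw [Real.mul_rpow h.nonneg (norm_nonneg _)]
    exact e1.trans (mul_le_mul_of_nonneg_left e2 (Real.rpow_nonneg h.nonneg _))
  have hmem : ∀ ψ : EllTwo X, Memℓp (E := fun _ : X => ℂ) (formalShift c τ ψ) 2 := fun ψ =>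
    memℓp_gen' (hsum ψ)
  let T₀ : EllTwo X →ₗ[ℂ] EllTwo X :=
    { toFun := fun ψ => ⟨formalShift c τ ψ, hmem ψ⟩
      map_add' := fun ψ χ => by
        ext x
        exact congrFun (map_add (formalShift c τ) _ _) x
      map_smul' := fun r ψ => by
        ext x
        exact congrFun (map_smul (formalShift c τ) _ _) x }
  refine ⟨T₀.mkContinuous C fun ψ => ?_, fun ψ => rfl, T₀.mkContinuous_norm_le h.nonneg _⟩
  exact lp.norm_le_of_forall_sum_le hp (mul_nonneg h.nonneg (norm_nonneg _)) (hsum ψ)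

/-- The bounded operator `(A ψ)(n) = c(n) ψ(τ n)` on `ℓ²`. -/
noncomputable def shiftOp (c : X → ℂ) (τ : X → X) : EllTwo X →L[ℂ] EllTwo X :=
  boundedOp (formalShift c τ)

lemma IsBoundedShift.apply {c : X → ℂ} {τ : X → X} {C : ℝ} (h : IsBoundedShift c τ C)
    (ψ : EllTwo X) (n : X) : shiftOp c τ ψ n = c n * ψ (τ n) := by
  obtain ⟨T, hT, -⟩ := h.exists_clm
  exact congrFun (boundedOp_apply ⟨T, hT⟩ ψ) n

lemma IsBoundedShift.norm_le {c : X → ℂ} {τ : X → X} {C : ℝ} (h : IsBoundedShift c τ C) :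
    ‖shiftOp c τ‖ ≤ C := by
  obtain ⟨T, hT, hC⟩ := h.exists_clm
  have : shiftOp c τ = T := by
    ext ψ n
    rw [h.apply, hT]
    rfl
  rwa [this]

/-- The two label maps are mutually inverse between the supports of the weights, so the inner
products agree after a change of summation index. -/
lemma IsBoundedShift.star_eq {c c' : X → ℂ} {τ τ' : X → X} {C C' : ℝ} (h : IsBoundedShift c τ C)
    (h' : IsBoundedShift c' τ' C') (h1 : ∀ n, c n ≠ 0 → τ' (τ n) = n ∧ c' (τ n) = star (c n))
    (h2 : ∀ n, c' n ≠ 0 → τ (τ' n) = n ∧ c (τ' n) = star (c' n)) :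
    star (shiftOp c τ) = shiftOp c' τ' := by
  rw [ContinuousLinearMap.star_eq_adjoint]
  symm
  rw [ContinuousLinearMap.eq_adjoint_iff]
  intro ψ χ
  rw [lp.inner_eq_tsum, lp.inner_eq_tsum]
  have ne : ∀ n : Function.support fun n => inner ℂ (ψ n) (shiftOp c τ χ n), c n ≠ 0 := by
    intro n hn
    apply n.2
    simp [h.apply, hn]
  refine tsum_eq_tsum_of_ne_zero_bij (fun n => τ n.1) ?_ ?_ ?_
  · intro n n' e
    exact Subtype.ext (h.injOn (ne n) (ne n') e)
  · intro m hm
    have hm' : c' m ≠ 0 := by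
      intro h0
      apply hm
      simp [h'.apply, h0]
    have hm2 := h2 m hm'
    refine ⟨⟨τ' m, ?_⟩, hm2.1⟩
    intro h0
    apply hm
    dsimp only at h0 ⊢
    rw [h.apply, hm2.1, hm2.2] at h0
    rw [h'.apply]
    simp only [RCLike.inner_apply, map_mul, starRingEnd_apply] at h0 ⊢
    rw [← h0]
    ring
  · intro n
    have hn := h1 n (ne n)
    change inner ℂ (shiftOp c' τ' ψ (τ n.1)) (χ (τ n.1)) = inner ℂ (ψ n.1) (shiftOp c τ χ n.1)
    rw [h'.apply, h.apply, hn.1, hn.2]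
    simp only [RCLike.inner_apply, map_mul, starRingEnd_apply, star_star]
    ring

/-- Multiplication by a real function on `ℓ²`. -/
noncomputable def mulOp (f : X → ℝ) : EllTwo X →L[ℂ] EllTwo X := shiftOp (fun n => (f n : ℂ)) id

lemma isBoundedShift_mul {f : X → ℝ} {C : ℝ} (hf : ∀ n, |f n| ≤ C) (hC : 0 ≤ C) :
    IsBoundedShift (fun n => (f n : ℂ)) id C :=
  ⟨fun _ _ _ _ h => h, fun n => by simpa using hf n, hC⟩

lemma mulOp_apply {f : X → ℝ} {C : ℝ} (hf : ∀ n, |f n| ≤ C) (ψ : EllTwo X) (n : X) :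
    mulOp f ψ n = f n * ψ n :=
  (isBoundedShift_mul hf ((abs_nonneg _).trans (hf n))).apply ψ n

lemma isSelfAdjoint_mulOp {f : X → ℝ} {C : ℝ} (hf : ∀ n, |f n| ≤ C) :
    IsSelfAdjoint (mulOp f) := by
  have hb := isBoundedShift_mul (C := |C|) (fun n => (hf n).trans (le_abs_self C)) (abs_nonneg _)
  exact hb.star_eq hb (fun n _ => ⟨rfl, by simp⟩) (fun n _ => ⟨rfl, by simp⟩)

lemma norm_mulOp_le {f : X → ℝ} {C : ℝ} (hC : 0 ≤ C) (hf : ∀ n, |f n| ≤ C) : ‖mulOp f‖ ≤ C :=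
  (isBoundedShift_mul hf hC).norm_le

/-- The identity holds termwise, so `D` may be unbounded: it is only needed that `η` is a vector of
`ℓ²`. This covers the kinetic energy. -/
lemma inner_eq_ofReal_tsum {D : X → ℝ} {φ η : EllTwo X} (h : ∀ n, η n = D n * φ n) :
    inner ℂ φ η = ((∑' n, D n * ‖φ n‖ ^ 2 : ℝ) : ℂ) := by
  rw [lp.inner_eq_tsum, Complex.ofReal_tsum]
  refine tsum_congr fun n => ?_
  rw [h, RCLike.inner_apply, mul_assoc, Complex.mul_conj, Complex.normSq_eq_norm_sq]
  push_cast
  rfl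

lemma mulOp_nonneg {f : X → ℝ} {C : ℝ} (hf : ∀ n, |f n| ≤ C) (h0 : ∀ n, 0 ≤ f n) :
    0 ≤ mulOp f := by
  rw [ContinuousLinearMap.nonneg_iff_isPositive, ContinuousLinearMap.isPositive_iff_complex]
  intro ψ
  have e : inner ℂ (mulOp f ψ) ψ = ((∑' n, f n * ‖ψ n‖ ^ 2 : ℝ) : ℂ) := by
    have := (isSelfAdjoint_mulOp hf).isSymmetric ψ ψ
    simp only [ContinuousLinearMap.coe_coe] at this
    rw [this]
    exact inner_eq_ofReal_tsum fun n => mulOp_apply hf ψ n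
  rw [e]
  refine ⟨by simp, ?_⟩
  rw [show RCLike.re ((∑' n, f n * ‖ψ n‖ ^ 2 : ℝ) : ℂ) = ∑' n, f n * ‖ψ n‖ ^ 2 from
    Complex.ofReal_re _]
  exact tsum_nonneg fun n => mul_nonneg (h0 n) (by positivity)

end Shifts

/-! ## Resolvents of a nonnegative multiplication operator plus a positive bounded operator -/

section Perturbation

variable {X : Type}

lemma norm_algebraMap_sub_le {H : Type} [NormedAddCommGroup H] [InnerProductSpace ℂ H]
    [CompleteSpace H] {V : H →L[ℂ] H} {γ c : ℝ} (hV : algebraMap ℝ (H →L[ℂ] H) γ ≤ V)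
    (hc : ‖V‖ ≤ c) (hγc : γ ≤ c) (hs : IsSelfAdjoint V) :
    ‖algebraMap ℝ (H →L[ℂ] H) c - V‖ ≤ c - γ := by
  have h1 : V ≤ algebraMap ℝ (H →L[ℂ] H) c := hs.le_algebraMap_norm_self.trans
    (algebraMap_mono _ hc)
  rw [CStarAlgebra.norm_le_iff_le_algebraMap _ (by linarith) (sub_nonneg.mpr h1), map_sub]
  exact sub_le_sub_left hV _

lemma re_inner_ge_of_algebraMap_le {H : Type} [NormedAddCommGroup H] [InnerProductSpace ℂ H]
    [CompleteSpace H] {V : H →L[ℂ] H} {γ : ℝ} (hV : algebraMap ℝ (H →L[ℂ] H) γ ≤ V) (φ : H) :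
    γ * ‖φ‖ ^ 2 ≤ RCLike.re (inner ℂ φ (V φ)) := by
  have h := ((ContinuousLinearMap.le_def _ _).mp hV).re_inner_nonneg_right φ
  rw [sub_apply, inner_sub_right, map_sub, Algebra.algebraMap_eq_smul_one] at h
  have e : inner ℂ φ ((γ • (1 : H →L[ℂ] H)) φ) = ((γ * ‖φ‖ ^ 2 : ℝ) : ℂ) := by
    rw [smul_apply, one_apply_eq_self, ← Complex.coe_smul,
      inner_smul_right, inner_self_eq_norm_sq_to_K]
    push_cast
    rfl
  rw [e, show RCLike.re ((γ * ‖φ‖ ^ 2 : ℝ) : ℂ) = γ * ‖φ‖ ^ 2 from Complex.ofReal_re _] at h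
  linarith

lemma inner_eq_of_form {D : X → ℝ} {V : EllTwo X →L[ℂ] EllTwo X} {φ ψ : EllTwo X}
    (h : ∀ n, (D n : ℂ) * φ n + V φ n = ψ n) :
    inner ℂ φ ψ = ((∑' n, D n * ‖φ n‖ ^ 2 : ℝ) : ℂ) + inner ℂ φ (V φ) := by
  rw [← inner_eq_ofReal_tsum (η := ψ - V φ), ← inner_add_right, sub_add_cancel]
  intro n
  rw [lp.coeFn_sub, Pi.sub_apply, ← h n]
  ring

/-- The inverse of `D + V` for a multiplication operator `D ≥ 0` and a bounded `V ≥ γ > 0`. -/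
theorem exists_inverse_mul_add {D : X → ℝ} (hD : ∀ n, 0 ≤ D n) {V : EllTwo X →L[ℂ] EllTwo X}
    {γ : ℝ} (hγ : 0 < γ) (hs : IsSelfAdjoint V)
    (hV : algebraMap ℝ (EllTwo X →L[ℂ] EllTwo X) γ ≤ V) :
    ∃ S : EllTwo X →L[ℂ] EllTwo X,
      (∀ ψ n, (D n : ℂ) * S ψ n + V (S ψ) n = ψ n) ∧
      (∀ φ ψ : EllTwo X, (∀ n, (D n : ℂ) * φ n + V φ n = ψ n) → S ψ = φ) ∧
      (∀ ψ, RCLike.re (inner ℂ (S ψ) (V (S ψ))) ≤ RCLike.re (inner ℂ (S ψ) ψ)) ∧ 0 ≤ S := by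
  -- The maximum matters only on the trivial space, where `V ≥ γ` does not force `‖V‖ ≥ γ`.
  obtain ⟨c, hc⟩ : ∃ c, c = max ‖V‖ γ := ⟨_, rfl⟩
  have hVc : ‖V‖ ≤ c := hc ▸ le_max_left _ _
  have hγc : γ ≤ c := hc ▸ le_max_right _ _
  have hc0 : 0 < c := hγ.trans_le hγc
  have hE : ∀ n, |(D n + c)⁻¹| ≤ c⁻¹ := fun n => by
    rw [abs_of_nonneg (by have := hD n; positivity)]
    exact inv_anti₀ hc0 (by linarith [hD n])
  let E := mulOp fun n => (D n + c)⁻¹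
  -- Factor `D + V = (1 - F)(D + c)` with `F = (c - V)(D + c)⁻¹`. Then `‖F‖ ≤ (c - γ) / c < 1`, and
  -- the Neumann series inverts `1 - F` although `D` is unbounded.
  let F := (algebraMap ℝ (EllTwo X →L[ℂ] EllTwo X) c - V) * E
  have hF : ‖F‖ < 1 := by
    refine (norm_mul_le _ _).trans_lt ?_
    have h1 := norm_algebraMap_sub_le hV hVc hγc hs
    have h2 : ‖E‖ ≤ c⁻¹ := norm_mulOp_le (by positivity) hE
    calc _ ≤ (c - γ) * c⁻¹ := mul_le_mul h1 h2 (norm_nonneg _) (by linarith)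
      _ < 1 := by
        rw [← div_eq_mul_inv, div_lt_one hc0]
        linarith
  let U := Units.oneSub F hF
  have hU : ∀ ψ, (U⁻¹ : (EllTwo X →L[ℂ] EllTwo X)ˣ).1 ψ -
      F ((U⁻¹ : (EllTwo X →L[ℂ] EllTwo X)ˣ).1 ψ) = ψ := fun ψ => by
    have := congrArg (fun T : EllTwo X →L[ℂ] EllTwo X => T ψ) U.mul_inv
    simpa [U, Units.val_oneSub] using this
  let S := E * (U⁻¹ : (EllTwo X →L[ℂ] EllTwo X)ˣ).1
  have hS : ∀ ψ n, (D n : ℂ) * S ψ n + V (S ψ) n = ψ n := by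
    intro ψ n
    obtain ⟨χ, hχ⟩ : ∃ χ, χ = (U⁻¹ : (EllTwo X →L[ℂ] EllTwo X)ˣ).1 ψ := ⟨_, rfl⟩
    have e1 : S ψ = E χ := by rw [hχ]; rfl
    have e2 : E χ n = ((D n + c)⁻¹ : ℝ) * χ n := mulOp_apply hE χ n
    have e3 : F χ = c • E χ - V (E χ) := by
      simp [F, Algebra.algebraMap_eq_smul_one]
    have e4 := congrArg (fun f : EllTwo X => f n) (hU ψ)
    simp only [← hχ, e3] at e4
    rw [e1, ← e4]
    simp only [lp.coeFn_sub, Pi.sub_apply, lp.coeFn_smul, Pi.smul_apply, Complex.real_smul]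
    have e5 : (D n + c : ℂ) * E χ n = χ n := by
      rw [e2]
      have : (D n + c : ℂ) ≠ 0 := by
        have := hD n
        exact_mod_cast (by positivity : D n + c ≠ 0)
      push_cast
      field_simp
    rw [← e5]
    ring
  -- The nonnegative form of `D` is dropped. The same inequality gives uniqueness of the solution
  -- and positivity of the inverse.
  have hre : ∀ φ ψ : EllTwo X, (∀ n, (D n : ℂ) * φ n + V φ n = ψ n) →
      RCLike.re (inner ℂ φ (V φ)) ≤ RCLike.re (inner ℂ φ ψ) := by
    intro φ ψ h
    rw [inner_eq_of_form h, map_add, show RCLike.re ((∑' n, D n * ‖φ n‖ ^ 2 : ℝ) : ℂ) =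
      ∑' n, D n * ‖φ n‖ ^ 2 from Complex.ofReal_re _]
    have : 0 ≤ ∑' n, D n * ‖φ n‖ ^ 2 := tsum_nonneg fun n => mul_nonneg (hD n) (by positivity)
    linarith
  refine ⟨S, hS, ?_, fun ψ => hre _ _ (hS ψ), ?_⟩
  · intro φ ψ h
    have h0 : ∀ n, (D n : ℂ) * (S ψ - φ) n + V (S ψ - φ) n = (0 : EllTwo X) n := by
      intro n
      rw [map_sub]
      simp only [lp.coeFn_sub, Pi.sub_apply, lp.coeFn_zero, Pi.zero_apply]
      linear_combination hS ψ n - h n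
    have h1 := hre _ _ h0
    have h2 := re_inner_ge_of_algebraMap_le hV (S ψ - φ)
    rw [inner_zero_right, map_zero] at h1
    have h3 : ‖S ψ - φ‖ ^ 2 ≤ 0 := by
      by_contra h4
      push Not at h4
      nlinarith
    have : ‖S ψ - φ‖ = 0 := by nlinarith [norm_nonneg (S ψ - φ)]
    exact sub_eq_zero.mp (norm_eq_zero.mp this)
  · rw [ContinuousLinearMap.nonneg_iff_isPositive, ContinuousLinearMap.isPositive_iff_complex]
    intro ψ
    have h2 := re_inner_ge_of_algebraMap_le hV (S ψ)
    have h3 := hre _ _ (hS ψ)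
    refine ⟨?_, le_trans (by positivity) (h2.trans h3)⟩
    have h4 : inner ℂ (S ψ) (V (S ψ)) = ((RCLike.re (inner ℂ (S ψ) (V (S ψ))) : ℝ) : ℂ) :=
      (hs.isSymmetric.coe_re_inner_self_apply (S ψ)).symm
    rw [inner_eq_of_form (hS ψ), h4]
    norm_cast

end Perturbation

/-! ### Uniqueness of compressed resolvents and conjugation by their square roots -/

section Abstract

variable {H : Type} [NormedAddCommGroup H] [InnerProductSpace ℂ H]

/-- A right inverse and a left inverse of the same operator coincide: the left inverse `R'` is
applied to the preimage supplied by `R`. -/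
lemma IsCompressedResolvent.eq {T : H →ₗ.[ℂ] H} {Q : H →L[ℂ] H} {z : ℂ} {R R' : H →L[ℂ] H}
    (h : IsCompressedResolvent T Q z R) (h' : IsCompressedResolvent T Q z R') : R = R' := by
  ext1 ψ
  obtain ⟨χ, hχ, e⟩ := h.right_inv ψ
  have e1 := h'.left_inv _ _ hχ (congrArg (fun S : H →L[ℂ] H => S ψ) h.left_proj)
  rw [e] at e1
  rw [← e1]
  exact congrArg (fun S : H →L[ℂ] H => S ψ) h'.right_proj

lemma IsCompressedResolvent.compressedResolvent_eq {T : H →ₗ.[ℂ] H} {Q : H →L[ℂ] H} {z : ℂ}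
    {R : H →L[ℂ] H} (h : IsCompressedResolvent T Q z R) : compressedResolvent T Q z = R := by
  have hex : ∃ R, IsCompressedResolvent T Q z R := ⟨R, h⟩
  rw [compressedResolvent, dif_pos hex]
  exact hex.choose_spec.eq h

variable [CompleteSpace H]

/-- Conjugating the hypothesis by `P` gives `T² ≤ T` for `T = P R P ≥ 0`, hence `‖T‖ ≤ 1`, and `‖P
R^{1/2}‖² = ‖T‖`. No inverse of `R` is needed; compressed resolvents generally have a kernel. -/
lemma norm_mul_sqrt_le_one {P R : H →L[ℂ] H} (hP : IsSelfAdjoint P) (hR : 0 ≤ R)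
    (h : R * P * P * R ≤ R) : ‖P * CFC.sqrt R‖ ≤ 1 := by
  have hs : IsSelfAdjoint (CFC.sqrt R) := (CFC.sqrt_nonneg R).isSelfAdjoint
  have hT : P * CFC.sqrt R * star (P * CFC.sqrt R) = P * R * P := by
    rw [star_mul, hs.star_eq, hP.star_eq, mul_assoc, ← mul_assoc (CFC.sqrt R),
      CFC.sqrt_mul_sqrt_self R hR, mul_assoc]
  have hT0 : 0 ≤ P * R * P := hT ▸ mul_star_self_nonneg _
  have hTT : (P * R * P) * (P * R * P) ≤ P * R * P := by
    have := star_left_conjugate_le_conjugate h P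
    rw [hP.star_eq] at this
    simpa only [mul_assoc] using this
  have h1 : ‖(P * R * P) * (P * R * P)‖ ≤ ‖P * R * P‖ := by
    refine CStarAlgebra.norm_le_norm_of_nonneg_of_le ?_ hTT
    have := star_mul_self_nonneg (P * R * P)
    rwa [hT0.isSelfAdjoint.star_eq] at this
  rw [hT0.isSelfAdjoint.norm_mul_self, pow_two] at h1
  have h2 : ‖P * CFC.sqrt R‖ * ‖P * CFC.sqrt R‖ = ‖P * R * P‖ := by
    rw [← hT, CStarRing.norm_self_mul_star]
  have h3 : ‖P * R * P‖ ≤ 1 := by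
    by_contra h4
    push Not at h4
    nlinarith
  by_contra h4
  push Not at h4
  nlinarith

/-- Conjugation by square roots of resolvents that are dominated by `(P²)⁻¹`. -/
lemma norm_sandwich_dress_le {Wd Wu R : ℕ → H →L[ℂ] H} {P M : H →L[ℂ] H} {k : ℝ} {j : ℕ}
    (hP : IsSelfAdjoint P) (hR : 0 ≤ R j) (hR' : 0 ≤ R (j - 2))
    (h : R j * P * P * R j ≤ R j) (h' : R (j - 2) * P * P * R (j - 2) ≤ R (j - 2))
    (hWd : Wd j = star (Wu j)) (hWu : Wu j = P * M * P) (hM : ‖M‖ ≤ k) (X : H →L[ℂ] H) :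
    ‖sandwich R j (dress Wd Wu R j X)‖ ≤ k ^ 2 * ‖X‖ := by
  have hs : IsSelfAdjoint (CFC.sqrt (R j)) := (CFC.sqrt_nonneg _).isSelfAdjoint
  have hs' : IsSelfAdjoint (CFC.sqrt (R (j - 2))) := (CFC.sqrt_nonneg _).isSelfAdjoint
  have hk : 0 ≤ k := (norm_nonneg _).trans hM
  have e1 : CFC.sqrt (R (j - 2)) * Wu j * CFC.sqrt (R j) =
      star (P * CFC.sqrt (R (j - 2))) * M * (P * CFC.sqrt (R j)) := by
    rw [star_mul, hs'.star_eq, hP.star_eq, hWu]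
    simp only [mul_assoc]
  have e2 : ‖CFC.sqrt (R (j - 2)) * Wu j * CFC.sqrt (R j)‖ ≤ k := by
    rw [e1]
    calc _ ≤ ‖star (P * CFC.sqrt (R (j - 2)))‖ * ‖M‖ * ‖P * CFC.sqrt (R j)‖ := norm_mul₃_le
      _ ≤ 1 * k * 1 := by
        refine mul_le_mul (mul_le_mul ?_ hM (norm_nonneg _) zero_le_one)
          (norm_mul_sqrt_le_one hP hR h) (norm_nonneg _) (by simpa using hk)
        rw [norm_star]
        exact norm_mul_sqrt_le_one hP hR' h'
      _ = k := by ring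
  have e3 : ‖CFC.sqrt (R j) * Wd j * CFC.sqrt (R (j - 2))‖ ≤ k := by
    rw [← norm_star, star_mul, star_mul, hs.star_eq, hs'.star_eq, hWd, star_star, ← mul_assoc]
    exact e2
  have e4 : sandwich R j (dress Wd Wu R j X) = (CFC.sqrt (R j) * Wd j * CFC.sqrt (R (j - 2))) * X *
      (CFC.sqrt (R (j - 2)) * Wu j * CFC.sqrt (R j)) := by
    simp only [sandwich, dress, mul_assoc]
  rw [e4]
  calc _ ≤ ‖CFC.sqrt (R j) * Wd j * CFC.sqrt (R (j - 2))‖ * ‖X‖ *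
        ‖CFC.sqrt (R (j - 2)) * Wu j * CFC.sqrt (R j)‖ := norm_mul₃_le
    _ ≤ k * ‖X‖ * k := mul_le_mul (mul_le_mul_of_nonneg_right e3 (norm_nonneg _)) e2
        (norm_nonneg _) (mul_nonneg hk (norm_nonneg _))
    _ = k ^ 2 * ‖X‖ := by ring

lemma algebraMap_le_of_spectrum {B : H →L[ℂ] H} (hB : IsSelfAdjoint B) {r : ℝ}
    (h : ∀ x ∈ spectrum ℝ B, r ≤ x) : algebraMap ℝ (H →L[ℂ] H) r ≤ B :=
  (algebraMap_le_iff_le_spectrum (R := ℝ) hB).mpr h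

end Abstract

/-! ### Maximal operators: graphs, compressed resolvents, bottom of the spectrum -/

section Maximal

variable {X : Type}

/-- The domain condition is automatic, because `χ` is already square summable. -/
lemma mem_graph_maximalOp {A : FormalOp X} {φ χ : EllTwo X} :
    (φ, χ) ∈ (maximalOp A).graph ↔ ∀ n, χ n = A φ n := by
  rw [LinearPMap.mem_graph_iff]
  constructor
  · rintro ⟨y, h1, h2⟩ n
    dsimp only at h1 h2
    rw [← h2, ← h1]
    rfl
  · intro h
    have hm : Memℓp (E := fun _ : X => ℂ) (A φ) 2 := by
      have : A φ = χ := funext fun n => (h n).symm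
      rw [this]
      exact lp.memℓp χ
    refine ⟨⟨φ, hm⟩, rfl, ?_⟩
    ext n
    exact (h n).symm

/-- A compressed resolvent of `D + V + Y + z`, where the compression removes `Y`. -/
lemma isCompressedResolvent_mul {A : FormalOp X} {D : X → ℝ} {V Y Q S : EllTwo X →L[ℂ] EllTwo X}
    {f : X → ℝ} {z : ℂ}
    (hA : ∀ (ψ : EllTwo X) n, A ψ n = (D n : ℂ) * ψ n + V ψ n + z * ψ n + Y ψ n)
    (hQ : ∀ ψ n, Q ψ n = f n * ψ n) (hf : ∀ n, f n * f n = f n)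
    (hVQ : Q * V = V * Q) (hY : Q * Y * Q = 0)
    (hS : ∀ ψ n, (D n : ℂ) * S ψ n + V (S ψ) n = ψ n)
    (hS' : ∀ φ ψ : EllTwo X, (∀ n, (D n : ℂ) * φ n + V φ n = ψ n) → S ψ = φ) :
    Q * S = S * Q ∧ Q * Q = Q ∧ IsCompressedResolvent (maximalOp A) Q z (S * Q) := by
  have hVQ' : ∀ φ, Q (V φ) = V (Q φ) := fun φ => congrArg (fun T : EllTwo X →L[ℂ] EllTwo X => T φ) hVQ
  have hY' : ∀ φ, Q (Y (Q φ)) = 0 := fun φ => congrArg (fun T : EllTwo X →L[ℂ] EllTwo X => T φ) hY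
  have hQQ' : ∀ ψ, Q (Q ψ) = Q ψ := by
    intro ψ
    ext n
    rw [hQ, hQ, ← mul_assoc]
    congr 1
    exact_mod_cast hf n
  -- `Q` commutes with the multiplication `D` and with `V`, so `Q S ψ` solves the equation with
  -- right side `Q ψ`; uniqueness does the rest.
  have hQS : ∀ ψ, S (Q ψ) = Q (S ψ) := by
    intro ψ
    refine hS' _ _ fun n => ?_
    rw [← hVQ', hQ, hQ, hQ, ← hS ψ n]
    ring
  refine ⟨by ext1 ψ; exact (hQS ψ).symm, by ext1 ψ; exact hQQ' ψ, ?_, ?_, ?_, ?_⟩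
  · ext1 ψ
    change Q (S (Q ψ)) = S (Q ψ)
    rw [← hQS, hQQ']
  · ext1 ψ
    change S (Q (Q ψ)) = S (Q ψ)
    rw [hQQ']
  · intro ψ
    change ∃ χ, (S (Q ψ), χ) ∈ _ ∧ Q (χ - z • S (Q ψ)) = Q ψ
    -- The witness is `A S Q ψ`, computed from the equation for `S`. Its `Y` part is removed by `Q Y
    -- Q = 0`.
    refine ⟨Q ψ + z • S (Q ψ) + Y (S (Q ψ)), mem_graph_maximalOp.mpr fun n => ?_, ?_⟩
    · rw [hA, hS]
      rfl
    · rw [show Q ψ + z • S (Q ψ) + Y (S (Q ψ)) - z • S (Q ψ) = Q ψ + Y (S (Q ψ)) by abel, map_add,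
        hQQ', hQS, hY', add_zero]
  · intro φ χ hφ hq
    rw [mem_graph_maximalOp] at hφ
    change S (Q (Q (χ - z • φ))) = φ
    rw [hQQ']
    refine hS' _ _ fun n => ?_
    have e1 : (f n : ℂ) * φ n = φ n := by rw [← hQ, hq]
    have e2 : (f n : ℂ) * V φ n = V φ n := by rw [← hQ, hVQ', hq]
    have e3 : (f n : ℂ) * Y φ n = 0 := by
      have := hY' φ
      rw [hq] at this
      rw [← hQ, this]
      rfl
    rw [hQ]
    simp only [lp.coeFn_sub, Pi.sub_apply, lp.coeFn_smul, Pi.smul_apply, smul_eq_mul]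
    rw [hφ, hA]
    linear_combination (-(D n : ℂ)) * e1 - e2 - e3

/-- The bottom of the spectrum of a bounded self-adjoint operator is a lower bound. -/
lemma infSpec_le {A : FormalOp X} {B : EllTwo X →L[ℂ] EllTwo X} (hB : IsSelfAdjoint B)
    (hA : ∀ (ψ : EllTwo X) n, A ψ n = B ψ n) :
    algebraMap ℝ (EllTwo X →L[ℂ] EllTwo X) (infSpec (maximalOp A)) ≤ B := by
  -- For `Q = 1` and an everywhere defined `B` a compressed resolvent is a two-sided inverse of `B -
  -- x`, so the set is the real spectrum of `B`.
  have hset : {x : ℝ | ¬ ∃ R, IsCompressedResolvent (maximalOp A)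
      (ContinuousLinearMap.id ℂ (EllTwo X)) (x : ℂ) R} = spectrum ℝ B := by
    ext x
    rw [Set.mem_ofPred_eq, spectrum.mem_iff, not_iff_not, IsUnit.sub_iff,
      Algebra.algebraMap_eq_smul_one]
    constructor
    · rintro ⟨R, hR⟩
      refine ⟨⟨B - x • 1, R, ?_, ?_⟩, rfl⟩
      · ext1 ψ
        obtain ⟨χ, hχ, e⟩ := hR.right_inv ψ
        rw [mem_graph_maximalOp] at hχ
        have e1 : χ = B (R ψ) := by
          ext n
          rw [hχ, hA]
        rw [e1] at e
        exact e
      · ext1 φ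
        exact hR.left_inv φ (B φ) (mem_graph_maximalOp.mpr fun n => (hA φ n).symm) rfl
    · rintro ⟨U, hU⟩
      refine ⟨(U⁻¹ : (EllTwo X →L[ℂ] EllTwo X)ˣ).1, rfl, rfl, fun ψ => ?_, fun φ χ h _ => ?_⟩
      · refine ⟨B ((U⁻¹ : (EllTwo X →L[ℂ] EllTwo X)ˣ).1 ψ),
          mem_graph_maximalOp.mpr fun n => (hA _ n).symm, ?_⟩
        have := congrArg (fun T : EllTwo X →L[ℂ] EllTwo X => T ψ) U.mul_inv
        rw [hU] at this
        exact this
      · rw [mem_graph_maximalOp] at h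
        have e1 : χ = B φ := by
          ext n
          rw [h, hA]
        rw [e1]
        have := congrArg (fun T : EllTwo X →L[ℂ] EllTwo X => T φ) U.inv_mul
        rw [hU] at this
        exact this
  refine algebraMap_le_of_spectrum hB fun x hx => ?_
  rw [infSpec, hset]
  exact csInf_le (spectrum.isCompact (𝕜 := ℝ) B).bddBelow hx

end Maximal

/-! ## Shifts of configurations at fixed particle number -/

section Sector

variable {d N : ℕ}

/-- The restriction of a map of configurations to the `N`-particle configurations. -/
noncomputable def liftMap (N : ℕ) (t : Conf d → Conf d) (n : NConf d N) : NConf d N :=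
  open Classical in if h : (t n.1).degree = N then ⟨t n.1, h⟩ else n

lemma liftMap_val {t : Conf d → Conf d} {n : NConf d N} (h : (t n.1).degree = n.1.degree) :
    (liftMap N t n).1 = t n.1 := by
  rw [liftMap, dif_pos (h.trans n.2)]

lemma sector_apply (A : FormalOp (Conf d)) (ψ : NConf d N → ℂ) (n : NConf d N) :
    sector N A ψ n = A (Function.extend Subtype.val ψ 0) n.1 := rfl

lemma extend_val_apply (ψ : NConf d N → ℂ) (n : NConf d N) :
    Function.extend (Subtype.val : NConf d N → Conf d) ψ 0 n.1 = ψ n :=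
  Subtype.val_injective.extend_apply ψ 0 n

/-- Where the weight vanishes, the fallback value of `liftMap` is multiplied by zero, so
conservation of particles is needed only on the support. -/
lemma sector_eq_formalShift {A : FormalOp (Conf d)} {c : Conf d → ℝ} {t : Conf d → Conf d}
    (hA : ∀ ψ n, A ψ n = (c n : ℂ) * ψ (t n)) (ht : ∀ n, c n ≠ 0 → (t n).degree = n.degree) :
    sector N A = formalShift (fun n => (c n.1 : ℂ)) (liftMap N t) := by
  ext ψ n
  rw [sector_apply, hA]
  change _ = (c n.1 : ℂ) * ψ (liftMap N t n)
  by_cases h : c n.1 = 0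
  · simp [h]
  · rw [← extend_val_apply ψ (liftMap N t n), liftMap_val (ht _ h)]

lemma conf_le (n : NConf d N) (a : Mode d) : (n.1 a : ℝ) ≤ N := by
  exact_mod_cast (Finsupp.le_degree a n.1).trans_eq n.2

end Sector

/-! ### Matrix elements of the pair terms -/

section Pair

variable {d : ℕ}

/-- Two particles in the mode `𝟎` are replaced by the pair `±𝐣`. -/
noncomputable def pairDown (j : Mode d) (n : Conf d) : Conf d :=
  n - Finsupp.single 0 1 - Finsupp.single 0 1 + Finsupp.single j 1 + Finsupp.single (-j) 1

/-- The pair `±𝐣` is replaced by two particles in the mode `𝟎`. -/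
noncomputable def pairUp (j : Mode d) (n : Conf d) : Conf d :=
  n + Finsupp.single 0 1 + Finsupp.single 0 1 - Finsupp.single j 1 - Finsupp.single (-j) 1

/-- The matrix elements of `W_𝐣`, where `r = φ_𝐣 / N`. -/
noncomputable def pairDownWeight (r : ℝ) (j : Mode d) (n : Conf d) : ℝ :=
  r * Real.sqrt ((n 0 : ℝ) * (n 0 - 1) * ((n j + 1) * (n (-j) + 1)))

/-- The matrix elements of `W*_𝐣`, where `r = φ_𝐣 / N`. -/
noncomputable def pairUpWeight (r : ℝ) (j : Mode d) (n : Conf d) : ℝ :=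
  r * Real.sqrt (((n 0 : ℝ) + 1) * (n 0 + 2) * (n j * n (-j)))

variable {j : Mode d} {r : ℝ} {n : Conf d}

lemma ne_neg_of_ne_zero (hj : j ≠ 0) : j ≠ -j := by
  intro h
  apply hj
  funext a
  have := congrFun h a
  simp only [Pi.neg_apply, Pi.zero_apply] at *
  omega

lemma pairDown_zero (hj : j ≠ 0) : pairDown j n 0 = n 0 - 2 := by
  simp [pairDown, hj]
  omega

lemma pairDown_self (hj : j ≠ 0) : pairDown j n j = n j + 1 := by
  have := (ne_neg_of_ne_zero hj).symm
  simp [pairDown, hj.symm, this]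

lemma pairDown_neg (hj : j ≠ 0) : pairDown j n (-j) = n (-j) + 1 := by
  have := ne_neg_of_ne_zero hj
  simp [pairDown, hj, this, eq_comm]

lemma pairDown_of_ne {a : Mode d} (h0 : a ≠ 0) (h1 : a ≠ j) (h2 : a ≠ -j) :
    pairDown j n a = n a := by
  simp [pairDown, h0.symm, h1.symm, h2.symm]

lemma pairUp_zero (hj : j ≠ 0) : pairUp j n 0 = n 0 + 2 := by
  simp [pairUp, hj]

lemma pairUp_self (hj : j ≠ 0) : pairUp j n j = n j - 1 := by
  have := (ne_neg_of_ne_zero hj).symm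
  simp [pairUp, hj.symm, this]

lemma pairUp_neg (hj : j ≠ 0) : pairUp j n (-j) = n (-j) - 1 := by
  have := ne_neg_of_ne_zero hj
  simp [pairUp, hj, this, eq_comm]

lemma pairUp_of_ne {a : Mode d} (h0 : a ≠ 0) (h1 : a ≠ j) (h2 : a ≠ -j) :
    pairUp j n a = n a := by
  simp [pairUp, h0.symm, h1.symm, h2.symm]

lemma two_le_of_pairDownWeight_ne (h : pairDownWeight r j n ≠ 0) : 2 ≤ n 0 := by
  by_contra h2
  apply h
  have : n 0 = 0 ∨ n 0 = 1 := by omega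
  rcases this with e | e <;> simp [pairDownWeight, e]

lemma one_le_of_pairUpWeight_ne (h : pairUpWeight r j n ≠ 0) : 1 ≤ n j ∧ 1 ≤ n (-j) := by
  constructor <;>
  · by_contra h2
    apply h
    simp [pairUpWeight, show _ = 0 by simpa using h2]

lemma pairUp_pairDown (hj : j ≠ 0) (h : 2 ≤ n 0) : pairUp j (pairDown j n) = n := by
  ext a
  by_cases h0 : a = 0
  · subst h0
    rw [pairUp_zero hj, pairDown_zero hj]
    omega
  by_cases h1 : a = j
  · subst h1
    rw [pairUp_self hj, pairDown_self hj]
    omega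
  by_cases h2 : a = -j
  · subst h2
    rw [pairUp_neg hj, pairDown_neg hj]
    omega
  rw [pairUp_of_ne h0 h1 h2, pairDown_of_ne h0 h1 h2]

lemma pairDown_pairUp (hj : j ≠ 0) (h : 1 ≤ n j ∧ 1 ≤ n (-j)) : pairDown j (pairUp j n) = n := by
  ext a
  by_cases h0 : a = 0
  · subst h0
    rw [pairDown_zero hj, pairUp_zero hj]
    omega
  by_cases h1 : a = j
  · subst h1
    rw [pairDown_self hj, pairUp_self hj]
    omega
  by_cases h2 : a = -j
  · subst h2
    rw [pairDown_neg hj, pairUp_neg hj]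
    omega
  rw [pairDown_of_ne h0 h1 h2, pairUp_of_ne h0 h1 h2]

lemma degree_pairDown (h : 2 ≤ n 0) : (pairDown j n).degree = n.degree := by
  have e : n - Finsupp.single 0 1 - Finsupp.single 0 1 + Finsupp.single 0 1 +
      Finsupp.single 0 1 = n := by
    ext a
    by_cases h0 : a = 0
    · subst h0
      simp
      omega
    · simp [Ne.symm h0]
  have := congrArg Finsupp.degree e
  simp only [map_add, Finsupp.degree_single, pairDown] at this ⊢
  exact this

lemma degree_pairUp (hj : j ≠ 0) (h : 1 ≤ n j ∧ 1 ≤ n (-j)) :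
    (pairUp j n).degree = n.degree := by
  conv_rhs => rw [← pairDown_pairUp hj h]
  rw [degree_pairDown]
  rw [pairUp_zero hj]
  omega

lemma pairUpWeight_pairDown (hj : j ≠ 0) (h : 2 ≤ n 0) :
    pairUpWeight r j (pairDown j n) = pairDownWeight r j n := by
  rw [pairUpWeight, pairDownWeight, pairDown_zero hj, pairDown_self hj, pairDown_neg hj]
  push_cast [h]
  ring_nf

lemma pairDownWeight_pairUp (hj : j ≠ 0) (h : 1 ≤ n j ∧ 1 ≤ n (-j)) :
    pairDownWeight r j (pairUp j n) = pairUpWeight r j n := by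
  rw [← pairUpWeight_pairDown hj (by rw [pairUp_zero hj]; omega), pairDown_pairUp hj h]

/-- Operators act on coefficients by pullback: annihilating the pair means reading `ψ` at the
configuration with the pair added and two condensate particles removed. -/
lemma formalW_apply {L : ℝ} (v : PairPotential d L) (N : ℕ) (hj : j ≠ 0) (ψ : Conf d → ℂ)
    (n : Conf d) : formalW v N j ψ n =
      (pairDownWeight (v.coeff j / N) j n : ℂ) * ψ (pairDown j n) := by
  change ((v.coeff j / N : ℝ) : ℂ) * ((Real.sqrt (n 0) : ℂ) *
    ((Real.sqrt ((n - Finsupp.single 0 1 : Conf d) 0) : ℂ) *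
    ((Real.sqrt ((n - Finsupp.single 0 1 - Finsupp.single 0 1 : Conf d) j + 1) : ℂ) *
    ((Real.sqrt ((n - Finsupp.single 0 1 - Finsupp.single 0 1 + Finsupp.single j 1 : Conf d) (-j)
      + 1) : ℂ) * ψ (pairDown j n))))) = _
  have hjj := ne_neg_of_ne_zero hj
  have e1 : (n - Finsupp.single 0 1 - Finsupp.single 0 1 : Conf d) j = n j := by
    simp [hj.symm]
  have e2 : (n - Finsupp.single 0 1 - Finsupp.single 0 1 + Finsupp.single j 1 : Conf d) (-j) =
      n (-j) := by
    simp [hj, hjj, eq_comm]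
  have e3 : (n - Finsupp.single 0 1 : Conf d) 0 = n 0 - 1 := by simp
  rw [e1, e2, e3, pairDownWeight]
  -- An empty condensate is separated, since the truncated difference `n 0 - 1` is then not the real
  -- one; both sides vanish.
  rcases Nat.eq_zero_or_pos (n 0) with h | h
  · simp [h]
  · rw [Nat.cast_sub h, Nat.cast_one]
    have h1 : (1 : ℝ) ≤ n 0 := by exact_mod_cast h
    rw [Real.sqrt_mul (by nlinarith), Real.sqrt_mul (by positivity), Real.sqrt_mul (by positivity)]
    push_cast
    ring

lemma formalWstar_apply {L : ℝ} (v : PairPotential d L) (N : ℕ) (hj : j ≠ 0) (ψ : Conf d → ℂ)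
    (n : Conf d) : formalWstar v N j ψ n =
      (pairUpWeight (v.coeff j / N) j n : ℂ) * ψ (pairUp j n) := by
  change ((v.coeff j / N : ℝ) : ℂ) * ((Real.sqrt (n 0 + 1) : ℂ) *
    ((Real.sqrt ((n + Finsupp.single 0 1 : Conf d) 0 + 1) : ℂ) *
    ((Real.sqrt ((n + Finsupp.single 0 1 + Finsupp.single 0 1 : Conf d) j) : ℂ) *
    ((Real.sqrt ((n + Finsupp.single 0 1 + Finsupp.single 0 1 - Finsupp.single j 1 : Conf d) (-j)) :
      ℂ) * ψ (pairUp j n))))) = _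
  have hjj := ne_neg_of_ne_zero hj
  have e1 : (n + Finsupp.single 0 1 + Finsupp.single 0 1 : Conf d) j = n j := by
    simp [hj.symm]
  have e2 : (n + Finsupp.single 0 1 + Finsupp.single 0 1 - Finsupp.single j 1 : Conf d) (-j) =
      n (-j) := by
    simp [hj, hjj, eq_comm]
  have e3 : (((n + Finsupp.single 0 1 : Conf d) 0 : ℕ) : ℝ) + 1 = n 0 + 2 := by
    simp
    ring
  rw [e1, e2, e3, pairUpWeight]
  rw [Real.sqrt_mul (by positivity), Real.sqrt_mul (by positivity), Real.sqrt_mul (by positivity)]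
  push_cast
  ring

lemma formalH0_apply {L : ℝ} (v : PairPotential d L) (N : ℕ) (ψ : Conf d → ℂ) (n : Conf d) :
    formalH0 v N j ψ n =
      (((kSq L j + v.coeff j / N * n 0) * (n j + n (-j)) : ℝ) : ℂ) * ψ n := by
  change (kSq L j : ℂ) * (cre j (ann j ψ) n + cre (-j) (ann (-j) ψ) n) +
    ((v.coeff j / N : ℝ) : ℂ) * cre 0 (ann 0 (cre j (ann j ψ) + cre (-j) (ann (-j) ψ))) n = _
  rw [cre_ann_apply, cre_ann_apply, cre_ann_apply, Pi.add_apply, cre_ann_apply, cre_ann_apply]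
  push_cast
  ring

/-- The eigenvalues of the kinetic energy of the modes outside `S`. -/
noncomputable def kineticValue (L : ℝ) (S : Set (Mode d)) (n : Conf d) : ℝ :=
  ∑ j ∈ n.support, Set.indicator Sᶜ (fun j => kSq L j * n j) j

lemma kineticValue_nonneg (L : ℝ) (S : Set (Mode d)) (n : Conf d) : 0 ≤ kineticValue L S n := by
  refine Finset.sum_nonneg fun j _ => Set.indicator_nonneg (fun j _ => ?_) j
  exact mul_nonneg (Finset.sum_nonneg fun a _ => sq_nonneg _) (Nat.cast_nonneg _)

lemma formalKinetic_apply (L : ℝ) (S : Set (Mode d)) (ψ : Conf d → ℂ) (n : Conf d) :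
    formalKinetic L S ψ n = (kineticValue L S n : ℂ) * ψ n := by
  change ∑ j ∈ n.support, Set.indicator Sᶜ (fun j => (kSq L j : ℂ) * cre j (ann j ψ) n) j = _
  rw [kineticValue, Complex.ofReal_sum, Finset.sum_mul]
  refine Finset.sum_congr rfl fun j _ => ?_
  by_cases h : j ∈ S
  · simp [h]
  · simp [h, cre_ann_apply, mul_assoc]

end Pair

/-! ## The operators of the model as weighted shifts -/

section Model

variable {d : ℕ} {L : ℝ} {v : PairPotential d L} {M : ℕ}

lemma InteractingModes.mode_ne_zero (J : InteractingModes v M) (l : Fin M) : J.mode l ≠ 0 :=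
  ((J.mem_iff (J.mode l)).mpr ⟨l, Or.inl rfl⟩).1

lemma InteractingModes.phi_pos (J : InteractingModes v M) (l : Fin M) : 0 < J.phi l := by
  have h := ((J.mem_iff (J.mode l)).mpr ⟨l, Or.inl rfl⟩).2
  obtain ⟨r, hr, e⟩ := v.positiveType (J.mode l)
  have e' : v.coeff (J.mode l) = r := by rw [PairPotential.coeff, e, Complex.ofReal_re]
  rw [InteractingModes.phi]
  rw [e'] at h ⊢
  exact lt_of_le_of_ne hr h.symm

lemma kSq_nonneg (j : Mode d) : 0 ≤ kSq L j := Finset.sum_nonneg fun _ _ => sq_nonneg _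

lemma kSq_pos (hL : 0 < L) {j : Mode d} (hj : j ≠ 0) : 0 < kSq L j := by
  obtain ⟨a, ha⟩ := Function.ne_iff.mp hj
  refine Finset.sum_pos' (fun _ _ => sq_nonneg _) ⟨a, Finset.mem_univ _, ?_⟩
  have : (j a : ℝ) ≠ 0 := by exact_mod_cast ha
  have := Real.pi_pos
  positivity

variable {N : ℕ} {j : Mode d}

lemma isBoundedShift_pairUp (r : ℝ) (N : ℕ) (hj : j ≠ 0) :
    IsBoundedShift (fun n : NConf d N => (pairUpWeight r j n.1 : ℂ)) (liftMap N (pairUp j))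
      (|r| * (N + 2) ^ 2) := by
  refine ⟨fun n hn n' hn' e => ?_, fun n => ?_, by positivity⟩
  · have h := one_le_of_pairUpWeight_ne (Complex.ofReal_ne_zero.mp hn)
    have h' := one_le_of_pairUpWeight_ne (Complex.ofReal_ne_zero.mp hn')
    have e' := congrArg Subtype.val e
    rw [liftMap_val (degree_pairUp hj h), liftMap_val (degree_pairUp hj h')] at e'
    apply Subtype.ext
    rw [← pairDown_pairUp hj h, e', pairDown_pairUp hj h']
  · rw [Complex.norm_real, Real.norm_eq_abs, pairUpWeight, abs_mul, abs_of_nonneg (Real.sqrt_nonneg _)]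
    refine mul_le_mul_of_nonneg_left ?_ (abs_nonneg _)
    rw [Real.sqrt_le_left (by positivity)]
    have h0 := conf_le n 0
    have h1 := conf_le n j
    have h2 := conf_le n (-j)
    calc ((n.1 0 : ℝ) + 1) * (n.1 0 + 2) * (n.1 j * n.1 (-j)) ≤
          ((N + 2) * (N + 2)) * ((N + 2) * (N + 2)) := by
          gcongr <;> linarith
      _ = _ := by ring

lemma isBoundedShift_pairDown (r : ℝ) (N : ℕ) (hj : j ≠ 0) :
    IsBoundedShift (fun n : NConf d N => (pairDownWeight r j n.1 : ℂ)) (liftMap N (pairDown j))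
      (|r| * (N + 2) ^ 2) := by
  refine ⟨fun n hn n' hn' e => ?_, fun n => ?_, by positivity⟩
  · have h := two_le_of_pairDownWeight_ne (Complex.ofReal_ne_zero.mp hn)
    have h' := two_le_of_pairDownWeight_ne (Complex.ofReal_ne_zero.mp hn')
    have e' := congrArg Subtype.val e
    rw [liftMap_val (degree_pairDown h), liftMap_val (degree_pairDown h')] at e'
    apply Subtype.ext
    rw [← pairUp_pairDown hj h, e', pairUp_pairDown hj h']
  · by_cases h : pairDownWeight r j n.1 = 0
    · simp only [h, Complex.ofReal_zero, norm_zero]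
      positivity
    · have h := two_le_of_pairDownWeight_ne h
      have := (isBoundedShift_pairUp r N hj).bound (liftMap N (pairDown j) n)
      simp only [liftMap_val (degree_pairDown h), pairUpWeight_pairDown hj h] at this
      exact this

lemma star_shiftOp_pairUp (r : ℝ) (N : ℕ) (hj : j ≠ 0) :
    star (shiftOp (fun n : NConf d N => (pairUpWeight r j n.1 : ℂ)) (liftMap N (pairUp j))) =
      shiftOp (fun n : NConf d N => (pairDownWeight r j n.1 : ℂ)) (liftMap N (pairDown j)) := by
  refine (isBoundedShift_pairUp r N hj).star_eq (isBoundedShift_pairDown r N hj) ?_ ?_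
  · intro n hn
    have h := one_le_of_pairUpWeight_ne (Complex.ofReal_ne_zero.mp hn)
    have e := liftMap_val (degree_pairUp hj h)
    have h2 : 2 ≤ (liftMap N (pairUp j) n).1 0 := by rw [e, pairUp_zero hj]; omega
    refine ⟨Subtype.ext ?_, ?_⟩
    · rw [liftMap_val (degree_pairDown h2), e, pairDown_pairUp hj h]
    · simp [e, pairDownWeight_pairUp hj h]
  · intro n hn
    have h := two_le_of_pairDownWeight_ne (Complex.ofReal_ne_zero.mp hn)
    have e := liftMap_val (degree_pairDown (j := j) h)
    have h2 : 1 ≤ (liftMap N (pairDown j) n).1 j ∧ 1 ≤ (liftMap N (pairDown j) n).1 (-j) := by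
      rw [e, pairDown_self hj, pairDown_neg hj]
      omega
    refine ⟨Subtype.ext ?_, ?_⟩
    · rw [liftMap_val (degree_pairUp hj h2), e, pairUp_pairDown hj h]
    · simp [e, pairUpWeight_pairDown hj h]

lemma opWstar_eq (J : InteractingModes v M) (N : ℕ) (l : Fin M) : opWstar J N l =
    shiftOp (fun n => (pairUpWeight (v.coeff (J.mode l) / N) (J.mode l) n.1 : ℂ))
      (liftMap N (pairUp (J.mode l))) := by
  rw [opWstar, shiftOp, sector_eq_formalShift (formalWstar_apply v N (J.mode_ne_zero l))]
  exact fun n hn => degree_pairUp (J.mode_ne_zero l) (one_le_of_pairUpWeight_ne hn)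

lemma opW_eq (J : InteractingModes v M) (N : ℕ) (l : Fin M) : opW J N l =
    shiftOp (fun n => (pairDownWeight (v.coeff (J.mode l) / N) (J.mode l) n.1 : ℂ))
      (liftMap N (pairDown (J.mode l))) := by
  rw [opW, shiftOp, sector_eq_formalShift (formalW_apply v N (J.mode_ne_zero l))]
  exact fun n hn => degree_pairDown (two_le_of_pairDownWeight_ne hn)

lemma star_opWstar (J : InteractingModes v M) (N : ℕ) (l : Fin M) :
    star (opWstar J N l) = opW J N l := by
  rw [opWstar_eq, opW_eq]
  exact star_shiftOp_pairUp _ N (J.mode_ne_zero l)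

/-- The eigenvalues of `Ĥ⁰_𝐣`. -/
noncomputable def pairEnergy (v : PairPotential d L) (N : ℕ) (j : Mode d) (n : NConf d N) : ℝ :=
  (kSq L j + v.coeff j / N * n.1 0) * (n.1 j + n.1 (-j))

lemma abs_pairEnergy_le (v : PairPotential d L) (N : ℕ) (j : Mode d) (n : NConf d N) :
    |pairEnergy v N j n| ≤ (kSq L j + |v.coeff j / N| * N) * (N + N) := by
  rw [pairEnergy, abs_mul]
  have h0 := conf_le n 0
  have h1 := conf_le n j
  have h2 := conf_le n (-j)
  have hk := kSq_nonneg (L := L) j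
  refine mul_le_mul ?_ ?_ (abs_nonneg _) (by positivity)
  · refine (abs_add_le _ _).trans ?_
    rw [abs_of_nonneg hk, abs_mul, Nat.abs_cast]
    gcongr
  · rw [abs_of_nonneg (by positivity)]
    linarith

lemma pairEnergy_nonneg (v : PairPotential d L) (N : ℕ) (j : Mode d) (hv : 0 ≤ v.coeff j)
    (n : NConf d N) : 0 ≤ pairEnergy v N j n := by
  have hk := kSq_nonneg (L := L) j
  unfold pairEnergy
  positivity

/-- `Ĥ^{Bog}_{𝐣_l}` as a bounded operator. -/
noncomputable def opHhat (J : InteractingModes v M) (N : ℕ) (l : Fin M) : FockN d N →L[ℂ] FockN d N :=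
  mulOp (pairEnergy v N (J.mode l)) + (opW J N l + opWstar J N l)

lemma isSelfAdjoint_opW_add (J : InteractingModes v M) (N : ℕ) (l : Fin M) :
    IsSelfAdjoint (opW J N l + opWstar J N l) := by
  rw [isSelfAdjoint_iff, star_add, star_opWstar, ← star_opWstar, star_star, add_comm]

lemma isSelfAdjoint_opHhat (J : InteractingModes v M) (N : ℕ) (l : Fin M) :
    IsSelfAdjoint (opHhat J N l) :=
  (isSelfAdjoint_mulOp (abs_pairEnergy_le v N (J.mode l))).add (isSelfAdjoint_opW_add J N l)

lemma formalHhat_extend_apply (J : InteractingModes v M) (N : ℕ) (l : Fin M) (ψ : FockN d N)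
    (n : NConf d N) : formalHhat v N (J.mode l) (Function.extend Subtype.val ψ 0) n.1 =
      opHhat J N l ψ n := by
  have e1 := congrFun (opW_apply J N l ψ) n
  have e2 := congrFun (opWstar_apply J N l ψ) n
  rw [sector_apply] at e1 e2
  have e3 := mulOp_apply (abs_pairEnergy_le v N (J.mode l)) ψ n
  change formalH0 v N (J.mode l) _ n.1 + formalW v N (J.mode l) _ n.1 +
    formalWstar v N (J.mode l) _ n.1 =
    mulOp (pairEnergy v N (J.mode l)) ψ n + (opW J N l ψ n + opWstar J N l ψ n)
  rw [← e1, ← e2, e3, formalH0_apply, extend_val_apply, add_assoc]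
  rfl

lemma interaction_apply (J : InteractingModes v M) (N : ℕ) (S : Finset (Fin M)) (ψ : FockN d N)
    (n : NConf d N) : sector N (∑ l ∈ S, formalHhat v N (J.mode l)) ψ n =
      (∑ l ∈ S, opHhat J N l) ψ n := by
  rw [sector_apply, LinearMap.sum_apply, Finset.sum_apply, sum_apply,
    lp.coeFn_sum, Finset.sum_apply]
  exact Finset.sum_congr rfl fun l _ => formalHhat_extend_apply J N l ψ n

/-- The indicator function of the range of `Q^{(i,i+1)}_𝐣`. -/
noncomputable def pairIndicator (N : ℕ) (j : Mode d) (i : ℕ) (n : NConf d N) : ℝ :=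
  if n.1 j + n.1 (-j) + i = N ∨ n.1 j + n.1 (-j) + i + 1 = N then 1 else 0

lemma abs_pairIndicator_le (N : ℕ) (j : Mode d) (i : ℕ) (n : NConf d N) :
    |pairIndicator N j i n| ≤ 1 := by
  unfold pairIndicator
  split_ifs <;> simp

lemma pairIndicator_mul_self (N : ℕ) (j : Mode d) (i : ℕ) (n : NConf d N) :
    pairIndicator N j i n * pairIndicator N j i n = pairIndicator N j i n := by
  unfold pairIndicator
  split_ifs <;> simp

lemma opQ_eq (J : InteractingModes v M) (N : ℕ) (l : Fin M) (i : ℕ) :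
    opQ J N l i = mulOp (pairIndicator N (J.mode l) i) := by
  ext ψ n
  rw [mulOp_apply (abs_pairIndicator_le N (J.mode l) i), opQ_apply, sector_apply]
  change (if n.1 (J.mode l) + n.1 (-J.mode l) + i = N ∨ n.1 (J.mode l) + n.1 (-J.mode l) + i + 1 = N
    then Function.extend Subtype.val (ψ : NConf d N → ℂ) 0 n.1 else 0) = _
  unfold pairIndicator
  split_ifs
  · rw [extend_val_apply]
    simp
  · simp

lemma opQ_apply' (J : InteractingModes v M) (N : ℕ) (l : Fin M) (i : ℕ) (ψ : FockN d N)
    (n : NConf d N) : opQ J N l i ψ n = pairIndicator N (J.mode l) i n * ψ n := by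
  rw [opQ_eq, mulOp_apply (abs_pairIndicator_le N (J.mode l) i)]

lemma isSelfAdjoint_opQ (J : InteractingModes v M) (N : ℕ) (l : Fin M) (i : ℕ) :
    IsSelfAdjoint (opQ J N l i) := by
  rw [opQ_eq]
  exact isSelfAdjoint_mulOp (abs_pairIndicator_le N (J.mode l) i)

lemma Wdown_eq_star (J : InteractingModes v M) (N : ℕ) (l : Fin M) (i : ℕ) :
    Wdown J N l i = star (Wup J N l i) := by
  rw [Wdown, Wup, star_mul, star_mul, star_opWstar, (isSelfAdjoint_opQ J N l i).star_eq,
    (isSelfAdjoint_opQ J N l (i - 2)).star_eq, mul_assoc]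

lemma opQ_comm_mulOp (J : InteractingModes v M) (N : ℕ) (l : Fin M) (i : ℕ) {f : NConf d N → ℝ}
    {C : ℝ} (hf : ∀ n, |f n| ≤ C) : opQ J N l i * mulOp f = mulOp f * opQ J N l i := by
  ext ψ n
  change opQ J N l i (mulOp f ψ) n = mulOp f (opQ J N l i ψ) n
  rw [opQ_apply', mulOp_apply hf, mulOp_apply hf, opQ_apply']
  ring

/-- Different couples are disjoint, so moving a pair at `±𝐣_l` leaves the occupation of `±𝐣_m`
unchanged. -/
lemma opQ_comm_opWstar (J : InteractingModes v M) (N : ℕ) {l m : Fin M} (h : l ≠ m) (i : ℕ) :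
    opQ J N m i * opWstar J N l = opWstar J N l * opQ J N m i := by
  have hl := J.mode_ne_zero l
  have hm := J.mode_ne_zero m
  have h1 : J.mode m ≠ J.mode l := fun e => h (J.mode_injective l m (Or.inl e.symm))
  have h2 : J.mode m ≠ -J.mode l := fun e => h (J.mode_injective m l (Or.inr e)).symm
  have hb := isBoundedShift_pairUp (v.coeff (J.mode l) / N) N hl
  ext ψ n
  change opQ J N m i (opWstar J N l ψ) n = opWstar J N l (opQ J N m i ψ) n
  rw [opQ_apply', opWstar_eq, hb.apply, hb.apply, opQ_apply']
  by_cases hn : pairUpWeight (v.coeff (J.mode l) / N) (J.mode l) n.1 = 0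
  · simp [hn]
  · have e := liftMap_val (degree_pairUp hl (one_le_of_pairUpWeight_ne hn))
    have : pairIndicator N (J.mode m) i (liftMap N (pairUp (J.mode l)) n) =
        pairIndicator N (J.mode m) i n := by
      unfold pairIndicator
      rw [e, pairUp_of_ne hm h1 h2, pairUp_of_ne (neg_ne_zero.mpr hm)
        (fun e => h2 (neg_eq_iff_eq_neg.mp e)) (fun e => h1 (neg_injective e))]
    rw [this]
    ring

lemma opQ_comm_opHhat (J : InteractingModes v M) (N : ℕ) {l m : Fin M} (h : l ≠ m) (i : ℕ) :
    opQ J N m i * opHhat J N l = opHhat J N l * opQ J N m i := by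
  have h1 := opQ_comm_opWstar J N h i
  have h2 := congrArg star h1
  rw [star_mul, star_mul, star_opWstar, (isSelfAdjoint_opQ J N m i).star_eq] at h2
  rw [opHhat, mul_add, add_mul, mul_add, add_mul, h1, h2,
    opQ_comm_mulOp J N m i (abs_pairEnergy_le v N (J.mode l))]

/-- A pair changes the occupation of `±𝐣_m` by two, while the range of `Q_i` allows only two
consecutive values. -/
lemma opQ_opWstar_opQ (J : InteractingModes v M) (N : ℕ) (m : Fin M) (i : ℕ) :
    opQ J N m i * opWstar J N m * opQ J N m i = 0 := by
  have hm := J.mode_ne_zero m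
  have hb := isBoundedShift_pairUp (v.coeff (J.mode m) / N) N hm
  ext ψ n
  change opQ J N m i (opWstar J N m (opQ J N m i ψ)) n = 0
  rw [opQ_apply', opWstar_eq, hb.apply, opQ_apply']
  by_cases hn : pairUpWeight (v.coeff (J.mode m) / N) (J.mode m) n.1 = 0
  · simp [hn]
  · have h1 := one_le_of_pairUpWeight_ne hn
    have e := liftMap_val (degree_pairUp hm h1)
    have : pairIndicator N (J.mode m) i n *
        pairIndicator N (J.mode m) i (liftMap N (pairUp (J.mode m)) n) = 0 := by
      unfold pairIndicator
      rw [e, pairUp_self hm, pairUp_neg hm]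
      split_ifs with h2 h3
      · omega
      all_goals simp
    have h0 : (pairIndicator N (J.mode m) i n : ℂ) *
        pairIndicator N (J.mode m) i (liftMap N (pairUp (J.mode m)) n) = 0 := by
      exact_mod_cast this
    linear_combination (pairUpWeight (v.coeff (J.mode m) / N) (J.mode m) n.1 : ℂ) *
      ψ (liftMap N (pairUp (J.mode m)) n) * h0

lemma opQ_opW_add_opQ (J : InteractingModes v M) (N : ℕ) (m : Fin M) (i : ℕ) :
    opQ J N m i * (opW J N m + opWstar J N m) * opQ J N m i = 0 := by
  have h1 := opQ_opWstar_opQ J N m i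
  have h2 := congrArg star h1
  rw [star_mul, star_mul, star_opWstar, (isSelfAdjoint_opQ J N m i).star_eq, star_zero,
    ← mul_assoc] at h2
  rw [mul_add, add_mul, h1, h2, add_zero]

end Model

lemma isSelfAdjoint_algebraMap_real {H : Type} [NormedAddCommGroup H] [InnerProductSpace ℂ H]
    [CompleteSpace H] (r : ℝ) : IsSelfAdjoint (algebraMap ℝ (H →L[ℂ] H) r) :=
  IsSelfAdjoint.algebraMap _ (IsSelfAdjoint.all r)

lemma algebraMap_real_mono {H : Type} [NormedAddCommGroup H] [InnerProductSpace ℂ H]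
    [CompleteSpace H] {r r' : ℝ} (h : r ≤ r') :
    algebraMap ℝ (H →L[ℂ] H) r ≤ algebraMap ℝ (H →L[ℂ] H) r' :=
  algebraMap_mono _ h

/-- The form inequality reads `S V S ≤ S`, so `P² ≤ V` gives `S P² S ≤ S`; conjugation by `Q`, which
commutes with `S`, transfers this to `S Q`. -/
lemma compression_dominated {H : Type} [NormedAddCommGroup H] [InnerProductSpace ℂ H]
    [CompleteSpace H] {S Q P V : H →L[ℂ] H} (hS : 0 ≤ S) (hQ : IsSelfAdjoint Q) (hQQ : Q * Q = Q)
    (hQS : Q * S = S * Q) (hV : IsSelfAdjoint V) (hPV : P * P ≤ V)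
    (h : ∀ ψ, RCLike.re (inner ℂ (S ψ) (V (S ψ))) ≤ RCLike.re (inner ℂ (S ψ) ψ)) :
    0 ≤ S * Q ∧ S * Q * P * P * (S * Q) ≤ S * Q := by
  have e1 : S * Q = star Q * S * Q := by
    rw [hQ.star_eq, hQS, mul_assoc, hQQ]
  have hSs : IsSelfAdjoint S := hS.isSelfAdjoint
  have hSVS : star S * V * S ≤ S := by
    rw [ContinuousLinearMap.le_def, ContinuousLinearMap.isPositive_def']
    refine ⟨hSs.sub (hV.conjugate' S), fun ψ => ?_⟩
    rw [ContinuousLinearMap.reApplyInnerSelf_apply, sub_apply, inner_sub_left,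
      map_sub, hSs.star_eq, sub_nonneg]
    have e2 : inner ℂ ((S * V * S) ψ) ψ = inner ℂ (V (S ψ)) (S ψ) := hSs.isSymmetric _ _
    rw [e2, inner_re_symm]
    exact h ψ
  have hSPS : S * P * P * S ≤ S := by
    refine le_trans ?_ hSVS
    have := star_left_conjugate_le_conjugate hPV S
    rw [hSs.star_eq] at this ⊢
    rwa [← mul_assoc] at this
  refine ⟨e1 ▸ star_left_conjugate_nonneg hS Q, ?_⟩
  have e3 : S * Q * P * P * (S * Q) = star Q * (S * P * P * S) * Q := by
    rw [hQ.star_eq]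
    nth_rewrite 1 [← hQS]
    simp only [mul_assoc]
  rw [e3, e1]
  exact star_left_conjugate_le_conjugate hSPS Q

/-! ### Existence and domination of the resolvents -/

section Model

variable {d : ℕ} {L : ℝ} {v : PairPotential d L} {M : ℕ}

/-- A multiplication operator below the compressed Hamiltonians. -/
noncomputable def lowerSymbol (J : InteractingModes v M) (N : ℕ) (m : Fin M) (γ : ℝ)
    (n : NConf d N) : ℝ := pairEnergy v N (J.mode m) n + γ

variable {J : InteractingModes v M} {N : ℕ} {m : Fin M} {γ w : ℝ}

lemma le_lowerSymbol (n : NConf d N) : γ ≤ lowerSymbol J N m γ n := by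
  have := pairEnergy_nonneg v N (J.mode m) (J.phi_pos m).le n
  unfold lowerSymbol
  linarith

lemma exists_sqrt_lowerSymbol_le (J : InteractingModes v M) (N : ℕ) (m : Fin M) (γ : ℝ) :
    ∃ C, ∀ n, |Real.sqrt (lowerSymbol J N m γ n)| ≤ C := by
  refine ⟨Real.sqrt ((kSq L (J.mode m) + |v.coeff (J.mode m) / N| * N) * (N + N) + |γ|),
    fun n => ?_⟩
  rw [abs_of_nonneg (Real.sqrt_nonneg _)]
  refine Real.sqrt_le_sqrt (add_le_add ?_ (le_abs_self γ))
  exact (le_abs_self _).trans (abs_pairEnergy_le v N (J.mode m) n)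

lemma algebraMap_apply_coe {X : Type} (r : ℝ) (ψ : EllTwo X) (n : X) :
    algebraMap ℝ (EllTwo X →L[ℂ] EllTwo X) r ψ n = r * ψ n := by
  rw [Algebra.algebraMap_eq_smul_one]
  change (r • ψ) n = _
  rw [lp.coeFn_smul, Pi.smul_apply, Complex.real_smul]

lemma sqrt_lowerSymbol_mul_self (hγ : 0 < γ) :
    mulOp (fun n => Real.sqrt (lowerSymbol J N m γ n)) *
      mulOp (fun n => Real.sqrt (lowerSymbol J N m γ n)) =
    mulOp (pairEnergy v N (J.mode m)) + algebraMap ℝ (FockN d N →L[ℂ] FockN d N) γ := by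
  obtain ⟨C, hC⟩ := exists_sqrt_lowerSymbol_le J N m γ
  ext ψ n
  change mulOp (fun n => Real.sqrt (lowerSymbol J N m γ n)) (mulOp _ ψ) n =
    mulOp (pairEnergy v N (J.mode m)) ψ n + algebraMap ℝ (FockN d N →L[ℂ] FockN d N) γ ψ n
  rw [mulOp_apply hC, mulOp_apply hC, mulOp_apply (abs_pairEnergy_le v N (J.mode m)),
    algebraMap_apply_coe, ← mul_assoc, ← Complex.ofReal_mul,
    Real.mul_self_sqrt (hγ.le.trans (le_lowerSymbol n)), lowerSymbol]
  push_cast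
  ring

/-- The resolvents exist, are nonnegative, and are dominated by a multiplication operator. -/
theorem resolventR_dominated (hγ : 0 < γ)
    (hw : w + γ ≤ infSpec (interactionHam J N (Finset.Iio m))) (i : ℕ) :
    IsCompressedResolvent (bogHam J N (Finset.Iic m)) (opQ J N m i) (w : ℂ)
        (resolventR J N m w i) ∧ 0 ≤ resolventR J N m w i ∧
      resolventR J N m w i * mulOp (fun n => Real.sqrt (lowerSymbol J N m γ n)) *
        mulOp (fun n => Real.sqrt (lowerSymbol J N m γ n)) * resolventR J N m w i ≤
        resolventR J N m w i := by
  have hB : IsSelfAdjoint (∑ l ∈ Finset.Iio m, opHhat J N l) :=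
    isSelfAdjoint_sum _ fun l _ => isSelfAdjoint_opHhat J N l
  have hBle := infSpec_le hB (interaction_apply J N (Finset.Iio m))
  have hE := isSelfAdjoint_mulOp (abs_pairEnergy_le v N (J.mode m))
  -- The bounded part of the compressed operator. The kinetic energy plays the role of `D`, and the
  -- hopping of the couple `m` that of the term removed by the compression.
  obtain ⟨V, hVdef⟩ : ∃ V, V = ∑ l ∈ Finset.Iio m, opHhat J N l +
      mulOp (pairEnergy v N (J.mode m)) - algebraMap ℝ (FockN d N →L[ℂ] FockN d N) w := ⟨_, rfl⟩
  have hVs : IsSelfAdjoint V := hVdef ▸ (hB.add hE).sub (isSelfAdjoint_algebraMap_real w)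
  have hGV : mulOp (pairEnergy v N (J.mode m)) + algebraMap ℝ (FockN d N →L[ℂ] FockN d N) γ ≤ V := by
    have h1 : algebraMap ℝ (FockN d N →L[ℂ] FockN d N) (w + γ) ≤ ∑ l ∈ Finset.Iio m, opHhat J N l :=
      (algebraMap_real_mono hw).trans hBle
    rw [map_add] at h1
    rw [hVdef, ← sub_nonneg]
    rw [← sub_nonneg] at h1
    convert h1 using 1
    abel
  have hγV : algebraMap ℝ (FockN d N →L[ℂ] FockN d N) γ ≤ V :=
    le_trans (le_add_of_nonneg_left (mulOp_nonneg (abs_pairEnergy_le v N (J.mode m))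
      (pairEnergy_nonneg v N (J.mode m) (J.phi_pos m).le))) hGV
  obtain ⟨S, hS1, hS2, hS3, hS0⟩ := exists_inverse_mul_add
    (D := fun n : NConf d N => kineticValue L
      {j | ∃ l ∈ Finset.Iic m, j = J.mode l ∨ j = -J.mode l} n.1)
    (fun n => kineticValue_nonneg L _ n.1) hγ hVs hγV
  have hQV : opQ J N m i * V = V * opQ J N m i := by
    rw [hVdef, mul_sub, sub_mul, mul_add, add_mul, Finset.mul_sum, Finset.sum_mul,
      opQ_comm_mulOp J N m i (abs_pairEnergy_le v N (J.mode m)),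
      Algebra.commutes w (opQ J N m i)]
    congr 2
    exact Finset.sum_congr rfl fun l hl =>
      opQ_comm_opHhat J N (Finset.mem_Iio.mp hl).ne i
  have hA : ∀ (ψ : FockN d N) n, sector N (formalKinetic L
      {j | ∃ l ∈ Finset.Iic m, j = J.mode l ∨ j = -J.mode l} +
        ∑ l ∈ Finset.Iic m, formalHhat v N (J.mode l)) ψ n =
      (kineticValue L {j | ∃ l ∈ Finset.Iic m, j = J.mode l ∨ j = -J.mode l} n.1 : ℂ) * ψ n +
        V ψ n + (w : ℂ) * ψ n + (opW J N m + opWstar J N m) ψ n := by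
    intro ψ n
    have e1 := interaction_apply J N (Finset.Iic m) ψ n
    rw [sector_apply] at e1 ⊢
    rw [LinearMap.add_apply, Pi.add_apply, e1, formalKinetic_apply, extend_val_apply,
      ← Finset.Iio_insert, Finset.sum_insert Finset.notMem_Iio_self, add_assoc, add_assoc]
    congr 1
    have e2 : opHhat J N m + ∑ l ∈ Finset.Iio m, opHhat J N l = V +
        (algebraMap ℝ (FockN d N →L[ℂ] FockN d N) w + (opW J N m + opWstar J N m)) := by
      rw [hVdef, opHhat]
      abel
    rw [e2, ← algebraMap_apply_coe]
    rfl
  obtain ⟨hc, hQQ, hR⟩ := isCompressedResolvent_mul hA (opQ_apply' J N m i)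
    (pairIndicator_mul_self N (J.mode m) i) hQV (opQ_opW_add_opQ J N m i) hS1 hS2
  have hRe : resolventR J N m w i = S * opQ J N m i := hR.compressedResolvent_eq
  rw [hRe]
  have hP := sqrt_lowerSymbol_mul_self (J := J) (N := N) (m := m) hγ
  obtain ⟨h1, h2⟩ := compression_dominated hS0 (isSelfAdjoint_opQ J N m i) hQQ hc hVs
    (hP.trans_le hGV) hS3
  exact ⟨hR, h1, h2⟩

end Model

/-! ### The model satisfies the abstract hypotheses -/

section Model

variable {d : ℕ} {L : ℝ} {v : PairPotential d L} {M : ℕ}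
  {J : InteractingModes v M} {N : ℕ} {m : Fin M}

lemma kSq_eq (J : InteractingModes v M) (m : Fin M) :
    kSq L (J.mode m) = J.eps m * J.phi m := by
  rw [InteractingModes.eps, div_mul_cancel₀ _ (J.phi_pos m).ne']

lemma lowerSymbol_eq (n : NConf d N) {γ : ℝ} : lowerSymbol J N m (J.phi m * γ) n =
    J.phi m * ((J.eps m + n.1 0 / N) * (n.1 (J.mode m) + n.1 (-J.mode m)) + γ) := by
  rw [lowerSymbol, pairEnergy, kSq_eq, ← InteractingModes.phi]
  ring

lemma conf_three_le (n : NConf d N) {j : Mode d} (hj : j ≠ 0) : n.1 0 + n.1 j + n.1 (-j) ≤ N := by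
  classical
  have hjj := ne_neg_of_ne_zero hj
  have h : ∑ a ∈ ({0, j, -j} : Finset (Mode d)), n.1 a ≤ n.1.degree := by
    rw [Finsupp.degree_apply]
    refine Finset.sum_le_sum_of_ne_zero fun a _ ha => Finsupp.mem_support_iff.mpr ha
  rw [n.2, Finset.sum_insert (by simp [hj.symm, eq_comm, hj]), Finset.sum_pair hjj] at h
  omega

/-- Up to `J.phi m ^ 2` this is `hopping_bound`, with `p` and `q` the occupations of `±𝐣_m` after
removal of the pair. Membership in the range of `Q_i` gives `p + q + 2 ≥ N - i + 1`, and `invK` is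
increasing, so the constant at index `i` suffices. -/
lemma pairUpWeight_sq_le {e r : ℝ} (h0 : 0 < e) (h1 : e ≤ 1 / 100) (he : J.eps m = e ^ 2)
    (hr : 0 ≤ r) (hrN : 6 * (r + 2 / N) ≤ e ^ 4) {i : ℕ} (hi : i + 2 ≤ N) (n : NConf d N)
    (hn : pairUpWeight (v.coeff (J.mode m) / N) (J.mode m) n.1 ≠ 0)
    (hQ : pairIndicator N (J.mode m) i (liftMap N (pairUp (J.mode m)) n) ≠ 0) :
    pairUpWeight (v.coeff (J.mode m) / N) (J.mode m) n.1 ^ 2 ≤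
      KConst (2 * e ^ 2) (e ^ 2) N i *
        (lowerSymbol J N m (J.phi m * (gapConst e - r)) n *
          lowerSymbol J N m (J.phi m * (gapConst e - r)) (liftMap N (pairUp (J.mode m)) n)) := by
  have hm := J.mode_ne_zero m
  have hφ := J.phi_pos m
  have h := one_le_of_pairUpWeight_ne hn
  have e1 := liftMap_val (degree_pairUp hm h)
  have hle := conf_three_le n hm
  have hN : (0 : ℝ) < N := by exact_mod_cast (show 0 < N by omega)
  have hi' : (i : ℝ) + 2 ≤ N := by exact_mod_cast hi
  obtain ⟨p, hp⟩ : ∃ p, n.1 (J.mode m) = p + 1 := ⟨_, (Nat.sub_add_cancel h.1).symm⟩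
  obtain ⟨q, hq⟩ : ∃ q, n.1 (-J.mode m) = q + 1 := ⟨_, (Nat.sub_add_cancel h.2).symm⟩
  rw [lowerSymbol_eq, lowerSymbol_eq, e1, pairUp_zero hm, pairUp_self hm, pairUp_neg hm, hp, hq, he,
    pairUpWeight, hp, hq, mul_pow, Real.sq_sqrt (by positivity)]
  have hpq : p + q + i = N ∨ p + q + i + 1 = N := by
    by_contra hc
    apply hQ
    rw [pairIndicator, e1, pairUp_self hm, pairUp_neg hm, hp, hq]
    exact if_neg hc
  have hpq1 : (1 : ℝ) ≤ (p : ℝ) + q := by exact_mod_cast (show 1 ≤ p + q by omega)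
  have hpqN : (N : ℝ) - i + 1 ≤ p + q + 2 := by
    have : (N : ℝ) ≤ p + q + i + 1 := by exact_mod_cast (show N ≤ p + q + i + 1 by omega)
    linarith
  have hs2 : ((n.1 0 : ℝ) + 2) ≤ N := by
    exact_mod_cast (show n.1 0 + 2 ≤ N by omega)
  have key := hopping_bound (p := p) (q := q) h0 h1 hr hN hrN
    (show (0 : ℝ) < (n.1 0 : ℝ) + 2 by positivity) hs2 hpq1
  have hU := half_le_invK h0 h1 (show 3 ≤ (N : ℝ) - i + 1 by linarith)
  have hmono := invK_mono h0 h1 (show 0 < (N : ℝ) - i + 1 by linarith) hpqN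
  rw [KConst_eq]
  rw [← InteractingModes.phi]
  push_cast [Nat.add_sub_cancel]
  rw [one_div, inv_mul_eq_div, le_div_iff₀ (by linarith)]
  have hA : ((n.1 0 : ℝ) + 1) * (n.1 0 + 2) ≤ (n.1 0 + 2) ^ 2 := by nlinarith
  have hpp : (0 : ℝ) ≤ ((p : ℝ) + 1) * (q + 1) := by positivity
  calc (J.phi m / N) ^ 2 * (((n.1 0 : ℝ) + 1) * (n.1 0 + 2) * ((p + 1) * (q + 1))) *
        (4 * invK (e ^ 2) ((N : ℝ) - i + 1)) ≤
      (J.phi m / N) ^ 2 * ((n.1 0 + 2) ^ 2 * ((p + 1) * (q + 1))) *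
        (4 * invK (e ^ 2) (p + q + 2)) := by
        gcongr
    _ = J.phi m ^ 2 * (4 * invK (e ^ 2) (p + q + 2) *
        (((n.1 0 + 2) / N) ^ 2 * ((p + 1) * (q + 1)))) := by
        field_simp
    _ ≤ _ := mul_le_mul_of_nonneg_left key (by positivity)
    _ = _ := by
        ring

/-- The relative bound of the hopping terms. -/
theorem exists_hopping_factor {e r : ℝ} (h0 : 0 < e) (h1 : e ≤ 1 / 100) (he : J.eps m = e ^ 2)
    (hr : 0 ≤ r) (hrN : 6 * (r + 2 / N) ≤ e ^ 4) (hγ : 0 < J.phi m * (gapConst e - r)) {i : ℕ}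
    (hi : i + 2 ≤ N) :
    ∃ T : FockN d N →L[ℂ] FockN d N, ‖T‖ ≤ Real.sqrt (KConst (2 * e ^ 2) (e ^ 2) N i) ∧
      Wup J N m i =
        mulOp (fun n => Real.sqrt (lowerSymbol J N m (J.phi m * (gapConst e - r)) n)) * T *
        mulOp (fun n => Real.sqrt (lowerSymbol J N m (J.phi m * (gapConst e - r)) n)) := by
  obtain ⟨C, hC⟩ := exists_sqrt_lowerSymbol_le J N m (J.phi m * (gapConst e - r))
  have hm := J.mode_ne_zero m
  have hg : ∀ n, 0 < lowerSymbol J N m (J.phi m * (gapConst e - r)) n := fun n =>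
    hγ.trans_le (le_lowerSymbol n)
  have key := fun n => pairUpWeight_sq_le (m := m) (N := N) h0 h1 he hr hrN hi n
  have hb := isBoundedShift_pairUp (v.coeff (J.mode m) / N) N hm
  have hK := KConst_pos h0 h1 hi
  generalize lowerSymbol J N m (J.phi m * (gapConst e - r)) = g at *
  generalize hτ : liftMap N (pairUp (J.mode m)) = τ at *
  -- The weight of `W*_{i-2,i}` is divided by the square roots of the diagonal symbol at both ends
  -- of the hop; `‖T‖² ≤ K_i` then becomes the pointwise bound of matrix elements.
  let c : NConf d N → ℝ := fun n => pairIndicator N (J.mode m) (i - 2) n *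
    pairUpWeight (v.coeff (J.mode m) / N) (J.mode m) n.1 * pairIndicator N (J.mode m) i (τ n) /
      (Real.sqrt (g n) * Real.sqrt (g (τ n)))
  have hcb : IsBoundedShift (fun n => (c n : ℂ)) τ
      (Real.sqrt (KConst (2 * e ^ 2) (e ^ 2) N i)) := by
    refine ⟨fun n hn n' hn' h => hb.injOn ?_ ?_ h, fun n => ?_, Real.sqrt_nonneg _⟩
    · intro h
      apply hn
      simp only [c, Complex.ofReal_eq_zero.mp h, mul_zero, zero_mul, zero_div, Complex.ofReal_zero]
    · intro h
      apply hn'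
      simp only [c, Complex.ofReal_eq_zero.mp h, mul_zero, zero_mul, zero_div, Complex.ofReal_zero]
    · rw [Complex.norm_real, Real.norm_eq_abs]
      apply Real.le_sqrt_of_sq_le
      rw [sq_abs]
      simp only [c]
      have hgg : 0 < g n * g (τ n) := mul_pos (hg _) (hg _)
      rw [div_pow, mul_pow (Real.sqrt (g n)), Real.sq_sqrt (hg _).le, Real.sq_sqrt (hg _).le,
        div_le_iff₀ hgg]
      by_cases hn : pairUpWeight (v.coeff (J.mode m) / N) (J.mode m) n.1 = 0
      · rw [hn, mul_zero, zero_mul, zero_pow two_ne_zero]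
        positivity
      by_cases hQ : pairIndicator N (J.mode m) i (τ n) = 0
      · rw [hQ, mul_zero, zero_pow two_ne_zero]
        positivity
      refine le_trans ?_ (key n hn hQ)
      have a1 : pairIndicator N (J.mode m) (i - 2) n ^ 2 ≤ 1 :=
        (sq_le_one_iff_abs_le_one _).mpr (abs_pairIndicator_le _ _ _ _)
      have a2 : pairIndicator N (J.mode m) i (τ n) ^ 2 ≤ 1 :=
        (sq_le_one_iff_abs_le_one _).mpr (abs_pairIndicator_le _ _ _ _)
      rw [mul_pow, mul_pow]
      calc _ ≤ 1 * pairUpWeight (v.coeff (J.mode m) / N) (J.mode m) n.1 ^ 2 * 1 := by gcongr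
        _ = _ := by ring
  refine ⟨shiftOp (fun n => (c n : ℂ)) τ, hcb.norm_le, ?_⟩
  ext ψ n
  change opQ J N m (i - 2) (opWstar J N m (opQ J N m i ψ)) n =
    mulOp (fun n => Real.sqrt (g n)) (shiftOp (fun n => (c n : ℂ)) τ
      (mulOp (fun n => Real.sqrt (g n)) ψ)) n
  rw [opQ_apply', opWstar_eq, hτ, hb.apply, opQ_apply', mulOp_apply hC, hcb.apply, mulOp_apply hC]
  have e1 : c n * (Real.sqrt (g n) * Real.sqrt (g (τ n))) = pairIndicator N (J.mode m) (i - 2) n *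
      pairUpWeight (v.coeff (J.mode m) / N) (J.mode m) n.1 * pairIndicator N (J.mode m) i (τ n) :=
    div_mul_cancel₀ _ (mul_pos (Real.sqrt_pos.mpr (hg _)) (Real.sqrt_pos.mpr (hg _))).ne'
  have e2 : (c n : ℂ) * (Real.sqrt (g n) * Real.sqrt (g (τ n))) =
      pairIndicator N (J.mode m) (i - 2) n *
      pairUpWeight (v.coeff (J.mode m) / N) (J.mode m) n.1 * pairIndicator N (J.mode m) i (τ n) := by
    exact_mod_cast e1
  linear_combination -(ψ (τ n)) * e2

/-- The hypotheses of the abstract expansion hold for the model. -/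
theorem expansionBounds {e r ν w : ℝ} (h0 : 0 < e) (h1 : e ≤ 1 / 100) (he : J.eps m = e ^ 2)
    (hτ : 10 * e ≤ (e ^ 2) ^ thetaConst ν) (hτ1 : (e ^ 2) ^ thetaConst ν ≤ 1 / 10)
    (hr : 0 ≤ r) (hN : 2 ≤ N) (hrN : 6 * (r + 2 / N) ≤ e ^ 4)
    (hw : w + J.phi m * (gapConst e - r) ≤ infSpec (interactionHam J N (Finset.Iio m))) :
    (∀ i : ℕ, IsCompressedResolvent (bogHam J N (Finset.Iic m)) (opQ J N m i) (w : ℂ)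
      (resolventR J N m w i)) ∧
    ExpansionBounds (Wdown J N m) (Wup J N m) (resolventR J N m w)
      (KConst (2 * e ^ 2) (e ^ 2) N) (ZConst ν (2 * e ^ 2) (e ^ 2) N) (N - 2) := by
  have hγ : 0 < J.phi m * (gapConst e - r) := by
    refine mul_pos (J.phi_pos m) ?_
    have := (gapConst_bounds h0 h1).1
    have h4 : e ^ 4 ≤ 1 := pow_le_one₀ h0.le (by linarith)
    have : 0 ≤ (2 : ℝ) / N := by positivity
    linarith
  have hR := resolventR_dominated (J := J) (N := N) (m := m) hγ hw
  refine ⟨fun i => (hR i).1, fun i _ _ => (hR i).2.1, fun j hj h2 hjN X => ?_,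
    fun j hj h2 hjN => KConst_pos h0 h1 (by omega),
    fun j hj h2 hjN => KConst_le_ZConst h0 h1 hτ1 (by omega),
    fun j hj h2 hjN => ZConst_lt_one h0 h1 hτ hτ1 (by omega),
    fun j hj h2 hjN => KConst_mul_inv_le h0 h1 hτ hτ1 (by omega)⟩
  obtain ⟨T, hT, hWT⟩ := exists_hopping_factor (J := J) (m := m) (N := N) h0 h1 he hr hrN hγ
    (show j + 2 ≤ N by omega)
  obtain ⟨C, hC⟩ := exists_sqrt_lowerSymbol_le J N m (J.phi m * (gapConst e - r))
  have := norm_sandwich_dress_le (isSelfAdjoint_mulOp hC) (hR j).2.1 (hR (j - 2)).2.1 (hR j).2.2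
    (hR (j - 2)).2.2 (Wdown_eq_star J N m j) hWT hT X
  rwa [Real.sq_sqrt (KConst_pos h0 h1 (by omega)).le] at this

end Model

/-! ### Thresholds for `ε` and `N` -/

/-- As `Θ ≤ 1/4`, one has `ε^Θ ≥ √e ≥ 10e` once `e ≤ 1/100`. As `Θ > 0`, which is where `ν > 11/8`
enters, `ε^Θ` is small for small `ε`. -/
lemma exists_threshold {ν : ℝ} (hν : 11 / 8 < ν) : ∃ ε₀ : ℝ, 0 < ε₀ ∧ ∀ e : ℝ, 0 < e →
    e ^ 2 ≤ ε₀ → e ≤ 1 / 100 ∧ 10 * e ≤ (e ^ 2) ^ thetaConst ν ∧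
      (e ^ 2) ^ thetaConst ν ≤ 1 / 10 := by
  have hθ : 0 < thetaConst ν := lt_min (by linarith) (by norm_num)
  have hθ4 : thetaConst ν ≤ 1 / 4 := min_le_right _ _
  refine ⟨min ((1 / 100) ^ 2) ((1 / 10) ^ (1 / thetaConst ν)), by positivity, fun e h0 he => ?_⟩
  have h1 : e ≤ 1 / 100 :=
    le_of_sq_le_sq (he.trans (min_le_left _ _)) (by norm_num)
  refine ⟨h1, ?_, ?_⟩
  · have e1 : Real.sqrt e = (e ^ 2) ^ (1 / 4 : ℝ) := by
      rw [Real.sqrt_eq_rpow, ← Real.rpow_natCast, ← Real.rpow_mul h0.le]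
      norm_num
    have e2 : (e ^ 2) ^ (1 / 4 : ℝ) ≤ (e ^ 2) ^ thetaConst ν :=
      Real.rpow_le_rpow_of_exponent_ge (by positivity) (by nlinarith) hθ4
    rw [← e1] at e2
    refine le_trans ?_ e2
    apply Real.le_sqrt_of_sq_le
    nlinarith
  · calc (e ^ 2) ^ thetaConst ν ≤ ((1 / 10) ^ (1 / thetaConst ν)) ^ thetaConst ν :=
        Real.rpow_le_rpow (by positivity) (he.trans (min_le_right _ _)) hθ.le
      _ = 1 / 10 := by
        rw [← Real.rpow_mul (by norm_num), one_div_mul_cancel hθ.ne', Real.rpow_one]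

lemma exists_particle_number {c b : ℝ} (hc : 0 < c) :
    ∃ N₀ : ℕ, ∀ N : ℕ, N₀ ≤ N → 2 ≤ N ∧ 0 ≤ Real.log N ∧
      6 * (b / Real.log N ^ (1 / 8 : ℝ) + 2 / N) ≤ c := by
  have t1 : Tendsto (fun N : ℕ => Real.log (N : ℝ) ^ (1 / 8 : ℝ)) atTop atTop :=
    (tendsto_rpow_atTop (by norm_num)).comp
      (Real.tendsto_log_atTop.comp tendsto_natCast_atTop_atTop)
  have t2 : Tendsto (fun N : ℕ => 6 * (b / Real.log N ^ (1 / 8 : ℝ) + 2 / (N : ℝ))) atTop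
      (𝓝 (6 * (0 + 0))) :=
    ((t1.const_div_atTop b).add (tendsto_natCast_atTop_atTop.const_div_atTop 2)).const_mul 6
  have h := (t2.eventually (gt_mem_nhds (show 6 * (0 + 0) < c by simpa using hc))).and
    (eventually_ge_atTop 2)
  obtain ⟨N₀, hN₀⟩ := eventually_atTop.mp h
  refine ⟨N₀, fun N hN => ⟨(hN₀ N hN).2, Real.log_natCast_nonneg N, (hN₀ N hN).1.le⟩⟩

end BoseGas

theorem mainTheorem6 (ν : ℝ) (hν : 11 / 8 < ν) :
    ∃ a : ℝ → ℝ, (fun ε => a ε - 2 * ε) =O[𝓝[>] 0] (fun ε : ℝ => ε ^ ν) ∧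
    ∃ ε₀ : ℝ, 0 < ε₀ ∧
    ∀ (d : ℕ) (L : ℝ), 0 < L → ∀ (v : PairPotential d L) (M : ℕ) (J : InteractingModes v M)
      (m : Fin M), J.eps m ≤ ε₀ →
    ∃ N₀ : ℕ, ∀ N : ℕ, N₀ ≤ N → Even N →
    infSpec (interactionHam J N (Finset.Iio m)) - prevEnergy J N m
      ≥ -((m : ℕ) : ℝ) / (Real.log N) ^ (1 / 8 : ℝ) →
    ∀ δ w : ℝ, δ ≤ 1 + Real.sqrt (J.eps m) →
      w ≤ prevEnergy J N m + J.energy m +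
        (δ - 1) * J.phi m * Real.sqrt (J.eps m ^ 2 + 2 * J.eps m) →
    -- the resolvents exist and are positive, and the series defining `Γ` converge in norm
    (∀ i : ℕ, Even i → i + 2 ≤ N →
      IsCompressedResolvent (bogHam J N (Finset.Iic m)) (opQ J N m i) (w : ℂ)
        (resolventR J N m w i) ∧ 0 ≤ resolventR J N m w i) ∧
    (∀ i : ℕ, Even i → 2 ≤ i → i + 4 ≤ N →
      Summable (fun n : ℕ => (gammaOp J N m w i * resolventR J N m w i) ^ n) ∧
      Summable (fun n : ℕ => sandwich (resolventR J N m w) i (gammaOp J N m w i) ^ n)) ∧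
    -- the constants are meaningful
    (∀ f : ℕ, Even f → 4 ≤ f → f + 2 ≤ N →
      0 < KConst (a (J.eps m)) (J.eps m) N f ∧
      0 < ZConst ν (a (J.eps m)) (J.eps m) N (f - 2) ∧
      ZConst ν (a (J.eps m)) (J.eps m) N (f - 2) < 1) ∧
    -- the splitting and the estimates
    ∀ h : ℕ, 2 ≤ h → ∀ i : ℕ, Even i → 4 ≤ i → i + 2 ≤ N →
      gammaOp J N m w i =
        ∑ l ∈ evens 2 (i - 2), gammaMinus J N m w h i l +
        ∑ l ∈ evens 2 (i - 2), gammaPlus J N m w h i l ∧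
      ∀ l : ℕ, Even l → 2 ≤ l → l + 2 ≤ i →
        ‖sandwich (resolventR J N m w) i (gammaMinus J N m w h i l)‖ ≤
          ∏ f ∈ evens (l + 2) i, KConst (a (J.eps m)) (J.eps m) N f /
            (1 - ZConst ν (a (J.eps m)) (J.eps m) N (f - 2)) ^ 2 ∧
        ‖sandwich (resolventR J N m w) i (gammaPlus J N m w h i l)‖ ≤
          ZConst ν (a (J.eps m)) (J.eps m) N l ^ h *
          ∏ f ∈ evens (l + 2) i, KConst (a (J.eps m)) (J.eps m) N f /
            (1 - ZConst ν (a (J.eps m)) (J.eps m) N (f - 2)) ^ 2 := by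
  obtain ⟨ε₀, hε₀, hthr⟩ := exists_threshold hν
  -- The choice `a_ε = 2ε` is exact, so the error term is zero.
  refine ⟨fun ε => 2 * ε, ?_, ε₀, hε₀, fun d L hL v M J m hε => ?_⟩
  · simpa using isBigO_zero _ _
  have hφ := J.phi_pos m
  have hε0 : 0 < J.eps m := div_pos (kSq_pos hL (J.mode_ne_zero m)) hφ
  obtain ⟨e, he0, he⟩ : ∃ e : ℝ, 0 < e ∧ J.eps m = e ^ 2 :=
    ⟨Real.sqrt (J.eps m), Real.sqrt_pos.mpr hε0, (Real.sq_sqrt hε0.le).symm⟩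
  obtain ⟨h1, hτ, hτ1⟩ := hthr e he0 (he ▸ hε)
  obtain ⟨N₀, hN₀⟩ := exists_particle_number (b := ((m : ℕ) : ℝ) / J.phi m)
    (show 0 < e ^ 4 by positivity)
  refine ⟨N₀, fun N hN _ hinf δ w hδ hw => ?_⟩
  obtain ⟨hN2, hlog, hrN⟩ := hN₀ N hN
  -- For the largest admissible `δ - 1 = √ε` the bound on `w` is `z - φ · gapConst e`, with `z` the
  -- previous ground state energy. The loss allowed by the spectral hypothesis is `φ r`; since
  -- indices start from `0`, the number `m - 1` of the statement appears as `m`.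
  have hw' : w + J.phi m * (gapConst e - ((m : ℕ) : ℝ) / J.phi m / Real.log N ^ (1 / 8 : ℝ)) ≤
      infSpec (interactionHam J N (Finset.Iio m)) := by
    have hk : kSq L (J.mode m) = e ^ 2 * J.phi m := by rw [kSq_eq, he]
    have hsq : Real.sqrt (kSq L (J.mode m) ^ 2 + 2 * J.phi m * kSq L (J.mode m)) =
        J.phi m * Real.sqrt (e ^ 4 + 2 * e ^ 2) := by
      rw [hk, show (e ^ 2 * J.phi m) ^ 2 + 2 * J.phi m * (e ^ 2 * J.phi m) =
        J.phi m ^ 2 * (e ^ 4 + 2 * e ^ 2) by ring, Real.sqrt_mul (sq_nonneg _), Real.sqrt_sq hφ.le]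
    rw [InteractingModes.energy, hsq, hk, he, ← pow_mul] at hw
    rw [he, Real.sqrt_sq he0.le] at hδ
    have hδ' : (δ - 1) * J.phi m * Real.sqrt (e ^ (2 * 2) + 2 * e ^ 2) ≤
        e * J.phi m * Real.sqrt (e ^ 4 + 2 * e ^ 2) := by
      gcongr
      linarith
    have hd : J.phi m * (((m : ℕ) : ℝ) / J.phi m / Real.log N ^ (1 / 8 : ℝ)) =
        ((m : ℕ) : ℝ) / Real.log N ^ (1 / 8 : ℝ) := by
      field_simp
    rw [neg_div] at hinf
    rw [mul_sub, hd, gapConst]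
    linarith
  obtain ⟨hR, B⟩ := expansionBounds (ν := ν) he0 h1 he hτ hτ1
    (div_nonneg (by positivity) (Real.rpow_nonneg hlog _)) hN2 hrN hw'
  dsimp only
  rw [he]
  refine ⟨fun i hi hiN => ⟨hR i, B.nonneg i hi (by omega)⟩,
    fun i hi h2 hiN => ⟨B.summable_mul hi h2 (by omega), B.summable_sandwich hi h2 (by omega)⟩,
    fun f hf h4 hfN => ⟨B.K_pos f hf (by omega) (by omega),
      B.Z_pos (by grind) (by omega) (by omega),
      B.Z_lt_one (f - 2) (by grind) (by omega) (by omega)⟩,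
    fun h hh i hi h4 hiN => ⟨B.Gam_eq_sum (by omega) hi h4 (by omega),
      fun l hl h2 hli => B.norm_terms_le (by omega) hi h4 (by omega) hl h2 hli⟩⟩
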